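/- **Proposition (general finite-range approximation).** Let $\mathcal S^2\subset\mathbb R^3$ be the unit sphere with area measure $dx$ (total mass $4\pi$), geodesic distance $d$ and north pole $\eta=(0,0,1)$, and let $\mathcal D_\rho=\{x: d(\eta,x)\le\rho\}$. Let $P_\ell$ be the Legendre polynomials, $N_\ell=(2\ell+1)/(4\pi)$, and $\{Y_{\ell,m}\}_{\ell\ge 0,\,-\ell\le m\le\ell}$ the standard real $L^2(dx)$-orthonormal spherical harmonics, so that $Y_{\ell,0}(x)=\sqrt{N_\ell}\,P_\ell(\cos d(\eta,x))$. Let $(c_\ell)_{\ell\ge0}$ be real numbers with $\sum_\ell c_\ell^2\ell^2<\infty$, and let $f$ be the isotropic Gaussian field $$f(x)=\sum_{\ell\ge 0}\frac{c_\ell}{\sqrt{N_\ell}}\sum_{m=-\ell}^{\ell}a_{\ell,m}Y_{\ell,m}(x)$$ on a probability space $(\Omega,\mathbb P)$, where the $a_{\ell,m}$ are i.i.d. standard Gaussian random variables on $\Omega$ and the series converges in mean square at each $x$. Define, as functions of the angle $\theta=d(\eta,x)$, $$K(\theta)=\sum_\ell c_\ell^2P_\ell(\cos\theta),\qquad q(\theta)=\sum_\ell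 c_\ell\sqrt{N_\ell}\,P_\ell(\cos\theta),$$ so that $K$ is the covariance kernel of $f$; the series for $q$ converges absolutely for $0<\theta<\pi$. We also write $q(x)=q(d(\eta,x))$. For $0\le r\le\pi/2$ and $\theta\in[0,\pi]$ put $$q_1=\int_{\mathcal S^2\setminus\mathcal D_{r/4}}q(x)^2\,dx,\qquad q_2(\theta)=|K(\theta)|+\int_{\mathcal D_{r/2}}|q(x)|\,dx\cdot\sup_{\theta'\in[\theta-r/2,\,\theta+r/2]\cap(0,\pi)}|q(\theta')|,$$ $$q_3=\int_{\mathcal S^2\setminus\mathcal D_{r/4}}\|\nabla_{\mathcal S^2}q(x)\|_2^2\,dx+\sup_{x\in\mathcal D_{r/2}\setminus\mathcal D_{r/4}}q(x)^2,$$ with values in $[0,\infty]$, where $0\cdot\infty=0$, the supremum of the empty set is $0$, and $\nabla_{\mathcal S^2}$ is the spherical gradient (which for $q$ exists at almost every point). Then there is an absolute constant $c>0$ such that, for all $(c_\ell)$, $f$ as above and every $r\in[0,\pi/2]$, there exists on the same probability space $\Omega$ (so, coupled with $f$) a centred isotropic Gaussian field $f^{(r)}$ on $\mathcal S^2$ with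 continuous sample paths which is $r$-range dependent, i.e. $\mathrm{Cov}(f^{(r)}(x),f^{(r)}(y))=0$ whenever $d(x,y)\ge r$, and such that, for all $x,y\in\mathcal S^2$ with $\theta=d(x,y)$, $$\left|\mathrm{Cov}\big((f-f^{(r)})(x),(f-f^{(r)})(y)\big)\right|\le c\,q_1\ \text{ if }\theta\le r,\qquad \left|\mathrm{Cov}\big((f-f^{(r)})(x),(f-f^{(r)})(y)\big)\right|\le c\,q_2(\theta)\ \text{ if }\theta\ge r,$$ and, for every $x\in\mathcal S^2$, the spherical gradient $\nabla_{\mathcal S^2}(f-f^{(r)})(x)$ exists in the mean-square sense and $$\mathbb E\big[\|\nabla_{\mathcal S^2}(f-f^{(r)})(x)\|_2^2\big]\le c\,q_3 .$$ -/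

import Mathlib

open MeasureTheory ProbabilityTheory Filter Topology
open scoped ENNReal NNReal

namespace SphericalField

noncomputable section

/-- Three-dimensional Euclidean space. -/
abbrev E3 : Type := EuclideanSpace ℝ (Fin 3)

/-- The unit sphere `S²` in `ℝ³`. -/
abbrev S2 : Type := Metric.sphere (0 : E3) 1

/-- The north pole `η = (0, 0, 1)`. -/
def northPole : S2 :=
  ⟨!₂[(0 : ℝ), 0, 1], by simp [EuclideanSpace.norm_eq, Fin.sum_univ_three]⟩

/-- The (unnormalised) area measure on `S²`, of total mass `4π`. -/
def area : Measure S2 := (volume : Measure E3).toSphere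

/-- The spherical (geodesic) distance on `S²`, with values in `[0, π]`. -/
def sphDist (x y : S2) : ℝ := InnerProductGeometry.angle (x : E3) (y : E3)

/-- The spherical cap of radius `r` centred at the north pole. -/
def cap (r : ℝ) : Set S2 := {x | sphDist northPole x ≤ r}

/-- The Legendre polynomial `P_ℓ`, by Rodrigues' formula. -/
def legendre (ℓ : ℕ) : Polynomial ℝ :=
  Polynomial.C (1 / (2 ^ ℓ * (ℓ.factorial : ℝ))) *
    Polynomial.derivative^[ℓ] ((Polynomial.X ^ 2 - 1) ^ ℓ)

/-- `N_ℓ = (2ℓ + 1) / (4π)`. -/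
def N (ℓ : ℕ) : ℝ := (2 * ℓ + 1) / (4 * Real.pi)

/-- The standard real spherical harmonic `Y_{ℓ,m}`, `-ℓ ≤ m ≤ ℓ`. With `k = |m|`, the factor
`sin^k θ cos (kφ)` (resp. `sin^k θ sin (kφ)`) is the real (resp. imaginary) part of `(x₀ + i x₁)^k`,
and `sin^k θ · P_ℓ^{(k)}(cos θ)` is the associated Legendre function. In particular
`Y_{ℓ,0} = √N_ℓ · P_ℓ(cos θ)`. -/
def Y (ℓ : ℕ) (m : ℤ) (x : S2) : ℝ :=
  let k : ℕ := m.natAbs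
  let A : ℝ := √(N ℓ * ((ℓ - k).factorial / (ℓ + k).factorial))
  let p : ℝ := (Polynomial.derivative^[k] (legendre ℓ)).eval ((x : E3) 2)
  let w : ℂ := (((x : E3) 0 : ℂ) + ((x : E3) 1 : ℂ) * Complex.I) ^ k
  if m = 0 then A * p
  else if 0 < m then √2 * A * w.re * p
  else √2 * A * w.im * p

/-- The indices `(ℓ, m)` with `ℓ ≥ 0` and `-ℓ ≤ m ≤ ℓ`. -/
abbrev HarmonicIndex : Type := (ℓ : ℕ) × Finset.Icc (-(ℓ : ℤ)) (ℓ : ℤ)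

/-- The partial sums over degrees `ℓ < L` of the random series
`∑_ℓ (c_ℓ / √N_ℓ) ∑_{m=-ℓ}^{ℓ} a_{ℓ,m} Y_{ℓ,m}(x)`. -/
def partialField {Ω : Type*} (c : ℕ → ℝ) (a : HarmonicIndex → Ω → ℝ) (L : ℕ) (x : S2) (ω : Ω) : ℝ :=
  ∑ ℓ ∈ Finset.range L, c ℓ / √(N ℓ) *
    ∑ m : Finset.Icc (-(ℓ : ℤ)) (ℓ : ℤ), a ⟨ℓ, m⟩ ω * Y ℓ m x

/-- The coefficients `a_{ℓ,m}` are i.i.d. standard Gaussian random variables. -/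
structure IsIIDStandardGaussian {Ω : Type*} [MeasurableSpace Ω] (a : HarmonicIndex → Ω → ℝ)
    (P : Measure Ω) : Prop where
  hasLaw : ∀ i, HasLaw (a i) (gaussianReal 0 1) P
  indep : iIndepFun a P

/-- `f` is the field `f(x) = ∑_ℓ (c_ℓ / √N_ℓ) ∑_{m=-ℓ}^{ℓ} a_{ℓ,m} Y_{ℓ,m}(x)`, the series
converging in mean square at every point `x` (this determines `f` up to modification). -/
def IsFieldSeries {Ω : Type*} [MeasurableSpace Ω] (c : ℕ → ℝ) (a : HarmonicIndex → Ω → ℝ)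
    (f : S2 → Ω → ℝ) (P : Measure Ω) : Prop :=
  ∀ x, MemLp (f x) 2 P ∧
    Tendsto (fun L ↦ eLpNorm (fun ω ↦ f x ω - partialField c a L x ω) 2 P) atTop (𝓝 0)

/-- The random field `g` is isotropic: its finite-dimensional distributions are invariant under
the rotations of the sphere. -/
def IsIsotropic {Ω : Type*} [MeasurableSpace Ω] (g : S2 → Ω → ℝ) (P : Measure Ω) : Prop :=
  ∀ R : E3 ≃ₗᵢ[ℝ] E3, LinearMap.det (R.toLinearEquiv : E3 →ₗ[ℝ] E3) = 1 →
    ∀ (n : ℕ) (x y : Fin n → S2), (∀ i, (y i : E3) = R (x i)) →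
      IdentDistrib (fun ω i ↦ g (y i) ω) (fun ω i ↦ g (x i) ω) P P

/-- The random field `g` is `r`-range dependent. -/
def IsRangeDependent {Ω : Type*} [MeasurableSpace Ω] (r : ℝ) (g : S2 → Ω → ℝ) (P : Measure Ω) :
    Prop :=
  ∀ x y : S2, r ≤ sphDist x y → covariance (g x) (g y) P = 0

/-- The random tangent vector `G` is the mean-square spherical gradient of the field `h` at `x`:
the first-order expansion of `h` at `x` with gradient `G` holds in `L²(P)`. -/
structure IsMeanSquareGradient {Ω : Type*} [MeasurableSpace Ω] (h : S2 → Ω → ℝ) (P : Measure Ω)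
    (x : S2) (G : Ω → E3) : Prop where
  memLp : MemLp G 2 P
  tangent : ∀ᵐ ω ∂P, inner ℝ (G ω) (x : E3) = 0
  expansion : Tendsto
    (fun y : S2 ↦ eLpNorm (fun ω ↦ h y ω - h x ω - inner ℝ (G ω) ((y : E3) - (x : E3))) 2 P /
      ‖(y : E3) - (x : E3)‖ₑ) (𝓝[≠] x) (𝓝 0)

/-- The spherical gradient of `g : S² → ℝ` at `x`: the Euclidean gradient at `x` of the
extension of `g` that is constant along rays from the origin. -/
def sphericalGradient (g : S2 → ℝ) (x : S2) : E3 :=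
  gradient (fun y : E3 ↦ if h : y = 0 then 0 else g ⟨‖y‖⁻¹ • y, by simp [norm_smul, h]⟩) (x : E3)

/-- The covariance kernel `K(θ) = ∑_ℓ c_ℓ² P_ℓ(cos θ)`. -/
def K (c : ℕ → ℝ) (θ : ℝ) : ℝ := ∑' ℓ, c ℓ ^ 2 * (legendre ℓ).eval (Real.cos θ)

/-- The zonal function `q` in terms of the angle, `q(θ) = ∑_ℓ c_ℓ √N_ℓ P_ℓ(cos θ)`.
If `∑ c_ℓ² ℓ² < ∞` then the series converges absolutely, locally uniformly on `0 < θ < π`; at the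
poles `θ = 0, π` it may diverge. -/
def qAngle (c : ℕ → ℝ) (θ : ℝ) : ℝ := ∑' ℓ, c ℓ * √(N ℓ) * (legendre ℓ).eval (Real.cos θ)

/-- The zonal function `q` on the sphere. -/
def q (c : ℕ → ℝ) (x : S2) : ℝ := qAngle c (sphDist northPole x)

/-- `q₁ = ∫_{S² ∖ D_{r/4}} q²`. -/
def q₁ (c : ℕ → ℝ) (r : ℝ) : ℝ≥0∞ :=
  ∫⁻ x in (cap (r / 4))ᶜ, ENNReal.ofReal (q c x ^ 2) ∂area

/-- `q₂(θ) = |K(θ)| + ∫_{D_{r/2}} |q| · sup_{θ' ∈ [θ - r/2, θ + r/2]} |q(θ')|`, where the supremum is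
over angles `θ'` of points other than the poles, where the series of `q` may diverge. The value may
be `∞`. -/
def q₂ (c : ℕ → ℝ) (r θ : ℝ) : ℝ≥0∞ :=
  ENNReal.ofReal |K c θ| +
    (∫⁻ x in cap (r / 2), ENNReal.ofReal |q c x| ∂area) *
      ⨆ θ' ∈ Set.Icc (θ - r / 2) (θ + r / 2) ∩ Set.Ioo 0 Real.pi, ENNReal.ofReal |qAngle c θ'|

/-- `q₃ = ∫_{S² ∖ D_{r/4}} ‖∇q‖² + sup_{D_{r/2} ∖ D_{r/4}} q²`. -/
def q₃ (c : ℕ → ℝ) (r : ℝ) : ℝ≥0∞ :=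
  (∫⁻ x in (cap (r / 4))ᶜ, ENNReal.ofReal (‖sphericalGradient (q c) x‖ ^ 2) ∂area) +
    ⨆ x ∈ cap (r / 2) \ cap (r / 4), ENNReal.ofReal (q c x ^ 2)

end

end SphericalField

/-! Write `Q` for the zonal function q in terms of the height t = cos θ. Its coefficients in the
orthonormal system √N_ℓ P_ℓ are the c_ℓ. By the addition theorem, zonal kernels A, B with
coefficients α_ℓ, β_ℓ satisfy ∫ A(x·z) B(y·z) dz = ∑ α_ℓ β_ℓ P_ℓ(x·y) (`hasSum_legendreCoeff_mul`).
So f behaves like white noise on the sphere convolved with q, and a different kernel with the same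
a_{ℓ,m} gives a field coupled with f.

Let Ψ be a C¹ cutoff of the height, 0 in D_{r/4} and 1 outside D_{r/2}, and split Q = ΨQ + (1-Ψ)Q.
The field f^{(r)} has kernel (1-Ψ)Q. For axes at distance at least r two copies of this kernel have
almost disjoint supports, which is r-range dependence. The difference f - f^{(r)} has kernel ΨQ, so
its variance is at most ∫ (ΨQ)² ≤ q₁. For θ ≥ r its covariance is K(θ) minus twice the cross term ∫
Q(x·z) ((1-Ψ)Q)(y·z) dz. There z lies within r/2 of y, so d(x,z) is within r/2 of θ, and q₂ appears.

The mean-square gradient is controlled by ∑ d_ℓ² ℓ(ℓ+1), where d_ℓ are the coefficients of ΨQ.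
Green's formula and Bessel's inequality bound this by the Dirichlet energy of ΨQ (`energy_cut_le`).
In the product rule the term with Ψ' costs the supremum of q² on the annulus times the energy of Ψ,
and that energy is bounded uniformly in r because Dirichlet energy is scale invariant in dimension
two (`exists_isCutoff`). Finite energy of Q and ΨQ also gives finite energy of (1-Ψ)Q, so f^{(r)} is
Lipschitz in mean square and chaining yields a continuous version
(`IsIsonormal.exists_continuous_modification`).

Two Sonin-type bounds on Legendre polynomials support this: √N_ℓ |P_ℓ(cos θ)| sin θ ≤ 1, for the
convergence of q, and |P_ℓ'| ≤ ℓ(ℓ+1)/2, for Lipschitz estimates. Probability enters through a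
linear isometry `W` from coefficient sequences into L²(P) with Gaussian values, which turns
covariances into inner products. -/

namespace SphericalField

/-! ### Legendre polynomials: differential equation, orthogonality, Sonin bounds -/

section Legendre

open Polynomial

/-- For u = (X²-1)^ℓ one has (X²-1)u' = 2ℓXu; differentiating j times gives the identity. At j = 0
the truncated index j - 1 is harmless because its coefficient is 0. -/
theorem iterate_derivative_sq_sub_one_pow (ℓ j : ℕ) :
    ((X : ℝ[X]) ^ 2 - 1) * derivative^[j + 1] (((X : ℝ[X]) ^ 2 - 1) ^ ℓ) =
      C (2 * (ℓ : ℝ) - 2 * j) * X * derivative^[j] (((X : ℝ[X]) ^ 2 - 1) ^ ℓ) +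
      C ((j : ℝ) * (2 * ℓ - j + 1)) * derivative^[j - 1] (((X : ℝ[X]) ^ 2 - 1) ^ ℓ) := by
  induction j with
  | zero =>
    simp only [zero_add, Function.iterate_one, Function.iterate_zero, id_eq, Nat.cast_zero,
      mul_zero, sub_zero, zero_mul, map_zero, add_zero]
    rcases ℓ with _ | ℓ
    · simp
    · rw [derivative_pow]
      simp only [derivative_sub, derivative_X_pow, derivative_one, Nat.add_sub_cancel]
      simp only [map_mul, map_natCast, map_ofNat]
      push_cast
      ring
  | succ j ih =>
    have h := congrArg derivative ih
    rw [derivative_mul, ← Function.iterate_succ_apply' derivative (j + 1), derivative_add,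
      derivative_mul, derivative_mul, derivative_mul, ← Function.iterate_succ_apply' derivative j,
      derivative_C, derivative_C, derivative_X, derivative_sub, derivative_X_pow,
      derivative_one] at h
    have h2 : C ((j : ℝ) * (2 * ℓ - j + 1)) *
        derivative (derivative^[j - 1] (((X : ℝ[X]) ^ 2 - 1) ^ ℓ)) =
        C ((j : ℝ) * (2 * ℓ - j + 1)) * derivative^[j] (((X : ℝ[X]) ^ 2 - 1) ^ ℓ) := by
      rcases j with _ | j
      · simp
      · rw [← Function.iterate_succ_apply' derivative]; rfl
    rw [h2] at h
    simp only [Nat.add_sub_cancel]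
    simp only [map_mul, map_sub, map_add, map_natCast, map_ofNat, map_one, Nat.cast_add,
      Nat.cast_one] at h ⊢
    simp only [Nat.cast_ofNat, Nat.add_one_sub_one, pow_one] at h
    linear_combination h

theorem iterate_derivative_legendre (ℓ k : ℕ) :
    derivative^[k] (legendre ℓ) = C (1 / (2 ^ ℓ * (ℓ.factorial : ℝ))) *
      derivative^[ℓ + k] ((X ^ 2 - 1) ^ ℓ) := by
  rw [legendre, iterate_derivative_C_mul, ← Function.iterate_add_apply, add_comm ℓ k]

/-- The differentiated Legendre equation. -/
theorem legendre_ode (ℓ k : ℕ) (t : ℝ) :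
    (1 - t ^ 2) * (derivative^[k + 2] (legendre ℓ)).eval t =
      2 * (k + 1) * t * (derivative^[k + 1] (legendre ℓ)).eval t -
        ((ℓ : ℝ) + k + 1) * (ℓ - k) * (derivative^[k] (legendre ℓ)).eval t := by
  have h := congrArg (eval t) (iterate_derivative_sq_sub_one_pow ℓ (ℓ + k + 1))
  simp only [iterate_derivative_legendre, eval_mul, eval_C, eval_sub, eval_pow, eval_X, eval_one,
    eval_add, Nat.add_sub_cancel] at h ⊢
  push_cast at h
  rw [show ℓ + (k + 2) = ℓ + k + 1 + 1 by ring, show ℓ + (k + 1) = ℓ + k + 1 by ring]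
  linear_combination (-(1 / (2 ^ ℓ * (ℓ.factorial : ℝ)))) * h

theorem eval_iterate_derivative_sq_sub_one_pow {ℓ j : ℕ} (h : j < ℓ) {ε : ℝ} (hε : ε ^ 2 = 1) :
    (derivative^[j] (((X : ℝ[X]) ^ 2 - 1) ^ ℓ)).eval ε = 0 := by
  obtain ⟨p, hp⟩ := pow_sub_dvd_iterate_derivative_pow ((X : ℝ[X]) ^ 2 - 1) ℓ j
  rw [hp]
  simp [hε, Nat.sub_ne_zero_of_lt h]

theorem legendre_eval_of_sq_eq_one (ℓ : ℕ) {ε : ℝ} (hε : ε ^ 2 = 1) :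
    (legendre ℓ).eval ε = ε ^ ℓ := by
  -- With ε = ±1, only the Leibniz term in which all ℓ derivatives hit (X - ε)^ℓ survives at ε. Both
  -- endpoints are handled at once.
  have h1 : ((X : ℝ[X]) ^ 2 - 1) ^ ℓ = (X - C ε) ^ ℓ * (X + C ε) ^ ℓ := by
    rw [← mul_pow]
    congr 1
    have : (C ε : ℝ[X]) ^ 2 = 1 := by rw [← C_pow, hε, C_1]
    linear_combination this
  rw [legendre, h1, iterate_derivative_mul, eval_mul, eval_C, eval_finsetSum,
    Finset.sum_eq_single 0]
  · simp only [Nat.choose_zero_right, Nat.sub_zero, Function.iterate_zero, id_eq, one_smul]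
    rw [iterate_derivative_X_sub_pow_self]
    simp only [eval_mul, eval_natCast, eval_pow, eval_add, eval_X, eval_C]
    rw [← two_mul, mul_pow]
    have := Nat.factorial_ne_zero ℓ
    field_simp
  · intro i _ hi
    rw [iterate_derivative_X_sub_pow]
    rcases Nat.lt_or_ge ℓ i with h | h
    · rw [Nat.choose_eq_zero_of_lt h]; simp
    · have : ℓ - (ℓ - i) = i := by omega
      simp [this, hi]
  · simp

theorem legendre_eval_one (ℓ : ℕ) : (legendre ℓ).eval 1 = 1 := by
  rw [legendre_eval_of_sq_eq_one ℓ (one_pow 2), one_pow]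

theorem integral_derivative_eval (p : ℝ[X]) (a b : ℝ) :
    ∫ t in a..b, (derivative p).eval t = p.eval b - p.eval a :=
  intervalIntegral.integral_eq_sub_of_hasDerivAt (fun t _ ↦ p.hasDerivAt t)
    ((Polynomial.continuous _).intervalIntegrable _ _)

/-- Repeated integration by parts moves all derivatives onto p. Boundary terms vanish since ±1 are
zeros of order ℓ of (X²-1)^ℓ. -/
theorem integral_mul_iterate_derivative_eq_zero (ℓ j : ℕ) (hj : j ≤ ℓ) (p : ℝ[X])
    (hp : derivative^[j] p = 0) :
    ∫ t in (-1 : ℝ)..1, (p * derivative^[j] (((X : ℝ[X]) ^ 2 - 1) ^ ℓ)).eval t = 0 := by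
  induction j generalizing p with
  | zero => simp only [Function.iterate_zero, id_eq] at hp; simp [hp]
  | succ j ih =>
    have h := ih (by omega) (derivative p) hp
    have h2 := integral_derivative_eval (p * derivative^[j] (((X : ℝ[X]) ^ 2 - 1) ^ ℓ)) (-1) 1
    simp only [derivative_mul, eval_add] at h2
    rw [intervalIntegral.integral_add ((Polynomial.continuous _).intervalIntegrable _ _)
      ((Polynomial.continuous _).intervalIntegrable _ _), h, zero_add,
      ← Function.iterate_succ_apply' derivative, eval_mul, eval_mul,
      eval_iterate_derivative_sq_sub_one_pow (by omega) (by norm_num),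
      eval_iterate_derivative_sq_sub_one_pow (by omega) (by norm_num)] at h2
    simpa using h2

theorem natDegree_legendre_le (ℓ : ℕ) : (legendre ℓ).natDegree ≤ ℓ := by
  rw [legendre]
  refine (natDegree_C_mul_le _ _).trans ((natDegree_iterate_derivative _ _).trans ?_)
  have : (((X : ℝ[X]) ^ 2 - 1) ^ ℓ).natDegree ≤ ℓ * 2 :=
    natDegree_pow_le_of_le ℓ ((natDegree_sub_le _ _).trans (by simp))
  omega

theorem integral_mul_legendre_eq_zero {ℓ : ℕ} {p : ℝ[X]} (hp : derivative^[ℓ] p = 0) :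
    ∫ t in (-1 : ℝ)..1, p.eval t * (legendre ℓ).eval t = 0 := by
  have h := integral_mul_iterate_derivative_eq_zero ℓ ℓ le_rfl p hp
  simp only [legendre, eval_mul, eval_C] at h ⊢
  simp_rw [mul_left_comm, intervalIntegral.integral_const_mul, h, mul_zero]

theorem integral_legendre_mul_legendre (ℓ k : ℕ) :
    ∫ t in (-1 : ℝ)..1, (legendre ℓ).eval t * (legendre k).eval t =
      if ℓ = k then 2 / (2 * (ℓ : ℝ) + 1) else 0 := by
  rcases lt_trichotomy ℓ k with h | rfl | h
  · rw [if_neg h.ne]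
    exact integral_mul_legendre_eq_zero
      (iterate_derivative_eq_zero ((natDegree_legendre_le ℓ).trans_lt h))
  · rw [if_pos rfl]
    set P := legendre ℓ with hP
    -- XP' - ℓP loses its leading term, so it is orthogonal to P. Integrating (XP²)' = 2(XP' - ℓP)P
    -- + (2ℓ+1)P² then gives the norm of P without computing leading coefficients.
    have hQ : derivative^[ℓ] (X * derivative P - C (ℓ : ℝ) * P) = 0 := by
      rcases Nat.eq_zero_or_pos ℓ with h0 | h0
      · have : P = C (P.coeff 0) := eq_C_of_natDegree_le_zero
          (by rw [hP]; exact (natDegree_legendre_le ℓ).trans h0.le)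
        subst h0
        rw [this]; simp
      · refine iterate_derivative_eq_zero_of_degree_lt ((degree_lt_iff_coeff_zero _ _).2 ?_)
        intro m hm
        rcases m with _ | m
        · omega
        · rw [coeff_sub, coeff_X_mul, coeff_derivative, coeff_C_mul]
          rcases hm.eq_or_lt with h | h
          · rw [h]; push_cast; ring
          · rw [coeff_eq_zero_of_natDegree_lt ((natDegree_legendre_le ℓ).trans_lt h)]; simp
    have h1 := integral_mul_legendre_eq_zero hQ
    have h2 := integral_derivative_eval (X * P * P) (-1) 1
    have e1 : ∀ t : ℝ, (derivative (X * P * P)).eval t =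
        2 * ((X * derivative P - C (ℓ : ℝ) * P).eval t * P.eval t) +
          (2 * ℓ + 1) * (P.eval t * P.eval t) := by
      intro t
      simp only [derivative_mul, derivative_X, eval_mul, eval_add, eval_sub, eval_X, eval_C,
        eval_one]
      ring
    simp_rw [e1] at h2
    rw [intervalIntegral.integral_add (Continuous.intervalIntegrable (by fun_prop) _ _)
      (Continuous.intervalIntegrable (by fun_prop) _ _),
      intervalIntegral.integral_const_mul, intervalIntegral.integral_const_mul, h1] at h2
    simp only [eval_mul, eval_X] at h2
    rw [hP, legendre_eval_one, legendre_eval_of_sq_eq_one ℓ (by norm_num : (-1 : ℝ) ^ 2 = 1)] at h2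
    have h3 : ((-1 : ℝ) ^ ℓ) * (-1) ^ ℓ = 1 := by rw [← mul_pow]; simp
    have h4 : (2 * (ℓ : ℝ) + 1) * ∫ t in (-1 : ℝ)..1, P.eval t * P.eval t = 2 := by
      rw [hP]; linear_combination h2 + h3
    rw [eq_div_iff (by positivity), mul_comm, h4]
  · rw [if_neg h.ne']
    simp_rw [mul_comm ((legendre ℓ).eval _)]
    exact integral_mul_legendre_eq_zero
      (iterate_derivative_eq_zero ((natDegree_legendre_le k).trans_lt h))

theorem legendre_ode_zero (ℓ : ℕ) (t : ℝ) :
    (1 - t ^ 2) * (derivative (derivative (legendre ℓ))).eval t =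
      2 * t * (derivative (legendre ℓ)).eval t - (ℓ : ℝ) * (ℓ + 1) * (legendre ℓ).eval t := by
  have := legendre_ode ℓ 0 t
  simp only [Function.iterate_succ, Function.iterate_zero, Function.comp_apply, id_eq,
    Nat.cast_zero] at this
  rw [this]; ring

/-- Green's formula for the Legendre operator, against an arbitrary `C¹` function. -/
theorem integral_deriv_mul_derivative_legendre (ℓ : ℕ) {u u' : ℝ → ℝ}
    (hu : ∀ t, HasDerivAt u (u' t) t) (hu' : Continuous u') :
    ∫ t in (-1 : ℝ)..1, (1 - t ^ 2) * u' t * (derivative (legendre ℓ)).eval t =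
      (ℓ : ℝ) * (ℓ + 1) * ∫ t in (-1 : ℝ)..1, u t * (legendre ℓ).eval t := by
  have hc : Continuous u := continuous_iff_continuousAt.2 fun t ↦ (hu t).continuousAt
  have hd : ∀ t ∈ Set.uIcc (-1 : ℝ) 1, HasDerivAt
      (fun t ↦ u t * ((1 - t ^ 2) * (derivative (legendre ℓ)).eval t))
      ((1 - t ^ 2) * u' t * (derivative (legendre ℓ)).eval t
        - (ℓ : ℝ) * (ℓ + 1) * (u t * (legendre ℓ).eval t)) t := by
    intro t _
    have h1 : HasDerivAt (fun t : ℝ ↦ 1 - t ^ 2) (-(2 * t)) t := by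
      simpa using (hasDerivAt_pow 2 t).const_sub 1
    have := (hu t).mul (h1.mul ((derivative (legendre ℓ)).hasDerivAt t))
    convert! this using 1
    simp only [Pi.mul_apply]
    linear_combination (-u t) * legendre_ode_zero ℓ t
  have := intervalIntegral.integral_eq_sub_of_hasDerivAt hd
    (Continuous.intervalIntegrable (by fun_prop) _ _)
  rw [intervalIntegral.integral_sub (Continuous.intervalIntegrable (by fun_prop) _ _)
      (Continuous.intervalIntegrable (by fun_prop) _ _),
    intervalIntegral.integral_const_mul] at this
  norm_num at this
  linear_combination this

theorem integral_derivative_legendre_mul (ℓ k : ℕ) :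
    ∫ t in (-1 : ℝ)..1, (1 - t ^ 2) * (derivative (legendre ℓ)).eval t *
      (derivative (legendre k)).eval t =
      if ℓ = k then (ℓ : ℝ) * (ℓ + 1) * (2 / (2 * ℓ + 1)) else 0 := by
  rw [integral_deriv_mul_derivative_legendre k (fun t ↦ (legendre ℓ).hasDerivAt t)
    (Polynomial.continuous _), integral_legendre_mul_legendre]
  split_ifs with h
  · rw [h]
  · simp

theorem monotoneOn_antitoneOn_of_mul_deriv_nonneg {S S' : ℝ → ℝ} (hS : ∀ t, HasDerivAt S (S' t) t)
    (h : ∀ t ∈ Set.Icc (-1 : ℝ) 1, 0 ≤ t * S' t) :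
    MonotoneOn S (Set.Icc 0 1) ∧ AntitoneOn S (Set.Icc (-1) 0) := by
  have hc : Continuous S := continuous_iff_continuousAt.2 fun t ↦ (hS t).continuousAt
  constructor
  · refine monotoneOn_of_deriv_nonneg (convex_Icc 0 1) hc.continuousOn
      (fun t _ ↦ (hS t).differentiableAt.differentiableWithinAt) fun t ht ↦ ?_
    rw [interior_Icc] at ht
    rw [(hS t).deriv]
    exact nonneg_of_mul_nonneg_right (h t ⟨by linarith [ht.1], ht.2.le⟩) ht.1
  · refine antitoneOn_of_deriv_nonpos (convex_Icc (-1) 0) hc.continuousOn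
      (fun t _ ↦ (hS t).differentiableAt.differentiableWithinAt) fun t ht ↦ ?_
    rw [interior_Icc] at ht
    rw [(hS t).deriv]
    by_contra! hlt
    have := h t ⟨ht.1.le, by linarith [ht.2]⟩
    nlinarith [ht.2, mul_pos_of_neg_of_neg ht.2 (neg_neg_of_pos hlt)]

/-- Sonin's bound for solutions of `(1 - t²) v'' = b t v' - a v`. -/
theorem sonin_le {v : ℝ[X]} {a b M : ℝ} (hb : 1 ≤ b)
    (hv : ∀ t, (1 - t ^ 2) * (derivative (derivative v)).eval t =
      b * t * (derivative v).eval t - a * v.eval t)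
    (h1 : a * v.eval 1 ^ 2 ≤ M) (h2 : a * v.eval (-1) ^ 2 ≤ M) {t : ℝ}
    (ht : t ∈ Set.Icc (-1 : ℝ) 1) : a * v.eval t ^ 2 ≤ M := by
  -- Sonin's function (1-t²)v'² + av² dominates av², agrees with it at ±1, and by the equation has
  -- derivative 2(b-1)tv'². So it is largest at the endpoints.
  have hS : ∀ t : ℝ, HasDerivAt
      (fun t ↦ (1 - t ^ 2) * (derivative v).eval t ^ 2 + a * v.eval t ^ 2)
      (2 * (b - 1) * t * (derivative v).eval t ^ 2) t := by
    intro t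
    have e1 : HasDerivAt (fun t : ℝ ↦ 1 - t ^ 2) (-(2 * t)) t := by
      simpa using (hasDerivAt_pow 2 t).const_sub 1
    have := (e1.mul (((derivative v).hasDerivAt t).pow 2)).add
      (((v.hasDerivAt t).pow 2).const_mul a)
    convert! this using 1
    simp only [Nat.cast_ofNat, Nat.add_one_sub_one, Pi.pow_apply, pow_one]
    linear_combination (-2 * (derivative v).eval t) * hv t
  obtain ⟨hm, ha⟩ := monotoneOn_antitoneOn_of_mul_deriv_nonneg hS fun t _ ↦ by
    have : t * (2 * (b - 1) * t * (derivative v).eval t ^ 2) =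
      2 * (b - 1) * (t * (derivative v).eval t) ^ 2 := by ring
    rw [this]
    have := sub_nonneg.2 hb
    positivity
  have hle : a * v.eval t ^ 2 ≤ (1 - t ^ 2) * (derivative v).eval t ^ 2 + a * v.eval t ^ 2 := by
    have : 0 ≤ (1 - t ^ 2) * (derivative v).eval t ^ 2 :=
      mul_nonneg (by nlinarith [ht.1, ht.2]) (sq_nonneg _)
    linarith
  refine hle.trans ?_
  rcases le_total 0 t with h0 | h0
  · have := hm ⟨h0, ht.2⟩ ⟨zero_le_one, le_rfl⟩ ht.2
    norm_num at this
    linarith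
  · have := ha ⟨le_rfl, by norm_num⟩ ⟨ht.1, h0⟩ ht.1
    norm_num at this
    linarith

theorem derivative_legendre_eval_of_sq_eq_one (ℓ : ℕ) {ε : ℝ} (hε : ε ^ 2 = 1) :
    (derivative (legendre ℓ)).eval ε ^ 2 = ((ℓ : ℝ) * (ℓ + 1) / 2) ^ 2 := by
  have h := legendre_ode_zero ℓ ε
  rw [hε, legendre_eval_of_sq_eq_one ℓ hε, sub_self, zero_mul] at h
  have h3 : (ε ^ ℓ) ^ 2 = 1 := by rw [← pow_mul, mul_comm, pow_mul, hε, one_pow]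
  have h4 : 2 * ε * (derivative (legendre ℓ)).eval ε = ℓ * (ℓ + 1) * ε ^ ℓ := by linarith
  have h5 := congrArg (· ^ 2) h4
  simp only [mul_pow, hε, h3] at h5
  linear_combination h5 / 4

/-- P_ℓ' solves an equation of Sonin type with b = 4 and a = (ℓ+2)(ℓ-1), so its extremes are at ±1.
Positivity of a requires ℓ ≥ 2; for smaller ℓ the derivative is constant. -/
theorem abs_derivative_legendre_le (ℓ : ℕ) {t : ℝ} (ht : t ∈ Set.Icc (-1 : ℝ) 1) :
    |(derivative (legendre ℓ)).eval t| ≤ (ℓ : ℝ) * (ℓ + 1) / 2 := by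
  rcases Nat.lt_or_ge ℓ 2 with h0 | h0
  · have : (derivative (legendre ℓ)).eval t ^ 2 = ((ℓ : ℝ) * (ℓ + 1) / 2) ^ 2 := by
      rw [← derivative_legendre_eval_of_sq_eq_one ℓ (one_pow 2)]
      have hd : (derivative (legendre ℓ)).natDegree ≤ 0 :=
        (natDegree_derivative_le _).trans (by have := natDegree_legendre_le ℓ; omega)
      rw [eq_C_of_natDegree_le_zero hd, eval_C, eval_C]
    rw [← Real.sqrt_sq_eq_abs, this, Real.sqrt_sq (by positivity)]
  · have hl : (2 : ℝ) ≤ ℓ := by exact_mod_cast h0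
    have ha : (0 : ℝ) < ((ℓ : ℝ) + 2) * (ℓ - 1) := by
      apply mul_pos <;> linarith
    have key : ((ℓ : ℝ) + 2) * (ℓ - 1) * (derivative (legendre ℓ)).eval t ^ 2 ≤
        ((ℓ : ℝ) + 2) * (ℓ - 1) * ((ℓ : ℝ) * (ℓ + 1) / 2) ^ 2 := by
      refine sonin_le (b := 4) (by norm_num) (fun t ↦ ?_) ?_ ?_ ht
      · have := legendre_ode ℓ 1 t
        simp only [Function.iterate_succ, Function.iterate_zero, Function.comp_apply, id_eq,
          Nat.cast_one] at this
        rw [this]; ring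
      · rw [derivative_legendre_eval_of_sq_eq_one ℓ (by norm_num)]
      · rw [derivative_legendre_eval_of_sq_eq_one ℓ (by norm_num)]
    exact abs_le_of_sq_le_sq (le_of_mul_le_mul_left key ha) (by positivity)

theorem one_sub_legendre_le (ℓ : ℕ) {t : ℝ} (ht : t ∈ Set.Icc (-1 : ℝ) 1) :
    1 - (legendre ℓ).eval t ≤ (ℓ : ℝ) * (ℓ + 1) / 2 * (1 - t) := by
  have h := Convex.norm_image_sub_le_of_norm_hasDerivWithin_le (s := Set.Icc (-1 : ℝ) 1)
    (f := fun t ↦ (legendre ℓ).eval t) (f' := fun t ↦ (derivative (legendre ℓ)).eval t)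
    (fun x _ ↦ ((legendre ℓ).hasDerivAt x).hasDerivWithinAt)
    (fun x hx ↦ abs_derivative_legendre_le ℓ hx) (convex_Icc _ _) ht ⟨by norm_num, le_rfl⟩
  rw [Real.norm_eq_abs, Real.norm_eq_abs, legendre_eval_one,
    abs_of_nonneg (sub_nonneg.2 ht.2)] at h
  exact (le_abs_self _).trans h

/-- The pointwise decay of the Legendre polynomials away from `±1`. -/
theorem one_sub_sq_mul_legendre_sq_le (ℓ : ℕ) {t : ℝ} (ht : t ∈ Set.Icc (-1 : ℝ) 1) :
    (1 - t ^ 2) * (legendre ℓ).eval t ^ 2 ≤ 2 / (2 * ℓ + 1) := by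
  rcases Nat.eq_zero_or_pos ℓ with rfl | h0
  · simp only [legendre, pow_zero, Nat.factorial_zero, Nat.cast_one, mul_one, div_one, map_one,
      Function.iterate_zero, id_eq, eval_one, one_pow, CharP.cast_eq_zero, mul_zero, zero_add]
    nlinarith [sq_nonneg t]
  set P := legendre ℓ with hP
  set a : ℝ := ℓ * (ℓ + 1) with ha_def
  have ha : 0 < a := by positivity
  -- S is minimal at 0, while (1-t²)S is maximal at 0. Hence a(1-t²)P² ≤ (1-t²)S(t) ≤ S(0), and S(0)
  -- is at most the average of S over [-1,1], known from orthogonality.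
  set S : ℝ → ℝ := fun t ↦ (1 - t ^ 2) * (derivative P).eval t ^ 2 + a * P.eval t ^ 2 with hSdef
  have e1 : ∀ t : ℝ, HasDerivAt (fun t : ℝ ↦ 1 - t ^ 2) (-(2 * t)) t := fun t ↦ by
    simpa using (hasDerivAt_pow 2 t).const_sub 1
  have hS : ∀ t : ℝ, HasDerivAt S (2 * t * (derivative P).eval t ^ 2) t := by
    intro t
    have := ((e1 t).mul (((derivative P).hasDerivAt t).pow 2)).add
      (((P.hasDerivAt t).pow 2).const_mul a)
    convert! this using 1
    simp only [Nat.cast_ofNat, Nat.add_one_sub_one, Pi.pow_apply, pow_one]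
    linear_combination (-2 * (derivative P).eval t) * legendre_ode_zero ℓ t
  have hT : ∀ t : ℝ, HasDerivAt (fun t ↦ -((1 - t ^ 2) * S t)) (2 * t * (a * P.eval t ^ 2)) t := by
    intro t
    have := ((e1 t).mul (hS t)).neg
    convert! this using 1
    simp only [hSdef]; ring
  obtain ⟨hm, hanti⟩ := monotoneOn_antitoneOn_of_mul_deriv_nonneg hS fun t _ ↦ by
    rw [show t * (2 * t * (derivative P).eval t ^ 2) = 2 * (t * (derivative P).eval t) ^ 2 by ring]
    positivity
  obtain ⟨hm', hanti'⟩ := monotoneOn_antitoneOn_of_mul_deriv_nonneg hT fun t _ ↦ by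
    rw [show t * (2 * t * (a * P.eval t ^ 2)) = 2 * a * (t * P.eval t) ^ 2 by ring]
    positivity
  have hmin : ∀ t ∈ Set.Icc (-1 : ℝ) 1, S 0 ≤ S t := by
    intro t ht
    rcases le_total 0 t with h | h
    · exact hm ⟨le_rfl, zero_le_one⟩ ⟨h, ht.2⟩ h
    · exact hanti ⟨ht.1, h⟩ ⟨by norm_num, le_rfl⟩ h
  have hmax : (1 - t ^ 2) * S t ≤ S 0 := by
    have : (fun t ↦ -((1 - t ^ 2) * S t)) 0 ≤ (fun t ↦ -((1 - t ^ 2) * S t)) t := by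
      rcases le_total 0 t with h | h
      · exact hm' ⟨le_rfl, zero_le_one⟩ ⟨h, ht.2⟩ h
      · exact hanti' ⟨ht.1, h⟩ ⟨by norm_num, le_rfl⟩ h
    norm_num at this
    linarith
  have hcS : Continuous S := continuous_iff_continuousAt.2 fun t ↦ (hS t).continuousAt
  have hint : ∫ t in (-1 : ℝ)..1, S t = 2 * (a * (2 / (2 * ℓ + 1))) := by
    have h1 := integral_derivative_legendre_mul ℓ ℓ
    have h2 := integral_legendre_mul_legendre ℓ ℓ
    rw [if_pos rfl] at h1 h2
    have : ∀ t, S t = (1 - t ^ 2) * (derivative P).eval t * (derivative P).eval t +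
      a * (P.eval t * P.eval t) := fun t ↦ by simp only [hSdef]; ring
    simp_rw [this]
    rw [intervalIntegral.integral_add (Continuous.intervalIntegrable (by fun_prop) _ _)
      (Continuous.intervalIntegrable (by fun_prop) _ _), intervalIntegral.integral_const_mul,
      h1, h2]
    ring
  have hlow : 2 * S 0 ≤ ∫ t in (-1 : ℝ)..1, S t := by
    have := intervalIntegral.integral_mono_on (by norm_num : (-1 : ℝ) ≤ 1)
      ((continuous_const (y := S 0)).intervalIntegrable (μ := volume) _ _) (hcS.intervalIntegrable _ _) hmin
    norm_num at this
    linarith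
  have h3 : a * ((1 - t ^ 2) * P.eval t ^ 2) ≤ (1 - t ^ 2) * S t := by
    have h4 : 0 ≤ 1 - t ^ 2 := by nlinarith [ht.1, ht.2]
    have : 0 ≤ (1 - t ^ 2) * ((1 - t ^ 2) * (derivative P).eval t ^ 2) := by positivity
    simp only [hSdef]
    nlinarith
  exact le_of_mul_le_mul_left (by linarith) ha

end Legendre

end SphericalField

namespace SphericalField

/-! ### The addition theorem for spherical harmonics -/

noncomputable section AdditionTheorem

open Polynomial

/-- The unnormalised complex spherical harmonic of degree `ℓ` and order `k ≥ 0`, as a polynomial. -/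
def solidHarmonic (ℓ k : ℕ) (v₀ v₁ v₂ : ℝ) : ℂ :=
  ((derivative^[k] (legendre ℓ)).eval v₂ : ℝ) * ((v₀ : ℂ) + (v₁ : ℂ) * Complex.I) ^ k

/-- The normalisation `(ℓ - k)! / (ℓ + k)!`. -/
def harmonicWeight (ℓ k : ℕ) : ℝ := (ℓ - k).factorial / (ℓ + k).factorial

/-- The right-hand side of the addition theorem, up to the factor `N ℓ`. -/
def additionKernel (ℓ : ℕ) (x y : Fin 3 → ℝ) : ℂ :=
  solidHarmonic ℓ 0 (x 0) (x 1) (x 2) * solidHarmonic ℓ 0 (y 0) (y 1) (y 2) +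
    ∑ j ∈ Finset.range ℓ, (harmonicWeight ℓ (j + 1) : ℂ) *
      (solidHarmonic ℓ (j + 1) (x 0) (x 1) (x 2) * solidHarmonic ℓ (j + 1) (y 0) (-y 1) (y 2) +
       solidHarmonic ℓ (j + 1) (x 0) (-x 1) (x 2) * solidHarmonic ℓ (j + 1) (y 0) (y 1) (y 2))

theorem harmonicWeight_zero (ℓ : ℕ) : harmonicWeight ℓ 0 = 1 := by
  simp [harmonicWeight, Nat.factorial_ne_zero]

theorem harmonicWeight_succ {ℓ j : ℕ} (h : j < ℓ) :
    harmonicWeight ℓ (j + 1) * (((ℓ : ℝ) + j + 1) * (ℓ - j)) = harmonicWeight ℓ j := by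
  obtain ⟨d, rfl⟩ := Nat.exists_eq_add_of_lt h
  have h1 : j + d + 1 - (j + 1) = d := by omega
  have h2 : j + d + 1 - j = d + 1 := by omega
  have h3 : j + d + 1 + (j + 1) = (j + d + 1 + j) + 1 := by omega
  simp only [harmonicWeight, h1, h2, h3, Nat.factorial_succ]
  push_cast
  have := Nat.factorial_ne_zero d
  have := Nat.factorial_ne_zero (j + d + 1 + j)
  have : (j : ℝ) + d + 1 + j + 1 ≠ 0 := by positivity
  field_simp
  ring

theorem solidHarmonic_top (ℓ : ℕ) (a b t : ℝ) : solidHarmonic ℓ (ℓ + 1) a b t = 0 := by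
  rw [solidHarmonic, iterate_derivative_eq_zero (Nat.lt_succ_of_le (natDegree_legendre_le ℓ))]
  simp

theorem solidHarmonic_zero (ℓ : ℕ) (a b t : ℝ) :
    solidHarmonic ℓ 0 a b t = ((legendre ℓ).eval t : ℝ) := by
  simp [solidHarmonic]

theorem hasDerivAt_solidHarmonic_zero {v₀ v₁ v₂ : ℝ → ℝ} {τ : ℝ} (ℓ : ℕ)
    (h₂ : HasDerivAt v₂ (-v₀ τ) τ) :
    HasDerivAt (fun τ ↦ solidHarmonic ℓ 0 (v₀ τ) (v₁ τ) (v₂ τ))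
      (-(1 / 2) * (solidHarmonic ℓ 1 (v₀ τ) (v₁ τ) (v₂ τ) +
        solidHarmonic ℓ 1 (v₀ τ) (-v₁ τ) (v₂ τ))) τ := by
  simp only [solidHarmonic_zero]
  have := (((legendre ℓ).hasDerivAt (v₂ τ)).comp τ h₂).ofReal_comp
  refine this.congr_deriv ?_
  simp only [solidHarmonic, Function.iterate_one]
  push_cast
  ring

/-- An infinitesimal rotation in the plane of coordinates 0 and 2 acts as a combination of the
raising and lowering operators on the order. The second derivative that would block the lowering
term is removed by the Legendre equation. -/
theorem hasDerivAt_solidHarmonic_succ {v₀ v₁ v₂ : ℝ → ℝ} {τ : ℝ} (ℓ j : ℕ)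
    (h₀ : HasDerivAt v₀ (v₂ τ) τ) (h₁ : HasDerivAt v₁ 0 τ) (h₂ : HasDerivAt v₂ (-v₀ τ) τ)
    (hv : v₀ τ ^ 2 + v₁ τ ^ 2 + v₂ τ ^ 2 = 1) :
    HasDerivAt (fun τ ↦ solidHarmonic ℓ (j + 1) (v₀ τ) (v₁ τ) (v₂ τ))
      (-(1 / 2) * solidHarmonic ℓ (j + 2) (v₀ τ) (v₁ τ) (v₂ τ) +
        1 / 2 * (((ℓ : ℝ) + j + 1) * (ℓ - j) : ℝ) * solidHarmonic ℓ j (v₀ τ) (v₁ τ) (v₂ τ)) τ := by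
  have hp := (((derivative^[j + 1] (legendre ℓ)).hasDerivAt (v₂ τ)).comp τ h₂).ofReal_comp
  have hw := ((h₀.ofReal_comp).add (h₁.ofReal_comp.mul_const Complex.I)).pow (j + 1)
  refine (hp.mul hw).congr_deriv ?_
  have hode := congrArg (fun z : ℝ ↦ (z : ℂ)) (legendre_ode ℓ j (v₂ τ))
  have hv' := congrArg (fun z : ℝ ↦ (z : ℂ)) hv
  simp only [solidHarmonic, ← Function.iterate_succ_apply' derivative]
  push_cast at hode hv' ⊢
  simp only [Function.comp_apply, Pi.add_apply, Pi.pow_apply]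
  set w : ℂ := (v₀ τ : ℂ) + (v₁ τ : ℂ) * Complex.I with hwdef
  -- This uses v₀ = (w + w̄)/2 and ww̄ = 1 - v₂² on the sphere.
  have hww : (v₀ τ : ℂ) * w = 1 / 2 * w ^ 2 + 1 / 2 * (1 - (v₂ τ : ℂ) ^ 2) := by
    rw [hwdef]
    linear_combination (1 / 2 : ℂ) * hv' - (1 / 2 * (v₁ τ : ℂ) ^ 2) * Complex.I_sq
  have e1 : j + 1 + 1 = j + 2 := rfl
  rw [e1]
  generalize (((derivative^[j + 2] (legendre ℓ)).eval (v₂ τ) : ℝ) : ℂ) = p2 at *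
  generalize (((derivative^[j + 1] (legendre ℓ)).eval (v₂ τ) : ℝ) : ℂ) = p1 at *
  generalize (((derivative^[j] (legendre ℓ)).eval (v₂ τ) : ℝ) : ℂ) = p0 at *
  linear_combination (-(p2 * w ^ j)) * hww - (1 / 2 * w ^ j) * hode

/-- The ladder relations make the derivative telescope in the order k: `harmonicWeight_succ` matches
raising from k with lowering from k + 1. At the top the terms of order ℓ + 1 vanish; at the bottom
the rest cancels the derivative of the zonal term. -/
theorem hasDerivAt_additionKernel (ℓ : ℕ) {x y : ℝ → Fin 3 → ℝ} {τ : ℝ}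
    (hx₀ : HasDerivAt (x · 0) (x τ 2) τ) (hx₁ : HasDerivAt (x · 1) 0 τ)
    (hx₂ : HasDerivAt (x · 2) (-x τ 0) τ) (hx : x τ 0 ^ 2 + x τ 1 ^ 2 + x τ 2 ^ 2 = 1)
    (hy₀ : HasDerivAt (y · 0) (y τ 2) τ) (hy₁ : HasDerivAt (y · 1) 0 τ)
    (hy₂ : HasDerivAt (y · 2) (-y τ 0) τ) (hy : y τ 0 ^ 2 + y τ 1 ^ 2 + y τ 2 ^ 2 = 1) :
    HasDerivAt (fun τ ↦ additionKernel ℓ (x τ) (y τ)) 0 τ := by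
  have hx₁' : HasDerivAt (fun τ ↦ -x τ 1) 0 τ := by simpa using hx₁.fun_neg
  have hy₁' : HasDerivAt (fun τ ↦ -y τ 1) 0 τ := by simpa using hy₁.fun_neg
  have hx' : x τ 0 ^ 2 + (-x τ 1) ^ 2 + x τ 2 ^ 2 = 1 := by rw [neg_sq, hx]
  have hy' : y τ 0 ^ 2 + (-y τ 1) ^ 2 + y τ 2 ^ 2 = 1 := by rw [neg_sq, hy]
  have hsum := HasDerivAt.fun_sum (u := Finset.range ℓ) fun j _ ↦
    (((hasDerivAt_solidHarmonic_succ (v₀ := (x · 0)) (v₂ := (x · 2)) ℓ j hx₀ hx₁ hx₂ hx).mul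
      (hasDerivAt_solidHarmonic_succ (v₀ := (y · 0)) (v₂ := (y · 2)) ℓ j hy₀ hy₁' hy₂ hy')).add
    ((hasDerivAt_solidHarmonic_succ (v₀ := (x · 0)) (v₂ := (x · 2)) ℓ j hx₀ hx₁' hx₂ hx').mul
      (hasDerivAt_solidHarmonic_succ (v₀ := (y · 0)) (v₂ := (y · 2)) ℓ j hy₀ hy₁ hy₂ hy))).const_mul
      ((harmonicWeight ℓ (j + 1) : ℝ) : ℂ)
  have h0 := (hasDerivAt_solidHarmonic_zero (v₀ := (x · 0)) (v₁ := (x · 1)) ℓ hx₂).mul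
    (hasDerivAt_solidHarmonic_zero (v₀ := (y · 0)) (v₁ := (y · 1)) ℓ hy₂)
  refine (h0.add hsum).congr_deriv ?_
  let H : ℕ → ℂ := fun k ↦ solidHarmonic ℓ k (x τ 0) (x τ 1) (x τ 2)
  let H' : ℕ → ℂ := fun k ↦ solidHarmonic ℓ k (x τ 0) (-x τ 1) (x τ 2)
  let K : ℕ → ℂ := fun k ↦ solidHarmonic ℓ k (y τ 0) (y τ 1) (y τ 2)
  let K' : ℕ → ℂ := fun k ↦ solidHarmonic ℓ k (y τ 0) (-y τ 1) (y τ 2)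
  let T : ℕ → ℂ := fun k ↦ (harmonicWeight ℓ k : ℂ) *
    (H (k + 1) * K' k + H k * K' (k + 1) + H' (k + 1) * K k + H' k * K (k + 1))
  -- The left side is fixed by unification with the summand of the derivative; the `change` below
  -- displays it in the letters H, H', K, K'.
  have hT : ∀ j ∈ Finset.range ℓ, _ = (1 / 2) * (T j - T (j + 1)) := fun j hj ↦ by
    have hb := congrArg (fun z : ℝ ↦ (z : ℂ)) (harmonicWeight_succ (Finset.mem_range.1 hj))
    push_cast at hb
    change ((harmonicWeight ℓ (j + 1) : ℝ) : ℂ) *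
      ((-(1 / 2) * H (j + 2) + 1 / 2 * (((ℓ : ℝ) + j + 1) * (ℓ - j) : ℝ) * H j) * K' (j + 1) +
        H (j + 1) * (-(1 / 2) * K' (j + 2) + 1 / 2 * (((ℓ : ℝ) + j + 1) * (ℓ - j) : ℝ) * K' j) +
       ((-(1 / 2) * H' (j + 2) + 1 / 2 * (((ℓ : ℝ) + j + 1) * (ℓ - j) : ℝ) * H' j) * K (j + 1) +
        H' (j + 1) * (-(1 / 2) * K (j + 2) + 1 / 2 * (((ℓ : ℝ) + j + 1) * (ℓ - j) : ℝ) * K j))) = _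
    simp only [T]
    push_cast
    rw [show j + 1 + 1 = j + 2 from rfl]
    linear_combination (1 / 2 * (H j * K' (j + 1) + H (j + 1) * K' j + H' j * K (j + 1) +
      H' (j + 1) * K j)) * hb
  have hS := Finset.sum_congr (rfl : Finset.range ℓ = Finset.range ℓ) hT
  refine (congrArg₂ (· + ·) rfl hS).trans ?_
  have hTℓ : T ℓ = 0 := by simp [T, H, H', K, K', solidHarmonic_top]
  rw [← Finset.mul_sum, Finset.sum_range_sub', hTℓ]
  have hH' : ∀ a b t, solidHarmonic ℓ 0 a (-b) t = solidHarmonic ℓ 0 a b t := fun a b t ↦ by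
    simp [solidHarmonic_zero]
  simp only [T, H, H', K, K', harmonicWeight_zero, hH', zero_add]
  push_cast
  ring

/-- Rotation by the angle `τ` in the plane of the coordinates `0` and `2`. -/
def tilt (τ : ℝ) (x : Fin 3 → ℝ) : Fin 3 → ℝ :=
  ![x 0 * Real.cos τ + x 2 * Real.sin τ, x 1, -x 0 * Real.sin τ + x 2 * Real.cos τ]

/-- Rotation by the angle `τ` around the polar axis. -/
def spin (τ : ℝ) (x : Fin 3 → ℝ) : Fin 3 → ℝ :=
  ![x 0 * Real.cos τ - x 1 * Real.sin τ, x 0 * Real.sin τ + x 1 * Real.cos τ, x 2]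

theorem additionKernel_tilt (ℓ : ℕ) (τ : ℝ) {x y : Fin 3 → ℝ}
    (hx : x 0 ^ 2 + x 1 ^ 2 + x 2 ^ 2 = 1) (hy : y 0 ^ 2 + y 1 ^ 2 + y 2 ^ 2 = 1) :
    additionKernel ℓ (tilt τ x) (tilt τ y) = additionKernel ℓ x y := by
  have key : ∀ (x : Fin 3 → ℝ), x 0 ^ 2 + x 1 ^ 2 + x 2 ^ 2 = 1 → ∀ τ,
      HasDerivAt (tilt · x 0) (tilt τ x 2) τ ∧ HasDerivAt (tilt · x 1) 0 τ ∧
      HasDerivAt (tilt · x 2) (-tilt τ x 0) τ ∧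
      tilt τ x 0 ^ 2 + tilt τ x 1 ^ 2 + tilt τ x 2 ^ 2 = 1 := by
    intro x hx τ
    simp only [tilt, Matrix.cons_val_zero, Matrix.cons_val_one, Matrix.cons_val]
    refine ⟨?_, hasDerivAt_const _ _, ?_, ?_⟩
    · exact (((Real.hasDerivAt_cos τ).const_mul _).add
        ((Real.hasDerivAt_sin τ).const_mul _)).congr_deriv (by ring)
    · exact (((Real.hasDerivAt_sin τ).const_mul _).add
        ((Real.hasDerivAt_cos τ).const_mul _)).congr_deriv (by ring)
    · linear_combination hx + (x 0 ^ 2 + x 2 ^ 2) * Real.sin_sq_add_cos_sq τ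
  have hd : ∀ τ, HasDerivAt (fun τ ↦ additionKernel ℓ (tilt τ x) (tilt τ y)) 0 τ := fun τ ↦ by
    obtain ⟨a, b, c, d⟩ := key x hx τ
    obtain ⟨a', b', c', d'⟩ := key y hy τ
    exact hasDerivAt_additionKernel ℓ a b c d a' b' c' d'
  have h0 : ∀ x : Fin 3 → ℝ, tilt 0 x = x := fun x ↦ by
    ext i; fin_cases i <;> simp [tilt]
  have := is_const_of_deriv_eq_zero (fun t ↦ (hd t).differentiableAt) (fun t ↦ (hd t).deriv) τ 0
  simpa [h0] using this

theorem solidHarmonic_spin (ℓ k : ℕ) (a b t τ : ℝ) :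
    solidHarmonic ℓ k (a * Real.cos τ - b * Real.sin τ) (a * Real.sin τ + b * Real.cos τ) t =
      Complex.exp (τ * Complex.I) ^ k * solidHarmonic ℓ k a b t := by
  have : ((a * Real.cos τ - b * Real.sin τ : ℝ) : ℂ) +
      ((a * Real.sin τ + b * Real.cos τ : ℝ) : ℂ) * Complex.I =
      Complex.exp (τ * Complex.I) * (a + b * Complex.I) := by
    rw [Complex.exp_mul_I]
    push_cast
    linear_combination (-(b : ℂ) * Complex.sin τ) * Complex.I_sq
  rw [solidHarmonic, this, mul_pow, solidHarmonic]
  ring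

theorem solidHarmonic_spin_neg (ℓ k : ℕ) (a b t τ : ℝ) :
    solidHarmonic ℓ k (a * Real.cos τ - b * Real.sin τ) (-(a * Real.sin τ + b * Real.cos τ)) t =
      Complex.exp (-τ * Complex.I) ^ k * solidHarmonic ℓ k a (-b) t := by
  have := solidHarmonic_spin ℓ k a (-b) t (-τ)
  simp only [Real.cos_neg, Real.sin_neg, Complex.ofReal_neg] at this
  rw [← this]
  congr 1 <;> ring

theorem additionKernel_spin (ℓ : ℕ) (τ : ℝ) (x y : Fin 3 → ℝ) :
    additionKernel ℓ (spin τ x) (spin τ y) = additionKernel ℓ x y := by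
  have h : ∀ k, Complex.exp (τ * Complex.I) ^ k * Complex.exp (-τ * Complex.I) ^ k = 1 := by
    intro k
    rw [← mul_pow, ← Complex.exp_add]
    simp
  simp only [additionKernel, spin, Matrix.cons_val_zero, Matrix.cons_val_one, Matrix.cons_val,
    solidHarmonic_spin, solidHarmonic_spin_neg, pow_zero, one_mul]
  congr 1
  refine Finset.sum_congr rfl fun j _ ↦ ?_
  congr 1
  linear_combination (solidHarmonic ℓ (j + 1) (x 0) (x 1) (x 2) *
    solidHarmonic ℓ (j + 1) (y 0) (-y 1) (y 2) + solidHarmonic ℓ (j + 1) (x 0) (-x 1) (x 2) *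
    solidHarmonic ℓ (j + 1) (y 0) (y 1) (y 2)) * h (j + 1)

theorem additionKernel_north (ℓ : ℕ) (x : Fin 3 → ℝ) {y : Fin 3 → ℝ} (h0 : y 0 = 0) (h1 : y 1 = 0)
    (h2 : y 2 = 1) : additionKernel ℓ x y = ((legendre ℓ).eval (x 2) : ℝ) := by
  simp [additionKernel, h0, h1, h2, solidHarmonic, legendre_eval_one]

theorem exists_mul_cos_mul_sin (a b : ℝ) :
    ∃ φ, a = √(a ^ 2 + b ^ 2) * Real.cos φ ∧ b = √(a ^ 2 + b ^ 2) * Real.sin φ := by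
  refine ⟨Complex.arg (a + b * Complex.I), ?_, ?_⟩
  · have := Complex.norm_mul_cos_arg (a + b * Complex.I)
    rw [Complex.norm_add_mul_I] at this
    simpa using this.symm
  · have := Complex.norm_mul_sin_arg (a + b * Complex.I)
    rw [Complex.norm_add_mul_I] at this
    simpa using this.symm

/-- **Legendre's addition theorem**, in polynomial form. -/
theorem additionKernel_eq (ℓ : ℕ) {x y : Fin 3 → ℝ} (hx : x 0 ^ 2 + x 1 ^ 2 + x 2 ^ 2 = 1)
    (hy : y 0 ^ 2 + y 1 ^ 2 + y 2 ^ 2 = 1) :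
    additionKernel ℓ x y =
      ((legendre ℓ).eval (x 0 * y 0 + x 1 * y 1 + x 2 * y 2) : ℝ) := by
  -- φ and ψ are the longitude and colatitude of y. A spin by -φ and a tilt by -ψ bring y to the
  -- north pole, where only order 0 survives; the height of the rotated x is then x·y.
  obtain ⟨φ, h0, h1⟩ := exists_mul_cos_mul_sin (y 0) (y 1)
  set ρ := √(y 0 ^ 2 + y 1 ^ 2) with hρ
  have hρ2 : ρ ^ 2 = y 0 ^ 2 + y 1 ^ 2 := Real.sq_sqrt (by positivity)
  obtain ⟨ψ, g0, g1⟩ := exists_mul_cos_mul_sin (y 2) ρ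
  have h1' : √(y 2 ^ 2 + ρ ^ 2) = 1 := by
    rw [hρ2]; rw [Real.sqrt_eq_one]; linarith
  rw [h1', one_mul] at g0 g1
  have hcs := Real.sin_sq_add_cos_sq φ
  have hcs' := Real.sin_sq_add_cos_sq ψ
  have hs : ∀ x : Fin 3 → ℝ, x 0 ^ 2 + x 1 ^ 2 + x 2 ^ 2 = 1 →
      spin (-φ) x 0 ^ 2 + spin (-φ) x 1 ^ 2 + spin (-φ) x 2 ^ 2 = 1 := fun x hx ↦ by
    simp only [spin, Matrix.cons_val_zero, Matrix.cons_val_one, Matrix.cons_val, Real.cos_neg,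
      Real.sin_neg]
    linear_combination hx + (x 0 ^ 2 + x 1 ^ 2) * hcs
  rw [← additionKernel_spin ℓ (-φ), ← additionKernel_tilt ℓ (-ψ) (hs x hx) (hs y hy),
    additionKernel_north]
  · congr 2
    simp only [tilt, spin, Matrix.cons_val_zero, Matrix.cons_val_one, Matrix.cons_val,
      Real.cos_neg, Real.sin_neg]
    rw [← g0, ← g1]
    linear_combination -(x 0) * h0 - x 1 * h1
  · simp only [tilt, spin, Matrix.cons_val_zero, Matrix.cons_val_one, Matrix.cons_val,
      Real.cos_neg, Real.sin_neg]
    rw [← g0, ← g1]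
    linear_combination y 2 * Real.cos φ * h0 + y 2 * Real.sin φ * h1 + y 2 * ρ * hcs
  · simp only [tilt, spin, Matrix.cons_val_zero, Matrix.cons_val_one, Matrix.cons_val,
      Real.cos_neg, Real.sin_neg]
    linear_combination Real.cos φ * h1 - Real.sin φ * h0
  · simp only [tilt, spin, Matrix.cons_val_zero, Matrix.cons_val_one, Matrix.cons_val,
      Real.cos_neg, Real.sin_neg]
    rw [← g0, ← g1]
    linear_combination hy - y 0 * h0 - y 1 * h1

theorem sum_Icc_neg (n : ℕ) (F : ℤ → ℝ) :
    ∑ m ∈ Finset.Icc (-(n : ℤ)) n, F m =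
      F 0 + ∑ j ∈ Finset.range n, (F (j + 1) + F (-(j + 1))) := by
  induction n with
  | zero => simp
  | succ n ih =>
    have : Finset.Icc (-((n + 1 : ℕ) : ℤ)) (n + 1 : ℕ) =
        insert ((n : ℤ) + 1) (insert (-((n : ℤ) + 1)) (Finset.Icc (-(n : ℤ)) n)) := by
      ext m
      simp only [Finset.mem_Icc, Finset.mem_insert]
      omega
    rw [this, Finset.sum_insert, Finset.sum_insert, ih, Finset.sum_range_succ]
    · ring
    · simp
    · simp only [Finset.mem_insert, Finset.mem_Icc]; omega

theorem sq_add_sq_add_sq_eq_one (x : S2) :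
    (x : E3) 0 ^ 2 + (x : E3) 1 ^ 2 + (x : E3) 2 ^ 2 = 1 := by
  have h := x.2
  rw [mem_sphere_zero_iff_norm] at h
  have h2 := EuclideanSpace.real_norm_sq_eq (x : E3)
  rw [h, Fin.sum_univ_three] at h2
  linarith

theorem inner_eq (x y : E3) : inner ℝ x y = x 0 * y 0 + x 1 * y 1 + x 2 * y 2 := by
  simp [PiLp.inner_apply, Fin.sum_univ_three, mul_comm]

theorem N_pos (ℓ : ℕ) : 0 < N ℓ := by
  unfold N; positivity

/-- **Legendre's addition theorem** for the real spherical harmonics. -/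
theorem sum_Y_mul_Y (ℓ : ℕ) (x y : S2) :
    ∑ m : Finset.Icc (-(ℓ : ℤ)) (ℓ : ℤ), Y ℓ m x * Y ℓ m y =
      N ℓ * (legendre ℓ).eval (inner ℝ (x : E3) (y : E3)) := by
  have h := additionKernel_eq ℓ (x := (x : E3)) (y := (y : E3)) (sq_add_sq_add_sq_eq_one x)
    (sq_add_sq_add_sq_eq_one y)
  rw [inner_eq, Finset.sum_coe_sort (Finset.Icc (-(ℓ : ℤ)) (ℓ : ℤ)) (fun m ↦ Y ℓ m x * Y ℓ m y),
    sum_Icc_neg]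
  have h' := congrArg Complex.re h
  rw [Complex.ofReal_re] at h'
  rw [← h', additionKernel, Complex.add_re, Complex.re_sum, mul_add, Finset.mul_sum]
  have hN := (N_pos ℓ).le
  congr 1
  · have h1 : √(N ℓ * (ℓ.factorial / ℓ.factorial)) * √(N ℓ * (ℓ.factorial / ℓ.factorial)) = N ℓ := by
      rw [div_self (by exact_mod_cast Nat.factorial_ne_zero ℓ), mul_one, Real.mul_self_sqrt hN]
    simp only [Y, solidHarmonic_zero, Int.natAbs_zero, Nat.sub_zero, Nat.add_zero,
      Function.iterate_zero, id_eq, if_true, ← Complex.ofReal_mul, Complex.ofReal_re]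
    linear_combination (eval ((x : E3) 2) (legendre ℓ) * eval ((y : E3) 2) (legendre ℓ)) * h1
  · refine Finset.sum_congr rfl fun j _ ↦ ?_
    have e1 : ((j : ℤ) + 1).natAbs = j + 1 := by omega
    have e2 : (-((j : ℤ) + 1)).natAbs = j + 1 := by omega
    have n1 : ¬ ((j : ℤ) + 1 = 0) := by omega
    have n2 : ¬ (-((j : ℤ) + 1) = 0) := by omega
    have p1 : 0 < (j : ℤ) + 1 := by omega
    have p2 : ¬ (0 < -((j : ℤ) + 1)) := by omega
    have h1 : √(N ℓ * harmonicWeight ℓ (j + 1)) * √(N ℓ * harmonicWeight ℓ (j + 1)) =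
        N ℓ * harmonicWeight ℓ (j + 1) :=
      Real.mul_self_sqrt (mul_nonneg hN (by unfold harmonicWeight; positivity))
    have h2 : √2 * √2 = (2 : ℝ) := Real.mul_self_sqrt (by norm_num)
    have hc : ∀ a b : ℝ, ((a : ℂ) + ((-b : ℝ) : ℂ) * Complex.I) ^ (j + 1) =
        (starRingEnd ℂ) (((a : ℂ) + (b : ℂ) * Complex.I) ^ (j + 1)) := by
      intro a b
      rw [map_pow]; congr 1
      simp
    simp only [Y, e1, e2, n1, n2, p1, p2, if_true, if_false]
    simp only [solidHarmonic, hc]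
    rw [← harmonicWeight, Complex.re_ofReal_mul]
    simp only [Complex.add_re, Complex.mul_re, Complex.ofReal_re, Complex.ofReal_im, Complex.mul_im,
      Complex.conj_re, Complex.conj_im, zero_mul, sub_zero, add_zero]
    generalize ((((x : E3) 0 : ℂ) + ((x : E3) 1 : ℂ) * Complex.I) ^ (j + 1)) = w at *
    generalize ((((y : E3) 0 : ℂ) + ((y : E3) 1 : ℂ) * Complex.I) ^ (j + 1)) = z at *
    generalize (eval ((x : E3) 2) (derivative^[j + 1] (legendre ℓ))) = p at *
    generalize (eval ((y : E3) 2) (derivative^[j + 1] (legendre ℓ))) = q at *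
    generalize √(N ℓ * harmonicWeight ℓ (j + 1)) = A at *
    linear_combination (√2 * √2 * p * q * (w.re * z.re + w.im * z.im)) * h1 +
      (N ℓ * harmonicWeight ℓ (j + 1) * p * q * (w.re * z.re + w.im * z.im)) * h2

end AdditionTheorem

end SphericalField

namespace SphericalField

/-! ### Area measure, zonal projection and Archimedes' theorem -/

noncomputable section SphereMeasure

open Polynomial
open scoped Pointwise

/-- The action of a linear isometry on the sphere. -/
def sphereMap (R : E3 ≃ₗᵢ[ℝ] E3) : S2 ≃ₜ S2 where
  toFun x := ⟨R x, by simp⟩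
  invFun x := ⟨R.symm x, by simp⟩
  left_inv x := by simp
  right_inv x := by simp
  continuous_toFun := by fun_prop
  continuous_invFun := by fun_prop

@[simp]
theorem coe_sphereMap (R : E3 ≃ₗᵢ[ℝ] E3) (x : S2) : (sphereMap R x : E3) = R x := rfl

instance : IsFiniteMeasure area := by unfold area; infer_instance

/-- The area of a set is a multiple of the volume of the cone over it, and a linear isometry maps
cones to cones and preserves volume. -/
theorem measurePreserving_sphereMap (R : E3 ≃ₗᵢ[ℝ] E3) :
    MeasurePreserving (sphereMap R) area area := by
  refine ⟨(sphereMap R).continuous.measurable, ?_⟩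
  ext s hs
  rw [Measure.map_apply (sphereMap R).continuous.measurable hs, area,
    Measure.toSphere_apply' _ hs,
    Measure.toSphere_apply' _ ((sphereMap R).continuous.measurable hs)]
  congr 1
  refine Eq.trans ?_ (R.measurePreserving.measure_preimage_emb
    R.toHomeomorph.measurableEmbedding _)
  congr 1
  ext v
  simp only [Set.mem_smul, Set.mem_image, Set.mem_preimage, Subtype.exists, exists_and_right,
    exists_eq_right]
  constructor
  · rintro ⟨c, hc, y, ⟨hy, hys⟩, rfl⟩
    exact ⟨c, hc, R y, ⟨by simpa using hy, hys⟩, by simp⟩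
  · rintro ⟨c, hc, y, ⟨hy, hys⟩, h⟩
    refine ⟨c, hc, R.symm y, ⟨by simpa using hy, ?_⟩, ?_⟩
    · convert! hys
      ext1; simp
    · rw [← map_smul, h]; simp

theorem integral_sphereMap (R : E3 ≃ₗᵢ[ℝ] E3) (F : S2 → ℝ) :
    ∫ z, F (sphereMap R z) ∂area = ∫ z, F z ∂area :=
  (measurePreserving_sphereMap R).integral_comp (sphereMap R).measurableEmbedding F

/-- The linear isometry of `ℝ³` given by the rotation of angle `τ` around the polar axis. -/
def spinIsometry (τ : ℝ) : E3 ≃ₗᵢ[ℝ] E3 :=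
  LinearIsometry.toLinearIsometryEquiv (F := E3) (E₁ := E3)
    { toFun := fun v ↦ WithLp.toLp 2 (spin τ v)
      map_add' := fun v w ↦ by
        ext i; fin_cases i <;> simp [spin] <;> ring
      map_smul' := fun c v ↦ by
        ext i; fin_cases i <;> simp [spin] <;> ring
      norm_map' := fun v ↦ by
        rw [EuclideanSpace.norm_eq, EuclideanSpace.norm_eq]
        congr 1
        simp only [LinearMap.coe_mk, AddHom.coe_mk, spin, Fin.sum_univ_three, Real.norm_eq_abs,
          sq_abs, Matrix.cons_val_zero, Matrix.cons_val_one, Matrix.cons_val]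
        linear_combination (v 0 ^ 2 + v 1 ^ 2) * Real.sin_sq_add_cos_sq τ }
    rfl

theorem spinIsometry_apply (τ : ℝ) (v : E3) (i : Fin 3) : spinIsometry τ v i = spin τ v i := rfl

/-- The spin by π/|m| multiplies (x₀ + ix₁)^|m| by e^{iπ} = -1. As the spin keeps heights and area,
harmonics of nonzero order integrate to 0 against functions of the height. -/
theorem Y_sphereMap_spinIsometry (ℓ : ℕ) {m : ℤ} (hm : m ≠ 0) (z : S2) :
    Y ℓ m (sphereMap (spinIsometry (Real.pi / m.natAbs)) z) = -Y ℓ m z := by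
  set k := m.natAbs with hk
  have hk0 : (k : ℝ) ≠ 0 := by simpa [hk] using hm
  have hw : ∀ z : S2,
      ((((sphereMap (spinIsometry (Real.pi / k)) z : S2) : E3) 0 : ℂ) +
      (((sphereMap (spinIsometry (Real.pi / k)) z : S2) : E3) 1 : ℂ) * Complex.I) ^ k =
      -((((z : E3) 0 : ℂ) + ((z : E3) 1 : ℂ) * Complex.I) ^ k) := by
    intro z
    have e : (((sphereMap (spinIsometry (Real.pi / k)) z : S2) : E3) 0 : ℂ) +
      (((sphereMap (spinIsometry (Real.pi / k)) z : S2) : E3) 1 : ℂ) * Complex.I =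
      Complex.exp ((Real.pi / k : ℝ) * Complex.I) *
        (((z : E3) 0 : ℂ) + ((z : E3) 1 : ℂ) * Complex.I) := by
      rw [coe_sphereMap, spinIsometry_apply, spinIsometry_apply, Complex.exp_mul_I]
      simp only [spin, Matrix.cons_val_zero, Matrix.cons_val_one]
      push_cast
      linear_combination (-((z : E3) 1 : ℂ) * Complex.sin (Real.pi / k)) * Complex.I_sq
    rw [e, mul_pow, ← Complex.exp_nat_mul]
    have : (k : ℂ) * (((Real.pi / k : ℝ) : ℂ) * Complex.I) = Real.pi * Complex.I := by
      have : (k : ℂ) ≠ 0 := by exact_mod_cast hk0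
      push_cast
      field_simp
    rw [this, Complex.exp_pi_mul_I, neg_one_mul]
  have h2 : ((sphereMap (spinIsometry (Real.pi / k)) z : S2) : E3) 2 = (z : E3) 2 := by
    rw [coe_sphereMap, spinIsometry_apply]
    simp [spin]
  simp only [Y, ← hk, hw, h2, if_neg hm, Complex.neg_re, Complex.neg_im]
  split_ifs <;> ring

theorem integral_mul_Y_eq_zero (ℓ : ℕ) {m : ℤ} (hm : m ≠ 0) (F : ℝ → ℝ) :
    ∫ z : S2, F ((z : E3) 2) * Y ℓ m z ∂area = 0 := by
  have h := integral_sphereMap (spinIsometry (Real.pi / m.natAbs))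
    (fun z ↦ F ((z : E3) 2) * Y ℓ m z)
  have h2 : ∀ z : S2, ((sphereMap (spinIsometry (Real.pi / m.natAbs)) z : S2) : E3) 2 =
      (z : E3) 2 := fun z ↦ by
    rw [coe_sphereMap, spinIsometry_apply]
    simp [spin]
  simp only [h2, Y_sphereMap_spinIsometry ℓ hm, mul_neg, integral_neg] at h
  linarith

/-- Invariance of area and inner products needs no orientation, so a reflection is enough for
transitivity. -/
theorem exists_isometry_map_eq (x y : S2) : ∃ R : E3 ≃ₗᵢ[ℝ] E3, R x = y :=
  ⟨Submodule.reflection (Submodule.span ℝ {(x : E3) - y})ᗮ,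
    Submodule.reflection_sub (by simp)⟩

theorem continuous_Y (ℓ : ℕ) (m : ℤ) : Continuous (Y ℓ m) := by
  unfold Y
  have h : Continuous fun x : S2 ↦ ((((x : E3) 0 : ℂ) + ((x : E3) 1 : ℂ) * Complex.I) ^ m.natAbs) := by
    fun_prop
  have h1 := Complex.continuous_re.comp h
  have h2 := Complex.continuous_im.comp h
  have h3 : Continuous fun x : S2 ↦
    (derivative^[m.natAbs] (legendre ℓ)).eval ((x : E3) 2) := by fun_prop
  simp only [Function.comp_def] at h1 h2
  split_ifs <;> fun_prop

theorem _root_.Continuous.integrable_area {F : S2 → ℝ} (hF : Continuous F) : Integrable F area :=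
  hF.integrable_of_hasCompactSupport (HasCompactSupport.of_compactSpace F)

theorem Y_zero (ℓ : ℕ) (x : S2) : Y ℓ 0 x = √(N ℓ) * (legendre ℓ).eval ((x : E3) 2) := by
  have : (ℓ.factorial : ℝ) ≠ 0 := by exact_mod_cast Nat.factorial_ne_zero ℓ
  simp [Y, this]

/-- The zonal projection formula at the north pole. -/
theorem integral_mul_legendre_inner (ℓ : ℕ) {F : ℝ → ℝ} (hF : Continuous F) (y : S2) :
    ∫ z : S2, F ((z : E3) 2) * (legendre ℓ).eval (inner ℝ (y : E3) (z : E3)) ∂area =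
      (legendre ℓ).eval ((y : E3) 2) *
        ∫ z : S2, F ((z : E3) 2) * (legendre ℓ).eval ((z : E3) 2) ∂area := by
  have hN := N_pos ℓ
  -- Expand P_ℓ(y·z) by the addition theorem. Only m = 0 survives the integration over z.
  have h1 : ∀ z : S2, F ((z : E3) 2) * (legendre ℓ).eval (inner ℝ (y : E3) (z : E3)) =
      ∑ m : Finset.Icc (-(ℓ : ℤ)) (ℓ : ℤ), (N ℓ)⁻¹ * Y ℓ m y * (F ((z : E3) 2) * Y ℓ m z) := by
    intro z
    have : ∀ m : Finset.Icc (-(ℓ : ℤ)) (ℓ : ℤ), (N ℓ)⁻¹ * Y ℓ m y * (F ((z : E3) 2) * Y ℓ m z) =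
      ((N ℓ)⁻¹ * F ((z : E3) 2)) * (Y ℓ m y * Y ℓ m z) := fun m ↦ by ring
    simp_rw [this]
    rw [← Finset.mul_sum, sum_Y_mul_Y]
    field_simp
  simp_rw [h1]
  rw [integral_finsetSum _ fun m _ ↦ Continuous.integrable_area (by
    have := continuous_Y ℓ m
    fun_prop)]
  rw [Finset.sum_eq_single (⟨0, by simp⟩ : Finset.Icc (-(ℓ : ℤ)) (ℓ : ℤ))]
  · rw [integral_const_mul, Y_zero]
    simp_rw [Y_zero]
    have : ∀ z : S2, F ((z : E3) 2) * (√(N ℓ) * (legendre ℓ).eval ((z : E3) 2)) =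
      √(N ℓ) * (F ((z : E3) 2) * (legendre ℓ).eval ((z : E3) 2)) := fun z ↦ by ring
    simp_rw [this]
    rw [integral_const_mul]
    have hs := Real.mul_self_sqrt hN.le
    field_simp
    linear_combination (eval ((y : E3) 2) (legendre ℓ) *
      ∫ z : S2, F ((z : E3) 2) * (legendre ℓ).eval ((z : E3) 2) ∂area) * hs
  · intro m _ hm
    rw [integral_const_mul, integral_mul_Y_eq_zero ℓ (fun h ↦ hm (Subtype.ext h)), mul_zero]
  · simp

theorem inner_northPole (z : E3) : inner ℝ (northPole : E3) z = z 2 := by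
  simp [inner_eq, northPole]

theorem area_univ : area Set.univ = ENNReal.ofReal (4 * Real.pi) := by
  rw [area, Measure.toSphere_apply_univ, EuclideanSpace.volume_ball_fin_three]
  simp only [finrank_euclideanSpace, Fintype.card_fin, Nat.cast_ofNat, ENNReal.ofReal_one, one_pow,
    one_mul]
  rw [show (3 : ℝ≥0∞) = ENNReal.ofReal 3 by simp, ← ENNReal.ofReal_mul (by norm_num)]
  congr 1; ring

theorem exists_S2_height {t : ℝ} (ht : t ∈ Set.Icc (-1 : ℝ) 1) : ∃ x : S2, (x : E3) 2 = t := by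
  have h : 0 ≤ 1 - t ^ 2 := by nlinarith [ht.1, ht.2]
  refine ⟨⟨!₂[√(1 - t ^ 2), 0, t], ?_⟩, by simp⟩
  rw [mem_sphere_zero_iff_norm, EuclideanSpace.norm_eq, Fin.sum_univ_three]
  simp [Real.sq_sqrt h]

/-- The law of the height is not yet known. If I is the integral, rotation invariance and the zonal
projection formula give I = P_ℓ(y₂) I for every y, so I ≠ 0 would force P_ℓ = 1 on [-1,1], against
orthogonality to P₀. -/
theorem integral_legendre_height {ℓ : ℕ} (hℓ : ℓ ≠ 0) :
    ∫ z : S2, (legendre ℓ).eval ((z : E3) 2) ∂area = 0 := by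
  have h : ∀ y : S2, ∫ z : S2, (legendre ℓ).eval ((z : E3) 2) ∂area =
      (legendre ℓ).eval ((y : E3) 2) * ∫ z : S2, (legendre ℓ).eval ((z : E3) 2) ∂area := by
    intro y
    have h1 := integral_mul_legendre_inner ℓ (continuous_const (y := (1 : ℝ))) y
    simp only [one_mul] at h1
    rw [← h1]
    obtain ⟨R, hR⟩ := exists_isometry_map_eq northPole y
    rw [← integral_sphereMap R (fun z ↦ (legendre ℓ).eval (inner ℝ (y : E3) (z : E3)))]
    simp only [coe_sphereMap, ← hR, R.inner_map_map, inner_northPole]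
  by_contra hne
  have h1 : ∀ t ∈ Set.Icc (-1 : ℝ) 1, (legendre ℓ).eval t = 1 := by
    intro t ht
    obtain ⟨y, rfl⟩ := exists_S2_height ht
    have := h y
    exact mul_right_cancel₀ hne (by linarith)
  have h2 := integral_legendre_mul_legendre 0 ℓ
  rw [if_neg hℓ.symm] at h2
  have h3 : ∫ t in (-1 : ℝ)..1, (legendre 0).eval t * (legendre ℓ).eval t =
      ∫ t in (-1 : ℝ)..1, (1 : ℝ) := by
    refine intervalIntegral.integral_congr fun t ht ↦ ?_
    rw [Set.uIcc_of_le (by norm_num)] at ht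
    simp only [h1 t ht]
    simp [legendre]
  rw [h3] at h2
  norm_num at h2

theorem coeff_legendre_self_ne_zero (ℓ : ℕ) : (legendre ℓ).coeff ℓ ≠ 0 := by
  rw [legendre, coeff_C_mul, coeff_iterate_derivative]
  have hm : ((X : ℝ[X]) ^ 2 - 1).Monic := by
    have := monic_X_pow_sub_C (1 : ℝ) (two_ne_zero)
    simpa using this
  have hd : ((X : ℝ[X]) ^ 2 - 1).natDegree = 2 := by
    have := natDegree_X_pow_sub_C (n := 2) (r := (1 : ℝ))
    simpa using this
  have h1 : (((X : ℝ[X]) ^ 2 - 1) ^ ℓ).coeff (ℓ + ℓ) = 1 := by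
    have h := (hm.pow ℓ).coeff_natDegree
    rwa [hm.natDegree_pow, hd, mul_two] at h
  rw [h1]
  have := Nat.factorial_ne_zero ℓ
  have h3 : (ℓ + ℓ).descFactorial ℓ ≠ 0 := by
    rw [Ne, Nat.descFactorial_eq_zero_iff_lt]; omega
  simp only [nsmul_eq_mul, mul_one]
  have h4 : ((ℓ + ℓ).descFactorial ℓ : ℝ) ≠ 0 := by exact_mod_cast h3
  positivity

theorem degree_legendre (ℓ : ℕ) : (legendre ℓ).degree = ℓ :=
  le_antisymm (degree_le_of_natDegree_le (natDegree_legendre_le ℓ))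
    (le_degree_of_ne_zero (coeff_legendre_self_ne_zero ℓ))

/-- The Legendre polynomials, as a polynomial sequence. -/
def legendreSequence : Polynomial.Sequence ℝ := ⟨legendre, degree_legendre⟩

theorem span_range_legendre : Submodule.span ℝ (Set.range legendre) = ⊤ :=
  legendreSequence.span fun i ↦ (leadingCoeff_ne_zero.2 (legendreSequence.ne_zero i)).isUnit

/-- The image of the area measure under the height function: `2π` times Lebesgue measure on
`[-1, 1]`. -/
def heightMeasure : Measure ℝ :=
  ENNReal.ofReal (2 * Real.pi) • volume.restrict (Set.Icc (-1) 1)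

instance : IsFiniteMeasure heightMeasure := by
  unfold heightMeasure
  exact Measure.smul_finite _ ENNReal.ofReal_ne_top

theorem integral_heightMeasure (F : ℝ → ℝ) :
    ∫ t, F t ∂heightMeasure = 2 * Real.pi * ∫ t in (-1 : ℝ)..1, F t := by
  rw [heightMeasure, integral_smul_measure, ENNReal.toReal_ofReal (by positivity),
    intervalIntegral.integral_of_le (by norm_num), integral_Icc_eq_integral_Ioc, smul_eq_mul]

theorem ae_heightMeasure_mem_Icc : ∀ᵐ t ∂heightMeasure, t ∈ Set.Icc (-1 : ℝ) 1 :=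
  Measure.ae_smul_measure (ae_restrict_mem measurableSet_Icc) _

/-- Both measures live on a compact interval, where Weierstrass approximation reduces bounded
continuous test functions to polynomials. -/
theorem measure_ext_of_integral_polynomial {μ ν : Measure ℝ} [IsFiniteMeasure μ]
    [IsFiniteMeasure ν] (hμ : ∀ᵐ t ∂μ, t ∈ Set.Icc (-1 : ℝ) 1)
    (hν : ∀ᵐ t ∂ν, t ∈ Set.Icc (-1 : ℝ) 1)
    (h : ∀ p : ℝ[X], ∫ t, p.eval t ∂μ = ∫ t, p.eval t ∂ν) : μ = ν := by
  have hpi : ∀ (μ : Measure ℝ) [IsFiniteMeasure μ], (∀ᵐ t ∂μ, t ∈ Set.Icc (-1 : ℝ) 1) →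
      ∀ F : ℝ → ℝ, Continuous F → Integrable F μ := by
    intro μ _ hμ F hF
    obtain ⟨C, hC⟩ := (isCompact_Icc (a := (-1 : ℝ)) (b := 1)).exists_bound_of_continuousOn
      hF.continuousOn
    exact Integrable.of_bound hF.aestronglyMeasurable C (hμ.mono fun t ht ↦ hC t ht)
  refine ext_of_forall_integral_eq_of_IsFiniteMeasure fun f ↦ ?_
  refine eq_of_abs_sub_le_all fun ε hε ↦ ?_
  set M := μ.real Set.univ + ν.real Set.univ + 1 with hM
  have hMpos : 0 < M := by positivity
  obtain ⟨p, hp⟩ := exists_polynomial_near_of_continuousOn (-1) 1 f f.continuous.continuousOn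
    (ε / M) (by positivity)
  have key : ∀ (μ : Measure ℝ) [IsFiniteMeasure μ], (∀ᵐ t ∂μ, t ∈ Set.Icc (-1 : ℝ) 1) →
      |∫ t, p.eval t ∂μ - ∫ t, f t ∂μ| ≤ ε / M * μ.real Set.univ := by
    intro μ _ hμ
    rw [← integral_sub (hpi μ hμ _ p.continuous) (hpi μ hμ _ f.continuous)]
    rw [← Real.norm_eq_abs]
    exact norm_integral_le_of_norm_le_const
      (hμ.mono fun t ht ↦ (Real.norm_eq_abs _).le.trans (hp t ht).le)
  have h1 := key μ hμ
  have h2 := key ν hν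
  rw [h p] at h1
  have h3 : |∫ t, f t ∂μ - ∫ t, f t ∂ν| ≤ ε / M * μ.real Set.univ + ε / M * ν.real Set.univ := by
    rw [abs_le] at *
    constructor <;> linarith [h1.1, h1.2, h2.1, h2.2]
  refine h3.trans ?_
  rw [← mul_add, div_mul_eq_mul_div, div_le_iff₀ hMpos]
  nlinarith

theorem inner_mem_Icc (x z : S2) : inner ℝ (x : E3) (z : E3) ∈ Set.Icc (-1 : ℝ) 1 := by
  have := abs_real_inner_le_norm (x : E3) (z : E3)
  simp only [norm_eq_of_mem_sphere, mul_one] at this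
  exact abs_le.1 this

/-- **Archimedes' theorem**: the height with respect to any axis is uniformly distributed. -/
theorem measurePreserving_inner (x : S2) :
    MeasurePreserving (fun z : S2 ↦ inner ℝ (x : E3) (z : E3)) area heightMeasure := by
  have hm : Measurable (fun z : S2 ↦ inner ℝ (x : E3) (z : E3)) :=
    (by fun_prop : Continuous _).measurable
  refine ⟨hm, ?_⟩
  refine measure_ext_of_integral_polynomial ?_ ae_heightMeasure_mem_Icc fun p ↦ ?_
  · refine (ae_map_iff hm.aemeasurable measurableSet_Icc).2 ?_
    exact ae_of_all _ fun z ↦ inner_mem_Icc x z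
  -- By linearity it suffices to test Legendre polynomials: for ℓ ≠ 0 both integrals vanish, and for
  -- ℓ = 0 both equal the total mass 4π.
  have hp : p ∈ Submodule.span ℝ (Set.range legendre) := by
    rw [span_range_legendre]; trivial
  have hia : ∀ p : ℝ[X], Integrable (fun t ↦ p.eval t)
      (area.map fun z : S2 ↦ inner ℝ (x : E3) (z : E3)) := fun p ↦ by
    rw [integrable_map_measure p.continuous.aestronglyMeasurable hm.aemeasurable]
    exact Continuous.integrable_area (by simp only [Function.comp_def]; fun_prop)
  have hib : ∀ p : ℝ[X], Integrable (fun t ↦ p.eval t) heightMeasure := fun p ↦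
    (p.continuous.integrableOn_Icc (μ := volume)).smul_measure ENNReal.ofReal_ne_top
  induction hp using Submodule.span_induction with
  | mem p hp =>
    obtain ⟨ℓ, rfl⟩ := hp
    rw [integral_map hm.aemeasurable (legendre ℓ).continuous.aestronglyMeasurable,
      integral_heightMeasure]
    have h2 := integral_legendre_mul_legendre 0 ℓ
    have h0 : legendre 0 = 1 := by simp [legendre]
    simp only [h0, eval_one, one_mul] at h2
    rw [h2]
    obtain ⟨R, hR⟩ := exists_isometry_map_eq northPole x
    rw [← integral_sphereMap R]
    simp only [coe_sphereMap, ← hR, R.inner_map_map, inner_northPole]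
    split_ifs with h
    · subst h
      simp only [h0, eval_one, integral_const, smul_eq_mul, measureReal_def, area_univ]
      rw [ENNReal.toReal_ofReal (by positivity)]
      norm_num; ring
    · rw [integral_legendre_height (Ne.symm h), mul_zero]
  | zero => simp
  | add p q _ _ hp hq =>
    simp only [eval_add]
    rw [integral_add (hia p) (hia q), integral_add (hib p) (hib q), hp, hq]
  | smul c p _ hp =>
    simp only [eval_smul, smul_eq_mul]
    rw [integral_const_mul, integral_const_mul, hp]

theorem integral_comp_inner (x : S2) {F : ℝ → ℝ} (hF : Continuous F) :
    ∫ z : S2, F (inner ℝ (x : E3) (z : E3)) ∂area = ∫ t, F t ∂heightMeasure := by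
  rw [← (measurePreserving_inner x).map_eq,
    integral_map (measurePreserving_inner x).aemeasurable hF.aestronglyMeasurable]

theorem integral_legendre_mul_legendre_heightMeasure (ℓ k : ℕ) :
    ∫ t, (legendre ℓ).eval t * (legendre k).eval t ∂heightMeasure =
      if ℓ = k then (N ℓ)⁻¹ else 0 := by
  rw [integral_heightMeasure, integral_legendre_mul_legendre]
  split_ifs
  · rw [N]; field_simp; norm_num
  · simp

/-- Convolution of two Legendre polynomials on the sphere. -/
theorem integral_legendre_inner_mul_legendre_inner (ℓ k : ℕ) (x y : S2) :
    ∫ z : S2, (legendre ℓ).eval (inner ℝ (x : E3) (z : E3)) *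
      (legendre k).eval (inner ℝ (y : E3) (z : E3)) ∂area =
      if ℓ = k then (N ℓ)⁻¹ * (legendre ℓ).eval (inner ℝ (x : E3) (y : E3)) else 0 := by
  -- Moving x to the pole makes the first factor a function of the height, so the zonal projection
  -- formula applies.
  obtain ⟨R, hR⟩ := exists_isometry_map_eq northPole x
  have hy : (y : E3) = R (R.symm y) := by simp
  rw [← integral_sphereMap R]
  have h1 := integral_mul_legendre_inner k (legendre ℓ).continuous (sphereMap R.symm y)
  simp only [coe_sphereMap] at h1 ⊢
  have e : ∀ z : S2, inner ℝ (y : E3) (R (z : E3)) = inner ℝ (R.symm (y : E3)) (z : E3) := by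
    intro z
    conv_lhs => rw [hy, R.inner_map_map]
  have e2 : inner ℝ (x : E3) (y : E3) = (R.symm (y : E3)) 2 := by
    rw [← inner_northPole, hy, ← hR, R.inner_map_map]; simp
  rw [e2]
  simp only [e, ← hR, R.inner_map_map, inner_northPole]
  rw [h1]
  have h3 := integral_comp_inner northPole
    (F := fun t ↦ (legendre ℓ).eval t * (legendre k).eval t) (by fun_prop)
  simp only [inner_northPole] at h3
  rw [h3, integral_legendre_mul_legendre_heightMeasure]
  split_ifs with h
  · subst h; ring
  · simp

end SphereMeasure

end SphericalField

namespace SphericalField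

/-! ### The Legendre basis and Parseval's formula for zonal convolutions -/

noncomputable section LegendreBasis

open Polynomial

theorem _root_.Continuous.memLp_heightMeasure {F : ℝ → ℝ} (hF : Continuous F) (p : ℝ≥0∞) :
    MemLp F p heightMeasure := by
  obtain ⟨C, hC⟩ := (isCompact_Icc (a := (-1 : ℝ)) (b := 1)).exists_bound_of_continuousOn
    hF.continuousOn
  exact MemLp.of_bound hF.aestronglyMeasurable C (ae_heightMeasure_mem_Icc.mono fun t ht ↦ hC t ht)

theorem _root_.Continuous.integrable_heightMeasure {F : ℝ → ℝ} (hF : Continuous F) :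
    Integrable F heightMeasure :=
  memLp_one_iff_integrable.1 (hF.memLp_heightMeasure 1)

/-- The normalised Legendre polynomial `√N_ℓ P_ℓ`. -/
def normLegendre (ℓ : ℕ) (t : ℝ) : ℝ := √(N ℓ) * (legendre ℓ).eval t

theorem continuous_normLegendre (ℓ : ℕ) : Continuous (normLegendre ℓ) := by
  unfold normLegendre; fun_prop

/-- The normalised Legendre polynomials as elements of `L²`. -/
def legendreLp (ℓ : ℕ) : Lp ℝ 2 heightMeasure :=
  ((continuous_normLegendre ℓ).memLp_heightMeasure 2).toLp _

theorem inner_toLp {α : Type*} [MeasurableSpace α] {μ : Measure α} {f g : α → ℝ}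
    (hf : MemLp f 2 μ) (hg : MemLp g 2 μ) :
    inner ℝ (hf.toLp f) (hg.toLp g) = ∫ t, f t * g t ∂μ := by
  rw [L2.inner_def]
  refine integral_congr_ae ?_
  filter_upwards [hf.coeFn_toLp, hg.coeFn_toLp] with t h1 h2
  rw [h1, h2]; simp [mul_comm]

theorem inner_toLp_left {α : Type*} [MeasurableSpace α] {μ : Measure α} {f : α → ℝ}
    (hf : MemLp f 2 μ) (h : Lp ℝ 2 μ) :
    inner ℝ (hf.toLp f) h = ∫ t, f t * h t ∂μ := by
  conv_lhs => rw [← Lp.toLp_coeFn h (Lp.memLp h)]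
  exact inner_toLp hf (Lp.memLp h)

theorem orthonormal_legendreLp : Orthonormal ℝ legendreLp := by
  rw [orthonormal_iff_ite]
  intro ℓ k
  rw [legendreLp, legendreLp, inner_toLp]
  have : ∀ t, normLegendre ℓ t * normLegendre k t =
    (√(N ℓ) * √(N k)) * ((legendre ℓ).eval t * (legendre k).eval t) := fun t ↦ by
    simp only [normLegendre]; ring
  simp_rw [this]
  rw [integral_const_mul, integral_legendre_mul_legendre_heightMeasure]
  split_ifs with h
  · rw [h, Real.mul_self_sqrt (N_pos k).le, mul_inv_cancel₀ (N_pos k).ne']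
  · simp

/-- Completeness of the system: a function orthogonal to all polynomials is, by Weierstrass
approximation on [-1,1], orthogonal to every smooth test function. -/
theorem ae_eq_zero_of_integral_legendre_mul_eq_zero {h : ℝ → ℝ} (hh : Integrable h heightMeasure)
    (h0 : ∀ ℓ, ∫ t, (legendre ℓ).eval t * h t ∂heightMeasure = 0) : h =ᵐ[heightMeasure] 0 := by
  have hint : ∀ F : ℝ → ℝ, Continuous F → Integrable (fun t ↦ F t * h t) heightMeasure := by
    intro F hF
    obtain ⟨C, hC⟩ := (isCompact_Icc (a := (-1 : ℝ)) (b := 1)).exists_bound_of_continuousOn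
      hF.continuousOn
    exact hh.bdd_mul hF.aestronglyMeasurable (ae_heightMeasure_mem_Icc.mono fun t ht ↦ hC t ht)
  have hpoly : ∀ p : ℝ[X], ∫ t, p.eval t * h t ∂heightMeasure = 0 := by
    intro p
    have hp : p ∈ Submodule.span ℝ (Set.range legendre) := by
      rw [span_range_legendre]; trivial
    induction hp using Submodule.span_induction with
    | mem p hp => obtain ⟨ℓ, rfl⟩ := hp; exact h0 ℓ
    | zero => simp
    | add p q _ _ hp hq =>
      simp only [eval_add, add_mul]
      rw [integral_add (hint _ p.continuous) (hint _ q.continuous), hp, hq, add_zero]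
    | smul c p _ hp =>
      simp only [eval_smul, smul_eq_mul, mul_assoc]
      rw [integral_const_mul, hp, mul_zero]
  refine ae_eq_zero_of_integral_contDiff_smul_eq_zero hh.locallyIntegrable fun g hg _ ↦ ?_
  simp only [smul_eq_mul]
  refine eq_of_abs_sub_le_all fun ε hε ↦ ?_
  rw [sub_zero]
  set M := ∫ t, |h t| ∂heightMeasure with hM
  have hM0 : 0 ≤ M := integral_nonneg fun t ↦ abs_nonneg _
  obtain ⟨p, hp⟩ := exists_polynomial_near_of_continuousOn (-1) 1 g hg.continuous.continuousOn
    (ε / (M + 1)) (by positivity)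
  have e : ∫ t, g t * h t ∂heightMeasure = ∫ t, (g t - p.eval t) * h t ∂heightMeasure := by
    simp only [sub_mul]
    rw [integral_sub (hint _ hg.continuous) (hint _ p.continuous), hpoly, sub_zero]
  rw [e, ← Real.norm_eq_abs]
  calc ‖∫ t, (g t - p.eval t) * h t ∂heightMeasure‖
      ≤ ∫ t, ε / (M + 1) * |h t| ∂heightMeasure := by
        refine norm_integral_le_of_norm_le (hh.abs.const_mul _) ?_
        filter_upwards [ae_heightMeasure_mem_Icc] with t ht
        rw [norm_mul, Real.norm_eq_abs, Real.norm_eq_abs, abs_sub_comm]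
        exact mul_le_mul_of_nonneg_right (hp t ht).le (abs_nonneg _)
    _ = ε / (M + 1) * M := by rw [integral_const_mul]
    _ ≤ ε := by
        rw [div_mul_eq_mul_div, div_le_iff₀ (by positivity)]
        nlinarith

theorem integrable_of_memLp_heightMeasure {h : ℝ → ℝ} (hh : MemLp h 2 heightMeasure) :
    Integrable h heightMeasure :=
  hh.integrable (by norm_num)

/-- The Hilbert basis of normalised Legendre polynomials. -/
def legendreBasis : HilbertBasis ℕ ℝ (Lp ℝ 2 heightMeasure) :=
  HilbertBasis.mkOfOrthogonalEqBot orthonormal_legendreLp <| by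
    rw [Submodule.eq_bot_iff]
    intro h hh
    rw [Submodule.mem_orthogonal] at hh
    refine (Lp.eq_zero_iff_ae_eq_zero).2 ?_
    refine ae_eq_zero_of_integral_legendre_mul_eq_zero
      (integrable_of_memLp_heightMeasure (Lp.memLp h)) fun ℓ ↦ ?_
    have := hh _ (Submodule.subset_span (Set.mem_range_self ℓ))
    rw [legendreLp, inner_toLp_left] at this
    simp only [normLegendre, mul_assoc] at this
    rw [integral_const_mul] at this
    exact (mul_eq_zero.1 this).resolve_left (Real.sqrt_ne_zero'.2 (N_pos ℓ))

@[simp]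
theorem coe_legendreBasis : (legendreBasis : ℕ → Lp ℝ 2 heightMeasure) = legendreLp :=
  HilbertBasis.coe_mkOfOrthogonalEqBot _ _

/-- The Legendre coefficients of a function of the height. -/
def legendreCoeff (A : ℝ → ℝ) (ℓ : ℕ) : ℝ := ∫ t, normLegendre ℓ t * A t ∂heightMeasure

theorem inner_legendreLp {A : ℝ → ℝ} (hA : MemLp A 2 heightMeasure) (ℓ : ℕ) :
    inner ℝ (legendreLp ℓ) (hA.toLp A) = legendreCoeff A ℓ :=
  inner_toLp _ hA

/-- The zonal function with a given axis, as an element of `L²` of the sphere. -/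
def zonalLp (x : S2) : Lp ℝ 2 heightMeasure →ₗᵢ[ℝ] Lp ℝ 2 area :=
  Lp.compMeasurePreservingₗᵢ ℝ _ (measurePreserving_inner x)

theorem inner_zonalLp_toLp {A B : ℝ → ℝ} (hA : MemLp A 2 heightMeasure)
    (hB : MemLp B 2 heightMeasure) (x y : S2) :
    inner ℝ (zonalLp x (hA.toLp A)) (zonalLp y (hB.toLp B)) =
      ∫ z : S2, A (inner ℝ (x : E3) (z : E3)) * B (inner ℝ (y : E3) (z : E3)) ∂area :=
  inner_toLp (hA.comp_measurePreserving (measurePreserving_inner x))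
    (hB.comp_measurePreserving (measurePreserving_inner y))

/-- Zonal functions of different degrees are orthogonal even for different axes. This collapses the
double Legendre expansion of a zonal convolution into a single sum. -/
theorem inner_zonalLp_legendreLp (ℓ k : ℕ) (x y : S2) :
    inner ℝ (zonalLp x (legendreLp ℓ)) (zonalLp y (legendreLp k)) =
      if ℓ = k then (legendre ℓ).eval (inner ℝ (x : E3) (y : E3)) else 0 := by
  rw [legendreLp, legendreLp, inner_zonalLp_toLp]
  have : ∀ z : S2, normLegendre ℓ (inner ℝ (x : E3) (z : E3)) *
      normLegendre k (inner ℝ (y : E3) (z : E3)) = (√(N ℓ) * √(N k)) *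
      ((legendre ℓ).eval (inner ℝ (x : E3) (z : E3)) *
        (legendre k).eval (inner ℝ (y : E3) (z : E3))) := fun t ↦ by
    simp only [normLegendre]; ring
  simp_rw [this]
  rw [integral_const_mul, integral_legendre_inner_mul_legendre_inner]
  split_ifs with h
  · have := (N_pos k).ne'
    rw [h, Real.mul_self_sqrt (N_pos k).le]
    field_simp
  · simp

/-- Parseval's formula for the convolution of two zonal functions. -/
theorem hasSum_legendreCoeff_mul {A B : ℝ → ℝ} (hA : MemLp A 2 heightMeasure)
    (hB : MemLp B 2 heightMeasure) (x y : S2) :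
    HasSum (fun ℓ ↦ legendreCoeff A ℓ * legendreCoeff B ℓ *
      (legendre ℓ).eval (inner ℝ (x : E3) (y : E3)))
      (∫ z : S2, A (inner ℝ (x : E3) (z : E3)) * B (inner ℝ (y : E3) (z : E3)) ∂area) := by
  rw [← inner_zonalLp_toLp hA hB]
  have e : ∀ ℓ, inner ℝ (zonalLp x (legendreLp ℓ)) (zonalLp y (hB.toLp B)) =
      legendreCoeff B ℓ * (legendre ℓ).eval (inner ℝ (x : E3) (y : E3)) := by
    intro ℓ
    have h := ((innerSL ℝ (zonalLp x (legendreLp ℓ))).comp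
      (zonalLp y).toContinuousLinearMap).hasSum (legendreBasis.hasSum_repr (hB.toLp B))
    refine HasSum.unique h ?_
    convert! hasSum_single ℓ (f := fun k ↦ legendreCoeff B k *
      if ℓ = k then (legendre ℓ).eval (inner ℝ (x : E3) (y : E3)) else 0) ?_ using 1
    · ext k
      simp only [map_smul, smul_eq_mul, legendreBasis.repr_apply_apply,
        coe_legendreBasis, inner_legendreLp]
      rw [← inner_zonalLp_legendreLp]
      rfl
    · simp
    · intro k hk; simp [hk.symm]
  have h := ((innerSL ℝ (zonalLp y (hB.toLp B))).comp
      (zonalLp x).toContinuousLinearMap).hasSum (legendreBasis.hasSum_repr (hA.toLp A))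
  convert! h using 1
  · ext ℓ
    simp only [map_smul, smul_eq_mul, legendreBasis.repr_apply_apply,
        coe_legendreBasis, inner_legendreLp]
    rw [mul_assoc, ← e, real_inner_comm]
    rfl
  · rw [real_inner_comm]; rfl

end LegendreBasis

end SphericalField

namespace SphericalField

/-! ### The series of q, its weak derivative, and the energy of the truncated kernel -/

noncomputable section ZonalSeries

open Polynomial

/-- The sine of the colatitude as a function of the height. -/
def rho (t : ℝ) : ℝ := √(1 - t ^ 2)

theorem continuous_rho : Continuous rho := by unfold rho; fun_prop

theorem rho_sq {t : ℝ} (ht : t ∈ Set.Icc (-1 : ℝ) 1) : rho t ^ 2 = 1 - t ^ 2 :=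
  Real.sq_sqrt (by nlinarith [ht.1, ht.2])

theorem rho_pos {t : ℝ} (ht : t ∈ Set.Ioo (-1 : ℝ) 1) : 0 < rho t :=
  Real.sqrt_pos.2 (by nlinarith [ht.1, ht.2])

/-- N_ℓ exactly compensates the decay 2/(2ℓ+1), leaving 1/(2π). Uniformity in ℓ means that ∑ |c_ℓ| <
∞ suffices for q to converge off the poles. -/
theorem rho_mul_abs_normLegendre_le (ℓ : ℕ) {t : ℝ} (ht : t ∈ Set.Icc (-1 : ℝ) 1) :
    rho t * |normLegendre ℓ t| ≤ 1 := by
  refine abs_le_one_iff_mul_self_le_one.2 ?_ |> fun h ↦ (le_abs_self _).trans h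
  have h := one_sub_sq_mul_legendre_sq_le ℓ ht
  have h1 : rho t * |normLegendre ℓ t| * (rho t * |normLegendre ℓ t|) =
      N ℓ * ((1 - t ^ 2) * (legendre ℓ).eval t ^ 2) := by
    rw [← rho_sq ht, normLegendre, abs_mul, abs_of_nonneg (Real.sqrt_nonneg _),
      ← sq_abs ((legendre ℓ).eval t)]
    linear_combination (rho t ^ 2 * |(legendre ℓ).eval t| ^ 2) * Real.mul_self_sqrt (N_pos ℓ).le
  rw [h1]
  calc N ℓ * ((1 - t ^ 2) * (legendre ℓ).eval t ^ 2) ≤ N ℓ * (2 / (2 * ℓ + 1)) :=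
        mul_le_mul_of_nonneg_left h (N_pos ℓ).le
    _ = 1 / (2 * Real.pi) := by rw [N]; field_simp; norm_num
    _ ≤ 1 := by
        rw [div_le_one (by positivity)]
        linarith [Real.pi_gt_three]

variable {c : ℕ → ℝ}

/-- The weight ℓ² ignores degree 0. After a shift by one, n + 2 ≤ 2(n + 1) gives the factor 4. -/
theorem summable_sq_mul_succ_sq (hc : Summable fun ℓ : ℕ ↦ c ℓ ^ 2 * (ℓ : ℝ) ^ 2) :
    Summable fun ℓ : ℕ ↦ c ℓ ^ 2 * ((ℓ : ℝ) + 1) ^ 2 := by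
  rw [← summable_nat_add_iff 1] at hc ⊢
  refine Summable.of_nonneg_of_le (fun _ ↦ by positivity) (fun n ↦ ?_) (hc.mul_left 4)
  have h : (((n + 1 : ℕ) : ℝ) + 1) ^ 2 ≤ 4 * ((n + 1 : ℕ) : ℝ) ^ 2 := by
    push_cast; nlinarith [(Nat.cast_nonneg n : (0 : ℝ) ≤ n)]
  calc _ ≤ c (n + 1) ^ 2 * (4 * ((n + 1 : ℕ) : ℝ) ^ 2) :=
        mul_le_mul_of_nonneg_left h (sq_nonneg _)
    _ = _ := by ring

theorem summable_sq_of_succ (hc : Summable fun ℓ : ℕ ↦ c ℓ ^ 2 * ((ℓ : ℝ) + 1) ^ 2) :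
    Summable fun ℓ : ℕ ↦ c ℓ ^ 2 := by
  refine Summable.of_nonneg_of_le (fun _ ↦ by positivity) (fun n ↦ ?_) hc
  have : (1 : ℝ) ≤ ((n : ℝ) + 1) ^ 2 := by nlinarith [(Nat.cast_nonneg n : (0 : ℝ) ≤ n)]
  nlinarith [sq_nonneg (c n)]

theorem summable_energy_of_succ (hc : Summable fun ℓ : ℕ ↦ c ℓ ^ 2 * ((ℓ : ℝ) + 1) ^ 2) :
    Summable fun ℓ : ℕ ↦ c ℓ ^ 2 * ((ℓ : ℝ) * (ℓ + 1)) := by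
  refine Summable.of_nonneg_of_le (fun _ ↦ by positivity) (fun n ↦ ?_) hc
  have : (n : ℝ) * (n + 1) ≤ ((n : ℝ) + 1) ^ 2 := by nlinarith [(Nat.cast_nonneg n : (0 : ℝ) ≤ n)]
  exact mul_le_mul_of_nonneg_left this (sq_nonneg _)

/-- Write |c_ℓ| as |c_ℓ|(ℓ+1) times 1/(ℓ+1) and use the inequality of arithmetic and geometric
means. -/
theorem summable_abs_of_succ (hc : Summable fun ℓ : ℕ ↦ c ℓ ^ 2 * ((ℓ : ℝ) + 1) ^ 2) :
    Summable fun ℓ : ℕ ↦ |c ℓ| := by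
  have h2 : Summable fun ℓ : ℕ ↦ (1 : ℝ) / ((ℓ : ℝ) + 1) ^ 2 := by
    have := (summable_nat_add_iff 1).2 (Real.summable_one_div_nat_pow.2 one_lt_two)
    simpa using this
  refine Summable.of_nonneg_of_le (fun _ ↦ abs_nonneg _) (fun n ↦ ?_) (hc.add h2)
  have h3 : |c n| = (|c n| * ((n : ℝ) + 1)) * (1 / ((n : ℝ) + 1)) := by field_simp
  have h4 : c n ^ 2 * ((n : ℝ) + 1) ^ 2 = (|c n| * ((n : ℝ) + 1)) ^ 2 := by
    rw [mul_pow, sq_abs]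
  have h5 : (1 : ℝ) / ((n : ℝ) + 1) ^ 2 = (1 / ((n : ℝ) + 1)) ^ 2 := by rw [div_pow, one_pow]
  rw [h4, h5]
  refine h3.le.trans ?_
  nlinarith [sq_nonneg (|c n| * ((n : ℝ) + 1) - 1 / ((n : ℝ) + 1)),
    sq_nonneg (|c n| * ((n : ℝ) + 1)), sq_nonneg (1 / ((n : ℝ) + 1))]

/-- The zonal function `q` in terms of the height. -/
def zonalSeries (c : ℕ → ℝ) (t : ℝ) : ℝ := ∑' ℓ, c ℓ * normLegendre ℓ t

theorem qAngle_eq (c : ℕ → ℝ) (θ : ℝ) : qAngle c θ = zonalSeries c (Real.cos θ) := by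
  simp only [qAngle, zonalSeries, normLegendre, mul_assoc]

theorem cos_sphDist (x y : S2) : Real.cos (sphDist x y) = inner ℝ (x : E3) (y : E3) := by
  rw [sphDist, InnerProductGeometry.cos_angle]; simp

theorem q_eq (c : ℕ → ℝ) (x : S2) : q c x = zonalSeries c ((x : E3) 2) := by
  rw [q, qAngle_eq, cos_sphDist, inner_northPole]

theorem abs_mul_normLegendre_le (ℓ : ℕ) {t : ℝ} (ht : t ∈ Set.Ioo (-1 : ℝ) 1) :
    |c ℓ * normLegendre ℓ t| ≤ |c ℓ| * (rho t)⁻¹ := by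
  rw [abs_mul]
  refine mul_le_mul_of_nonneg_left ?_ (abs_nonneg _)
  rw [← one_div, le_div_iff₀ (rho_pos ht), mul_comm]
  exact rho_mul_abs_normLegendre_le ℓ (Set.Ioo_subset_Icc_self ht)

theorem hasSum_zonalSeries (hc : Summable fun ℓ : ℕ ↦ c ℓ ^ 2 * ((ℓ : ℝ) + 1) ^ 2) {t : ℝ}
    (ht : t ∈ Set.Ioo (-1 : ℝ) 1) :
    HasSum (fun ℓ ↦ c ℓ * normLegendre ℓ t) (zonalSeries c t) :=
  (Summable.of_norm_bounded ((summable_abs_of_succ hc).mul_right _)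
    fun ℓ ↦ abs_mul_normLegendre_le ℓ ht).hasSum

theorem ae_heightMeasure_mem_Ioo : ∀ᵐ t ∂heightMeasure, t ∈ Set.Ioo (-1 : ℝ) 1 := by
  refine Measure.ae_smul_measure ?_ _
  rw [← Measure.restrict_congr_set Ioo_ae_eq_Icc]
  exact ae_restrict_mem measurableSet_Ioo

/-- A subsequence of the partial sums converges almost everywhere to the L² sum, hence to the
pointwise sum. This identifies the pointwise series of q with its L² expansion. -/
theorem ae_eq_of_hasSum_Lp {α : Type*} [MeasurableSpace α] {μ : Measure α} {g : ℕ → α → ℝ}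
    (hg : ∀ ℓ, MemLp (g ℓ) 2 μ) {s : Lp ℝ 2 μ} (hs : HasSum (fun ℓ ↦ (hg ℓ).toLp (g ℓ)) s)
    {Q : α → ℝ} (hQ : ∀ᵐ t ∂μ, HasSum (fun ℓ ↦ g ℓ t) (Q t)) : s =ᵐ[μ] Q := by
  obtain ⟨ns, hns, h⟩ := (tendstoInMeasure_of_tendsto_Lp hs.tendsto_sum_nat).exists_seq_tendsto_ae
  have h2 : ∀ᵐ t ∂μ, ∀ n, (∑ ℓ ∈ Finset.range n, (hg ℓ).toLp (g ℓ) : Lp ℝ 2 μ) t =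
      ∑ ℓ ∈ Finset.range n, g ℓ t := by
    rw [ae_all_iff]
    intro n
    filter_upwards [Lp.coeFn_finsetSum (Finset.range n) (fun ℓ ↦ (hg ℓ).toLp (g ℓ)),
      ae_all_iff.2 fun ℓ ↦ (hg ℓ).coeFn_toLp] with t h1 h2
    rw [h1]; simp [h2]
  filter_upwards [h, h2, hQ] with t h h2 hQ
  refine tendsto_nhds_unique h ?_
  simp only [h2]
  exact hQ.tendsto_sum_nat.comp hns.tendsto_atTop

theorem summable_smul_of_orthonormal {H : Type*} [NormedAddCommGroup H] [InnerProductSpace ℝ H]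
    [CompleteSpace H] {v : ℕ → H} (hv : Orthonormal ℝ v) {c : ℕ → ℝ}
    (hc : Summable fun ℓ ↦ c ℓ ^ 2) : Summable fun ℓ ↦ c ℓ • v ℓ := by
  have := (hv.orthogonalFamily.summable_iff_norm_sq_summable c).2 (by simpa using hc)
  simpa using this

theorem hasSum_legendreLp (hc : Summable fun ℓ : ℕ ↦ c ℓ ^ 2 * ((ℓ : ℝ) + 1) ^ 2) :
    MemLp (zonalSeries c) 2 heightMeasure ∧ ∀ h : MemLp (zonalSeries c) 2 heightMeasure,
      HasSum (fun ℓ ↦ c ℓ • legendreLp ℓ) (h.toLp _) := by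
  have hs := (summable_smul_of_orthonormal orthonormal_legendreLp (summable_sq_of_succ hc)).hasSum
  have hg : ∀ ℓ, MemLp (fun t ↦ c ℓ * normLegendre ℓ t) 2 heightMeasure := fun ℓ ↦
    ((continuous_normLegendre ℓ).memLp_heightMeasure 2).const_mul _
  have e : ∀ ℓ, (hg ℓ).toLp _ = c ℓ • legendreLp ℓ := fun ℓ ↦
    MemLp.toLp_const_smul (c ℓ) ((continuous_normLegendre ℓ).memLp_heightMeasure 2)
  simp_rw [← e] at hs
  have hae := ae_eq_of_hasSum_Lp hg hs
    (ae_heightMeasure_mem_Ioo.mono fun t ht ↦ hasSum_zonalSeries hc ht)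
  have hm : MemLp (zonalSeries c) 2 heightMeasure := (memLp_congr_ae hae).1 (Lp.memLp _)
  refine ⟨hm, fun _ ↦ ?_⟩
  simp_rw [← e]
  convert! hs
  refine Lp.ext (hm.coeFn_toLp.trans hae.symm)

theorem memLp_zonalSeries (hc : Summable fun ℓ : ℕ ↦ c ℓ ^ 2 * ((ℓ : ℝ) + 1) ^ 2) :
    MemLp (zonalSeries c) 2 heightMeasure := (hasSum_legendreLp hc).1

theorem hasSum_integral_mul_normLegendre
    (hc : Summable fun ℓ : ℕ ↦ c ℓ ^ 2 * ((ℓ : ℝ) + 1) ^ 2) {w : ℝ → ℝ}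
    (hw : MemLp w 2 heightMeasure) :
    HasSum (fun ℓ ↦ c ℓ * ∫ t, w t * normLegendre ℓ t ∂heightMeasure)
      (∫ t, w t * zonalSeries c t ∂heightMeasure) := by
  have h := (innerSL ℝ (hw.toLp w)).hasSum ((hasSum_legendreLp hc).2 (memLp_zonalSeries hc))
  simp only [innerSL_apply_apply, inner_smul_right] at h
  simpa only [legendreLp, inner_toLp] using h

theorem legendreCoeff_zonalSeries (hc : Summable fun ℓ : ℕ ↦ c ℓ ^ 2 * ((ℓ : ℝ) + 1) ^ 2) (ℓ : ℕ) :
    legendreCoeff (zonalSeries c) ℓ = c ℓ := by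
  have h := hasSum_integral_mul_normLegendre hc ((continuous_normLegendre ℓ).memLp_heightMeasure 2)
  refine h.unique ?_
  have e : ∀ k, ∫ t, normLegendre ℓ t * normLegendre k t ∂heightMeasure =
      if ℓ = k then 1 else 0 := fun k ↦ by
    have := orthonormal_iff_ite.1 orthonormal_legendreLp ℓ k
    rwa [legendreLp, legendreLp, inner_toLp] at this
  simp only [e]
  convert! hasSum_single ℓ (f := fun k ↦ c k * if ℓ = k then (1 : ℝ) else 0) ?_ using 1
  · simp
  · intro k hk; simp [hk.symm]

/-- The weighted derivative `√N_ℓ √(1 - t²) P_ℓ'(t)`. -/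
def dLegendre (ℓ : ℕ) (t : ℝ) : ℝ := √(N ℓ) * (rho t * (derivative (legendre ℓ)).eval t)

theorem continuous_dLegendre (ℓ : ℕ) : Continuous (dLegendre ℓ) := by
  have := continuous_rho
  unfold dLegendre; fun_prop

/-- Green's formula for the normalised Legendre polynomials. -/
theorem integral_rho_mul_dLegendre (k : ℕ) {u u' : ℝ → ℝ}
    (hu : ∀ t, HasDerivAt u (u' t) t) (hu' : Continuous u') :
    ∫ t, rho t * u' t * dLegendre k t ∂heightMeasure =
      (k : ℝ) * (k + 1) * ∫ t, u t * normLegendre k t ∂heightMeasure := by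
  have h := integral_deriv_mul_derivative_legendre k hu hu'
  have e1 : ∫ t, rho t * u' t * dLegendre k t ∂heightMeasure =
      ∫ t, √(N k) * ((1 - t ^ 2) * u' t * (derivative (legendre k)).eval t) ∂heightMeasure := by
    refine integral_congr_ae ?_
    filter_upwards [ae_heightMeasure_mem_Icc] with t ht
    rw [← rho_sq ht, dLegendre]; ring
  have e2 : ∀ t, u t * normLegendre k t = √(N k) * (u t * (legendre k).eval t) := fun t ↦ by
    rw [normLegendre]; ring
  simp_rw [e1, e2]
  rw [integral_const_mul, integral_const_mul, integral_heightMeasure, integral_heightMeasure, h]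
  ring

theorem integral_dLegendre_mul_dLegendre (ℓ k : ℕ) :
    ∫ t, dLegendre ℓ t * dLegendre k t ∂heightMeasure =
      if ℓ = k then (ℓ : ℝ) * (ℓ + 1) else 0 := by
  have hd : ∀ t, HasDerivAt (normLegendre ℓ) (√(N ℓ) * (derivative (legendre ℓ)).eval t) t :=
    fun t ↦ ((legendre ℓ).hasDerivAt t).const_mul _
  have h := integral_rho_mul_dLegendre k hd (by fun_prop)
  have e : ∀ t, dLegendre ℓ t = rho t * (√(N ℓ) * (derivative (legendre ℓ)).eval t) := fun t ↦ by
    rw [dLegendre]; ring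
  simp_rw [e] at *
  rw [h]
  have := orthonormal_iff_ite.1 orthonormal_legendreLp ℓ k
  rw [legendreLp, legendreLp, inner_toLp] at this
  rw [this]
  split_ifs with h
  · rw [h]; ring
  · simp

/-- The weighted derivatives as elements of `L²`. -/
def dLegendreLp (ℓ : ℕ) : Lp ℝ 2 heightMeasure :=
  ((continuous_dLegendre ℓ).memLp_heightMeasure 2).toLp _

theorem inner_dLegendreLp (ℓ k : ℕ) :
    inner ℝ (dLegendreLp ℓ) (dLegendreLp k) = if ℓ = k then (ℓ : ℝ) * (ℓ + 1) else 0 := by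
  rw [dLegendreLp, dLegendreLp, inner_toLp, integral_dLegendre_mul_dLegendre]

/-- The orthonormal system of normalised weighted derivatives, in degrees `ℓ ≥ 1`. -/
def dLegendreUnit (j : ℕ) : Lp ℝ 2 heightMeasure :=
  (√(((j : ℝ) + 1) * (j + 2)))⁻¹ • dLegendreLp (j + 1)

theorem orthonormal_dLegendreUnit : Orthonormal ℝ dLegendreUnit := by
  rw [orthonormal_iff_ite]
  intro i j
  rw [dLegendreUnit, dLegendreUnit, inner_smul_left, inner_smul_right, inner_dLegendreLp]
  have hij : (i + 1 = j + 1) ↔ i = j := by omega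
  simp only [hij]
  split_ifs with h
  · subst h
    have h1 : (0 : ℝ) < ((i : ℝ) + 1) * (i + 2) := by positivity
    have h2 := Real.mul_self_sqrt h1.le
    have h3 := Real.sqrt_ne_zero'.2 h1
    simp only [conj_trivial]
    push_cast
    field_simp
    linear_combination -h2
  · simp

/-- The weighted derivatives are orthogonal with squared norms ℓ(ℓ+1). The orthonormal system starts
at degree 1 since degree 0 has zero derivative. -/
theorem summable_smul_dLegendreLp (hc : Summable fun ℓ : ℕ ↦ c ℓ ^ 2 * ((ℓ : ℝ) + 1) ^ 2) :
    Summable fun ℓ ↦ c ℓ • dLegendreLp ℓ := by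
  rw [← summable_nat_add_iff 1]
  have h1 : Summable fun j : ℕ ↦ (c (j + 1) * √(((j : ℝ) + 1) * (j + 2))) ^ 2 := by
    have := (summable_nat_add_iff 1).2 (summable_energy_of_succ hc)
    refine this.congr fun j ↦ ?_
    rw [mul_pow, Real.sq_sqrt (by positivity)]
    push_cast
    ring
  refine (summable_smul_of_orthonormal orthonormal_dLegendreUnit h1).congr fun j ↦ ?_
  rw [dLegendreUnit, smul_smul, mul_assoc, mul_inv_cancel₀ (Real.sqrt_ne_zero'.2 (by positivity)),
    mul_one]

/-- The weighted derivative `√(1 - t²) Q'(t)` of the zonal function. -/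
def zonalGrad (c : ℕ → ℝ) : Lp ℝ 2 heightMeasure := ∑' ℓ, c ℓ • dLegendreLp ℓ

theorem hasSum_integral_mul_dLegendre
    (hc : Summable fun ℓ : ℕ ↦ c ℓ ^ 2 * ((ℓ : ℝ) + 1) ^ 2) {w : ℝ → ℝ}
    (hw : MemLp w 2 heightMeasure) :
    HasSum (fun ℓ ↦ c ℓ * ∫ t, w t * dLegendre ℓ t ∂heightMeasure)
      (∫ t, w t * zonalGrad c t ∂heightMeasure) := by
  have h := (innerSL ℝ (hw.toLp w)).hasSum (summable_smul_dLegendreLp hc).hasSum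
  simp only [innerSL_apply_apply, inner_smul_right] at h
  rw [inner_toLp_left] at h
  simp_rw [dLegendreLp, inner_toLp] at h
  exact h

theorem setIntegral_heightMeasure {a b : ℝ} (hab : a ≤ b) (ha : -1 ≤ a) (hb : b ≤ 1) (F : ℝ → ℝ) :
    ∫ t, (Set.Ioc a b).indicator F t ∂heightMeasure = 2 * Real.pi * ∫ t in a..b, F t := by
  rw [heightMeasure, integral_smul_measure, ENNReal.toReal_ofReal (by positivity),
    integral_indicator measurableSet_Ioc, Measure.restrict_restrict measurableSet_Ioc,
    intervalIntegral.integral_of_le hab, smul_eq_mul,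
    Set.inter_eq_left.2 (show Set.Ioc a b ⊆ Set.Icc (-1) 1 from
      fun t ht ↦ ⟨ha.trans ht.1.le, ht.2.trans hb⟩)]

theorem memLp_indicator_inv_rho {a b : ℝ} (ha : -1 < a) (hb : b < 1) :
    MemLp ((Set.Ioc a b).indicator fun t ↦ (rho t)⁻¹) 2 heightMeasure := by
  have hsub : Set.Icc a b ⊆ Set.Ioo (-1) 1 := fun t ht ↦ ⟨ha.trans_le ht.1, ht.2.trans_lt hb⟩
  obtain ⟨C, hC⟩ := (isCompact_Icc (a := a) (b := b)).exists_bound_of_continuousOn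
    (f := fun t ↦ (rho t)⁻¹)
    (continuous_rho.continuousOn.inv₀ fun t ht ↦ (rho_pos (hsub ht)).ne')
  refine MemLp.of_bound ((continuous_rho.measurable.inv.indicator
    measurableSet_Ioc).aestronglyMeasurable) (max C 0) (ae_of_all _ fun t ↦ ?_)
  by_cases ht : t ∈ Set.Ioc a b
  · rw [Set.indicator_of_mem ht]
    exact (hC t (Set.Ioc_subset_Icc_self ht)).trans (le_max_left _ _)
  · rw [Set.indicator_of_notMem ht]; simp

theorem intervalIntegrable_zonalGrad {a b : ℝ} (hab : a ≤ b) (ha : -1 < a) (hb : b < 1) :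
    IntervalIntegrable (fun t ↦ (rho t)⁻¹ * zonalGrad c t) volume a b := by
  rw [intervalIntegrable_iff_integrableOn_Ioc_of_le hab]
  have h := (memLp_indicator_inv_rho ha hb).integrable_mul (Lp.memLp (zonalGrad c))
  replace h := (integrable_smul_measure (by simp [Real.pi_pos]) ENNReal.ofReal_ne_top).1 h
  have h2 := IntegrableOn.mono_set h (s := Set.Ioc a b)
    (fun t ht ↦ ⟨ha.le.trans ht.1.le, ht.2.trans hb.le⟩)
  refine h2.congr_fun (fun t ht ↦ ?_) measurableSet_Ioc
  simp only [Pi.mul_apply, Set.indicator_of_mem ht]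

/-- Pairing the L² series of weighted derivatives with 1/ρ on (a,b] integrates it term by term. So Q
is absolutely continuous on compact subintervals of (-1,1), with derivative ρ⁻¹ times `zonalGrad c`.
-/
theorem zonalSeries_sub (hc : Summable fun ℓ : ℕ ↦ c ℓ ^ 2 * ((ℓ : ℝ) + 1) ^ 2) {a b : ℝ}
    (hab : a ≤ b) (ha : -1 < a) (hb : b < 1) :
    zonalSeries c b - zonalSeries c a = ∫ t in a..b, (rho t)⁻¹ * zonalGrad c t := by
  have h1 := hasSum_integral_mul_dLegendre hc (memLp_indicator_inv_rho ha hb)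
  have h2 := (hasSum_zonalSeries hc ⟨ha.trans_le hab, hb⟩).sub
    (hasSum_zonalSeries hc ⟨ha, hab.trans_lt hb⟩)
  have h3 := h2.mul_left (2 * Real.pi)
  have e : ∀ F : ℝ → ℝ, ∫ t, (Set.Ioc a b).indicator (fun t ↦ (rho t)⁻¹) t * F t ∂heightMeasure =
      2 * Real.pi * ∫ t in a..b, (rho t)⁻¹ * F t := fun F ↦ by
    rw [← setIntegral_heightMeasure hab ha.le hb.le]
    congr 1; ext t
    rw [Set.indicator_mul_left]
  have e2 : ∀ ℓ, ∫ t in a..b, (rho t)⁻¹ * dLegendre ℓ t = normLegendre ℓ b - normLegendre ℓ a := by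
    intro ℓ
    have : ∫ t in a..b, (rho t)⁻¹ * dLegendre ℓ t =
        ∫ t in a..b, √(N ℓ) * (derivative (legendre ℓ)).eval t := by
      refine intervalIntegral.integral_congr fun t ht ↦ ?_
      rw [Set.uIcc_of_le hab] at ht
      have := (rho_pos ⟨ha.trans_le ht.1, ht.2.trans_lt hb⟩).ne'
      simp only [dLegendre]
      field_simp
    rw [this, intervalIntegral.integral_const_mul, integral_derivative_eval, normLegendre,
      normLegendre, mul_sub]
  simp only [e, e2] at h1
  have h4 := h1.unique (h3.congr_fun ?_)
  · exact (mul_left_cancel₀ (by positivity) h4).symm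
  · intro ℓ; ring

/-- Lebesgue differentiation on an exhaustion of (-1,1), avoiding the poles where ρ vanishes. It
ties the L² object `zonalGrad c` to the classical gradient in q₃. -/
theorem ae_hasDerivAt_zonalSeries (hc : Summable fun ℓ : ℕ ↦ c ℓ ^ 2 * ((ℓ : ℝ) + 1) ^ 2) :
    ∀ᵐ t ∂heightMeasure, HasDerivAt (zonalSeries c) ((rho t)⁻¹ * zonalGrad c t) t := by
  have h1 : ∀ n : ℕ, ∀ᵐ t : ℝ, t ∈ Set.Ioo (-1 + 1 / ((n : ℝ) + 2)) (1 - 1 / ((n : ℝ) + 2)) →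
      HasDerivAt (zonalSeries c) ((rho t)⁻¹ * zonalGrad c t) t := by
    intro n
    set a : ℝ := -1 + 1 / ((n : ℝ) + 2) with ha_def
    set b : ℝ := 1 - 1 / ((n : ℝ) + 2) with hb_def
    have hpos : 0 < 1 / ((n : ℝ) + 2) := by positivity
    have hle : 1 / ((n : ℝ) + 2) ≤ 1 / 2 :=
      one_div_le_one_div_of_le (by norm_num) (by linarith [(Nat.cast_nonneg n : (0 : ℝ) ≤ n)])
    have ha : -1 < a := by linarith
    have hb : b < 1 := by linarith
    have hab : a ≤ b := by linarith
    filter_upwards [(intervalIntegrable_zonalGrad (c := c) hab ha hb).ae_hasDerivAt_integral]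
      with t h ht
    have h2 := h (by rw [Set.uIcc_of_le hab]; exact Set.Ioo_subset_Icc_self ht) a
      (by rw [Set.uIcc_of_le hab]; exact ⟨le_rfl, hab⟩)
    refine (h2.const_add (zonalSeries c a)).congr_of_eventuallyEq ?_
    filter_upwards [Ioo_mem_nhds ht.1 ht.2] with s hs
    rw [← zonalSeries_sub hc hs.1.le ha (hs.2.trans hb)]; ring
  have h2 : ∀ᵐ t ∂heightMeasure, ∀ n : ℕ,
      t ∈ Set.Ioo (-1 + 1 / ((n : ℝ) + 2)) (1 - 1 / ((n : ℝ) + 2)) →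
      HasDerivAt (zonalSeries c) ((rho t)⁻¹ * zonalGrad c t) t :=
    Measure.ae_smul_measure (ae_restrict_of_ae (ae_all_iff.2 h1)) _
  filter_upwards [h2, ae_heightMeasure_mem_Ioo] with t h ht
  obtain ⟨n, hn⟩ := exists_nat_one_div_lt (show 0 < min (t + 1) (1 - t) by
    rw [lt_min_iff]; constructor <;> linarith [ht.1, ht.2])
  have hn2 : 1 / ((n : ℝ) + 2) ≤ 1 / ((n : ℝ) + 1) :=
    one_div_le_one_div_of_le (by positivity) (by linarith)
  rw [lt_min_iff] at hn
  exact h n ⟨by linarith [hn.1], by linarith [hn.2]⟩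

/-- The weighted derivative of the product of the zonal function and a cutoff. -/
def cutGrad (c : ℕ → ℝ) (Ψ Ψ' : ℝ → ℝ) (t : ℝ) : ℝ :=
  Ψ t * zonalGrad c t + rho t * Ψ' t * zonalSeries c t

section Cutoff

variable {Ψ Ψ' : ℝ → ℝ}

theorem memLp_cutGrad (hc : Summable fun ℓ : ℕ ↦ c ℓ ^ 2 * ((ℓ : ℝ) + 1) ^ 2)
    (hΨ : Continuous Ψ) (hΨ' : Continuous Ψ') : MemLp (cutGrad c Ψ Ψ') 2 heightMeasure := by
  have hr := continuous_rho
  refine MemLp.add ?_ ?_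
  · exact MemLp.mul' (Lp.memLp (zonalGrad c)) (hΨ.memLp_heightMeasure ∞)
  · exact MemLp.mul' (memLp_zonalSeries hc) ((hr.mul hΨ').memLp_heightMeasure ∞)

theorem memLp_cut (hc : Summable fun ℓ : ℕ ↦ c ℓ ^ 2 * ((ℓ : ℝ) + 1) ^ 2)
    (hΨ : Continuous Ψ) : MemLp (fun t ↦ Ψ t * zonalSeries c t) 2 heightMeasure :=
  MemLp.mul' (memLp_zonalSeries hc) (hΨ.memLp_heightMeasure ∞)

/-- A weak Green's formula for ΨQ: it holds for each C¹ function Ψ·√N_ℓ P_ℓ, and both sides sum over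
ℓ by L² continuity. This avoids integrating by parts with the singular Q. -/
theorem integral_cutGrad_mul_dLegendre (hc : Summable fun ℓ : ℕ ↦ c ℓ ^ 2 * ((ℓ : ℝ) + 1) ^ 2)
    (hΨ : ∀ t, HasDerivAt Ψ (Ψ' t) t) (hΨ' : Continuous Ψ') (k : ℕ) :
    ∫ t, dLegendre k t * cutGrad c Ψ Ψ' t ∂heightMeasure =
      (k : ℝ) * (k + 1) * legendreCoeff (fun t ↦ Ψ t * zonalSeries c t) k := by
  have hΨc : Continuous Ψ := continuous_iff_continuousAt.2 fun t ↦ (hΨ t).continuousAt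
  have hr := continuous_rho
  have hdk := continuous_dLegendre k
  have hnk := continuous_normLegendre k
  have h1 := hasSum_integral_mul_dLegendre hc ((hdk.mul hΨc).memLp_heightMeasure 2)
  have h2 := hasSum_integral_mul_normLegendre hc ((hdk.mul (hr.mul hΨ')).memLp_heightMeasure 2)
  have h3 := hasSum_integral_mul_normLegendre hc ((hnk.mul hΨc).memLp_heightMeasure 2)
  have e1 : ∫ t, dLegendre k t * cutGrad c Ψ Ψ' t ∂heightMeasure =
      ∫ t, (dLegendre k * Ψ) t * zonalGrad c t ∂heightMeasure +
      ∫ t, (dLegendre k * (rho * Ψ')) t * zonalSeries c t ∂heightMeasure := by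
    rw [← integral_add]
    · refine integral_congr_ae (ae_of_all _ fun t ↦ ?_)
      simp only [cutGrad, Pi.mul_apply]; ring
    · exact ((hdk.mul hΨc).memLp_heightMeasure 2).integrable_mul (Lp.memLp (zonalGrad c))
    · exact ((hdk.mul (hr.mul hΨ')).memLp_heightMeasure 2).integrable_mul (memLp_zonalSeries hc)
  have e2 : legendreCoeff (fun t ↦ Ψ t * zonalSeries c t) k =
      ∫ t, (normLegendre k * Ψ) t * zonalSeries c t ∂heightMeasure := by
    simp only [legendreCoeff, Pi.mul_apply, mul_assoc]
  rw [e1, e2]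
  refine (h1.add h2).unique ((h3.mul_left _).congr_fun ?_)
  intro ℓ
  have hd : ∀ t, HasDerivAt (fun t ↦ Ψ t * normLegendre ℓ t)
      (Ψ' t * normLegendre ℓ t + Ψ t * (√(N ℓ) * (derivative (legendre ℓ)).eval t)) t :=
    fun t ↦ (hΨ t).mul (((legendre ℓ).hasDerivAt t).const_mul _)
  have hnℓ := continuous_normLegendre ℓ
  have hdℓ := continuous_dLegendre ℓ
  have h4 := integral_rho_mul_dLegendre k hd (by fun_prop)
  have h5 : ∫ t, (normLegendre k * Ψ) t * normLegendre ℓ t ∂heightMeasure =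
      ∫ t, Ψ t * normLegendre ℓ t * normLegendre k t ∂heightMeasure := by
    congr 1; ext t; simp only [Pi.mul_apply]; ring
  rw [h5, mul_left_comm ((k : ℝ) * (k + 1)), ← h4, ← mul_add, ← integral_add]
  · congr 2
    ext t
    simp only [Pi.mul_apply, dLegendre]; ring
  · exact Continuous.integrable_heightMeasure (by fun_prop)
  · exact Continuous.integrable_heightMeasure (by fun_prop)

/-- Bessel's inequality for the energy of the truncated zonal function. -/
theorem energy_cut_le (hc : Summable fun ℓ : ℕ ↦ c ℓ ^ 2 * ((ℓ : ℝ) + 1) ^ 2)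
    (hΨ : ∀ t, HasDerivAt Ψ (Ψ' t) t) (hΨ' : Continuous Ψ') :
    Summable (fun k : ℕ ↦ legendreCoeff (fun t ↦ Ψ t * zonalSeries c t) k ^ 2 *
      ((k : ℝ) * (k + 1))) ∧
    ∑' k : ℕ, legendreCoeff (fun t ↦ Ψ t * zonalSeries c t) k ^ 2 * ((k : ℝ) * (k + 1)) ≤
      ∫ t, cutGrad c Ψ Ψ' t ^ 2 ∂heightMeasure := by
  have hΨc : Continuous Ψ := continuous_iff_continuousAt.2 fun t ↦ (hΨ t).continuousAt
  have hm := memLp_cutGrad hc hΨc hΨ'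
  -- By Green's formula the coefficient of `cutGrad` along the unit vector of degree k is √(k(k+1))
  -- times the k-th Legendre coefficient, so Bessel's inequality is the energy bound. Degree 0
  -- contributes nothing.
  have e : ∀ j : ℕ, ‖inner ℝ (dLegendreUnit j) (hm.toLp _)‖ ^ 2 =
      legendreCoeff (fun t ↦ Ψ t * zonalSeries c t) (j + 1) ^ 2 *
        (((j + 1 : ℕ) : ℝ) * ((j + 1 : ℕ) + 1)) := by
    intro j
    rw [dLegendreUnit, inner_smul_left, dLegendreLp, inner_toLp,
      integral_cutGrad_mul_dLegendre hc hΨ hΨ']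
    have h1 : (0 : ℝ) < ((j : ℝ) + 1) * (j + 2) := by positivity
    have h3 := Real.sqrt_ne_zero'.2 h1
    simp only [conj_trivial, Real.norm_eq_abs, sq_abs, mul_pow, inv_pow, Real.sq_sqrt h1.le]
    push_cast
    field_simp
    ring
  have hs := orthonormal_dLegendreUnit.inner_products_summable (x := hm.toLp _)
  have hb := orthonormal_dLegendreUnit.tsum_inner_products_le (x := hm.toLp _)
  simp only [e] at hs hb
  have hs' := (summable_nat_add_iff (f := fun k : ℕ ↦
    legendreCoeff (fun t ↦ Ψ t * zonalSeries c t) k ^ 2 * ((k : ℝ) * (k + 1))) 1).1 hs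
  refine ⟨hs', ?_⟩
  rw [hs'.tsum_eq_zero_add]
  rw [← real_inner_self_eq_norm_sq, inner_toLp] at hb
  simpa [sq] using hb

/-- Bessel's inequality for the mass of the truncated zonal function. -/
theorem sum_sq_legendreCoeff_le {A : ℝ → ℝ} (hA : MemLp A 2 heightMeasure) :
    Summable (fun k : ℕ ↦ legendreCoeff A k ^ 2) ∧
    ∑' k : ℕ, legendreCoeff A k ^ 2 ≤ ∫ t, A t ^ 2 ∂heightMeasure := by
  have hs := orthonormal_legendreLp.inner_products_summable (x := hA.toLp _)
  have hb := orthonormal_legendreLp.tsum_inner_products_le (x := hA.toLp _)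
  simp only [inner_legendreLp, Real.norm_eq_abs, sq_abs] at hs hb
  refine ⟨hs, ?_⟩
  rw [← real_inner_self_eq_norm_sq, inner_toLp] at hb
  simpa [sq] using hb

end Cutoff

end ZonalSeries

end SphericalField

namespace SphericalField
-- Gaussian isometries and the representation of the field
noncomputable section Isonormal

variable {Ω : Type*} [MeasurableSpace Ω] {P : Measure Ω}

/-- A linear isometry into `L²(P)` whose values are centred Gaussian variables. -/
def IsIsonormal {H : Type*} [NormedAddCommGroup H] [NormedSpace ℝ H]
    (W : H →ₗᵢ[ℝ] Lp ℝ 2 P) : Prop :=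
  ∀ u, HasLaw (W u) (gaussianReal 0 (‖u‖₊ ^ 2)) P

/-- Along an almost everywhere convergent subsequence the characteristic functions converge by
dominated convergence, and the variances converge because the norms do. -/
theorem hasLaw_gaussianReal_of_tendsto [IsProbabilityMeasure P] {X : ℕ → Lp ℝ 2 P} {Y : Lp ℝ 2 P}
    (hX : ∀ n, HasLaw (X n) (gaussianReal 0 (‖X n‖₊ ^ 2)) P) (h : Tendsto X atTop (𝓝 Y)) :
    HasLaw Y (gaussianReal 0 (‖Y‖₊ ^ 2)) P := by
  have hm : ∀ Z : Lp ℝ 2 P, AEMeasurable Z P := fun Z ↦ (Lp.aestronglyMeasurable Z).aemeasurable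
  refine ⟨hm Y, ?_⟩
  have hprob : IsProbabilityMeasure (P.map Y) := Measure.isProbabilityMeasure_map (hm Y)
  refine Measure.ext_of_charFun (funext fun t ↦ ?_)
  have key : ∀ Z : Lp ℝ 2 P, charFun (P.map Z) t = ∫ ω, Complex.exp (t * Z ω * Complex.I) ∂P := by
    intro Z
    rw [charFun_apply_real, integral_map (hm Z) (by fun_prop)]
  obtain ⟨ns, hns, hae⟩ := (tendstoInMeasure_of_tendsto_Lp h).exists_seq_tendsto_ae
  have h1 : Tendsto (fun n ↦ charFun (P.map (X (ns n))) t) atTop (𝓝 (charFun (P.map Y) t)) := by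
    simp only [key]
    refine tendsto_integral_of_dominated_convergence (fun _ ↦ (1 : ℝ)) ?_ (integrable_const _) ?_ ?_
    · intro n
      have := (Lp.aestronglyMeasurable (X (ns n)))
      have h2 : Continuous fun x : ℝ ↦ Complex.exp (t * x * Complex.I) := by fun_prop
      exact h2.comp_aestronglyMeasurable this
    · intro n
      refine Eventually.of_forall fun ω ↦ ?_
      rw [← Complex.ofReal_mul, Complex.norm_exp_ofReal_mul_I]
    · filter_upwards [hae] with ω hω
      have h2 : Continuous fun x : ℝ ↦ Complex.exp (t * x * Complex.I) := by fun_prop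
      exact (h2.tendsto _).comp hω
  have h3 : Tendsto (fun n ↦ charFun (P.map (X (ns n))) t) atTop
      (𝓝 (charFun (gaussianReal 0 (‖Y‖₊ ^ 2)) t)) := by
    simp only [(hX _).map_eq, charFun_gaussianReal]
    have h4 : Tendsto (fun n ↦ ‖X (ns n)‖) atTop (𝓝 ‖Y‖) :=
      (h.comp hns.tendsto_atTop).norm
    have h5 : Continuous fun s : ℝ ↦
        Complex.exp (t * ((0 : ℝ) : ℂ) * Complex.I - ((s : ℂ) ^ 2) * t ^ 2 / 2) := by fun_prop
    have := (h5.tendsto _).comp h4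
    simpa [Function.comp_def] using this
  exact tendsto_nhds_unique h1 h3

section General

variable {H : Type*} [NormedAddCommGroup H] [InnerProductSpace ℝ H] {W : H →ₗᵢ[ℝ] Lp ℝ 2 P}

theorem IsIsonormal.integral_eq_zero (hW : IsIsonormal W) (u : H) : ∫ ω, W u ω ∂P = 0 := by
  rw [(hW u).integral_eq, integral_id_gaussianReal]

theorem integral_mul_eq_inner (W : H →ₗᵢ[ℝ] Lp ℝ 2 P) (u v : H) :
    ∫ ω, W u ω * W v ω ∂P = inner ℝ u v := by
  rw [← W.inner_map_map, L2.inner_def]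
  refine integral_congr_ae (Eventually.of_forall fun ω ↦ ?_)
  simp [mul_comm]

theorem IsIsonormal.covariance_eq [IsProbabilityMeasure P] (hW : IsIsonormal W) {X Y : Ω → ℝ}
    {u v : H} (hX : X =ᵐ[P] W u) (hY : Y =ᵐ[P] W v) : covariance X Y P = inner ℝ u v := by
  rw [covariance_eq_sub ((memLp_congr_ae hX).2 (Lp.memLp _)) ((memLp_congr_ae hY).2 (Lp.memLp _)),
    integral_congr_ae hX, hW.integral_eq_zero, zero_mul, sub_zero, ← integral_mul_eq_inner W]
  exact integral_congr_ae (hX.mul hY)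

theorem coeFn_map_sum_smul {ι : Type*} [Fintype ι] (W : H →ₗᵢ[ℝ] Lp ℝ 2 P) (v : ι → H)
    {X : ι → Ω → ℝ} (hX : ∀ i, X i =ᵐ[P] W (v i)) (w : ι → ℝ) :
    (fun ω ↦ ∑ i, w i * X i ω) =ᵐ[P] W (∑ i, w i • v i) := by
  rw [map_sum]
  refine EventuallyEq.trans ?_ (Lp.coeFn_finsetSum _ _).symm
  have h1 : ∀ᵐ ω ∂P, ∀ i, X i ω = W (v i) ω := ae_all_iff.2 hX
  have h2 : ∀ᵐ ω ∂P, ∀ i, (W (w i • v i)) ω = w i * W (v i) ω := by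
    refine ae_all_iff.2 fun i ↦ ?_
    rw [map_smul]
    filter_upwards [Lp.coeFn_smul (w i) (W (v i))] with ω hω
    simp [hω]
  filter_upwards [h1, h2] with ω ha hb
  simp only [map_smul] at hb
  simp [Finset.sum_apply, ha, hb]

theorem strongDual_apply_pi {ι : Type*} [Fintype ι] [DecidableEq ι] (L : StrongDual ℝ (ι → ℝ))
    (x : ι → ℝ) : L x = ∑ i, L (Pi.single i 1) * x i := by
  conv_lhs => rw [← Finset.univ_sum_single x]
  rw [map_sum]
  refine Finset.sum_congr rfl fun i _ ↦ ?_
  have : Pi.single i (x i) = x i • (Pi.single i 1 : ι → ℝ) := by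
    rw [← Pi.single_smul, smul_eq_mul, mul_one]
  rw [this, map_smul, smul_eq_mul, mul_comm]

theorem IsIsonormal.map_strongDual (hW : IsIsonormal W) {ι : Type*} [Fintype ι] [DecidableEq ι]
    {v : ι → H} {X : ι → Ω → ℝ} (hX : ∀ i, X i =ᵐ[P] W (v i)) (L : StrongDual ℝ (ι → ℝ)) :
    (P.map fun ω i ↦ X i ω).map L =
      gaussianReal 0 (‖∑ i, L (Pi.single i 1) • v i‖₊ ^ 2) := by
  have hm : AEMeasurable (fun ω i ↦ X i ω) P :=
    aemeasurable_pi_lambda _ fun i ↦ ((hW (v i)).aemeasurable).congr (hX i).symm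
  rw [AEMeasurable.map_map_of_aemeasurable L.continuous.aemeasurable hm, ← (hW _).map_eq]
  refine Measure.map_congr ?_
  refine EventuallyEq.trans (Eventually.of_forall fun ω ↦ ?_)
    (coeFn_map_sum_smul W v hX fun i ↦ L (Pi.single i 1))
  simp only [Function.comp]
  exact strongDual_apply_pi L _

/-- Every linear combination of values of the process is `W` of the same combination of vectors,
hence a Gaussian variable. -/
theorem IsIsonormal.isGaussianProcess (hW : IsIsonormal W) {T : Type*} {v : T → H}
    {X : T → Ω → ℝ} (hX : ∀ t, X t =ᵐ[P] W (v t)) : IsGaussianProcess X P where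
  hasGaussianLaw I := by
    classical
    exact ⟨isGaussian_of_map_eq_gaussianReal fun L ↦ ⟨0, _, hW.map_strongDual (ι := I) (v := fun i ↦ v i) (X := fun i ↦ X i) (fun i ↦ hX i) L⟩⟩

/-- A centred Gaussian vector is determined by its Gram matrix: each linear functional has a
Gaussian law whose variance depends only on inner products. -/
theorem IsIsonormal.identDistrib [IsProbabilityMeasure P] (hW : IsIsonormal W) {ι : Type*}
    [Fintype ι] {u v : ι → H} {X Z : ι → Ω → ℝ} (hX : ∀ i, X i =ᵐ[P] W (u i))
    (hZ : ∀ i, Z i =ᵐ[P] W (v i)) (h : ∀ i j, inner ℝ (u i) (u j) = (inner ℝ (v i) (v j) : ℝ)) :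
    IdentDistrib (fun ω i ↦ X i ω) (fun ω i ↦ Z i ω) P P := by
  classical
  have hm : AEMeasurable (fun ω i ↦ X i ω) P :=
    aemeasurable_pi_lambda _ fun i ↦ ((hW (u i)).aemeasurable).congr (hX i).symm
  have hm' : AEMeasurable (fun ω i ↦ Z i ω) P :=
    aemeasurable_pi_lambda _ fun i ↦ ((hW (v i)).aemeasurable).congr (hZ i).symm
  refine ⟨hm, hm', ?_⟩
  have := Measure.isProbabilityMeasure_map hm
  have := Measure.isProbabilityMeasure_map hm'
  refine Measure.ext_of_charFunDual (funext fun L ↦ ?_)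
  rw [charFunDual_eq_charFun_map_one, charFunDual_eq_charFun_map_one, hW.map_strongDual hX,
    hW.map_strongDual hZ]
  congr 3
  rw [← NNReal.coe_inj, coe_nnnorm, coe_nnnorm, ← sq_eq_sq₀ (norm_nonneg _) (norm_nonneg _)]
  rw [← real_inner_self_eq_norm_sq, ← real_inner_self_eq_norm_sq]
  simp only [sum_inner, inner_sum, inner_smul_left, inner_smul_right, h]

/-- The `L⁸` norm of a standard Gaussian variable. -/
def gaussianNorm : ℝ≥0∞ := eLpNorm id 8 (gaussianReal 0 1)

theorem gaussianNorm_ne_top : gaussianNorm ≠ ∞ :=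
  (memLp_id_gaussianReal' 8 (by simp)).eLpNorm_ne_top

theorem IsIsonormal.eLpNorm_eight (hW : IsIsonormal W) (u : H) :
    eLpNorm (W u) 8 P = ENNReal.ofReal ‖u‖ * gaussianNorm := by
  have h1 : eLpNorm (W u) 8 P = eLpNorm id 8 (P.map (W u)) := by
    rw [eLpNorm_map_measure (by fun_prop) (hW u).aemeasurable]; rfl
  have h2 : gaussianReal 0 (‖u‖₊ ^ 2) = (gaussianReal 0 1).map (‖u‖ * ·) := by
    rw [gaussianReal_map_const_mul]
    congr 1
    · simp
    · ext; simp
  rw [h1, (hW u).map_eq, h2, eLpNorm_map_measure (by fun_prop) (by fun_prop), gaussianNorm]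
  have : (id ∘ fun x : ℝ ↦ ‖u‖ * x) = ‖u‖ • (id : ℝ → ℝ) := by ext; simp
  rw [this, eLpNorm_const_smul]
  rw [← ofReal_norm (‖u‖), norm_norm]

end General

section Coefficients

variable {a : HarmonicIndex → Ω → ℝ}

theorem IsIIDStandardGaussian.memLp (ha : IsIIDStandardGaussian a P) (i : HarmonicIndex) :
    MemLp (a i) 2 P := by
  have h : MemLp id 2 (P.map (a i)) := (ha.hasLaw i).map_eq ▸ memLp_id_gaussianReal' 2 (by simp)
  exact (memLp_map_measure_iff (by fun_prop) (ha.hasLaw i).aemeasurable).1 h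

theorem IsIIDStandardGaussian.integral_eq_zero (ha : IsIIDStandardGaussian a P)
    (i : HarmonicIndex) : ∫ ω, a i ω ∂P = 0 := by
  rw [(ha.hasLaw i).integral_eq, integral_id_gaussianReal]

theorem IsIIDStandardGaussian.integral_sq (ha : IsIIDStandardGaussian a P) (i : HarmonicIndex) :
    ∫ ω, a i ω * a i ω ∂P = 1 := by
  have := (ha.hasLaw i).isProbabilityMeasure
  have h := (ha.hasLaw i).variance_eq
  rw [variance_id_gaussianReal, variance_eq_sub (ha.memLp i), ha.integral_eq_zero] at h
  simpa [sq] using h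

theorem IsIIDStandardGaussian.integral_mul (ha : IsIIDStandardGaussian a P) {i j : HarmonicIndex}
    (hij : i ≠ j) : ∫ ω, a i ω * a j ω ∂P = 0 := by
  have h := (ha.indep.indepFun hij).integral_mul_eq_mul_integral
    (ha.memLp i).aestronglyMeasurable (ha.memLp j).aestronglyMeasurable
  simpa [ha.integral_eq_zero] using h

/-- The coefficients as elements of `L²(P)`. -/
def coeffLp (ha : IsIIDStandardGaussian a P) (i : HarmonicIndex) : Lp ℝ 2 P := (ha.memLp i).toLp _

theorem orthonormal_coeffLp (ha : IsIIDStandardGaussian a P) : Orthonormal ℝ (coeffLp ha) := by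
  classical
  rw [orthonormal_iff_ite]
  intro i j
  have h : inner ℝ (coeffLp ha i) (coeffLp ha j) = ∫ ω, a i ω * a j ω ∂P := by
    rw [L2.inner_def]
    refine integral_congr_ae ?_
    filter_upwards [(ha.memLp i).coeFn_toLp, (ha.memLp j).coeFn_toLp] with ω h1 h2
    simp only [coeffLp, h1, h2]
    simp [mul_comm]
  rw [h]
  split_ifs with hij
  · rw [hij, ha.integral_sq]
  · exact ha.integral_mul hij

/-- The coefficient space of the spherical harmonics of degree `ℓ`. -/
abbrev Harm (ℓ : ℕ) : Type := EuclideanSpace ℝ (Finset.Icc (-(ℓ : ℤ)) (ℓ : ℤ))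

/-- The Hilbert space of square summable coefficient sequences. -/
abbrev HarmSeq : Type := lp Harm 2

/-- The isometry sending a coefficient vector of degree `ℓ` to the corresponding Gaussian
variable. -/
def blockIsometry (ha : IsIIDStandardGaussian a P) (ℓ : ℕ) : Harm ℓ →ₗᵢ[ℝ] Lp ℝ 2 P :=
  LinearMap.isometryOfOrthonormal
    (v := (EuclideanSpace.basisFun (Finset.Icc (-(ℓ : ℤ)) (ℓ : ℤ)) ℝ).toBasis)
    ((EuclideanSpace.basisFun (Finset.Icc (-(ℓ : ℤ)) (ℓ : ℤ)) ℝ).toBasis.constr ℝ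
      fun m ↦ coeffLp ha ⟨ℓ, m⟩)
    (by
      rw [OrthonormalBasis.coe_toBasis]
      exact (EuclideanSpace.basisFun (Finset.Icc (-(ℓ : ℤ)) (ℓ : ℤ)) ℝ).orthonormal)
    (by
      have h : ((EuclideanSpace.basisFun (Finset.Icc (-(ℓ : ℤ)) (ℓ : ℤ)) ℝ).toBasis.constr ℝ
          fun m ↦ coeffLp ha ⟨ℓ, m⟩) ∘
          (EuclideanSpace.basisFun (Finset.Icc (-(ℓ : ℤ)) (ℓ : ℤ)) ℝ).toBasis =
          fun m ↦ coeffLp ha ⟨ℓ, m⟩ := by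
        funext m
        exact Module.Basis.constr_basis _ _ _ _
      rw [h]
      exact (orthonormal_coeffLp ha).comp _ sigma_mk_injective)

theorem blockIsometry_apply (ha : IsIIDStandardGaussian a P) (ℓ : ℕ) (v : Harm ℓ) :
    blockIsometry ha ℓ v = ∑ m, v m • coeffLp ha ⟨ℓ, m⟩ := by
  rw [blockIsometry, LinearMap.coe_isometryOfOrthonormal, Module.Basis.constr_apply_fintype]
  rfl

theorem orthogonalFamily_blockIsometry (ha : IsIIDStandardGaussian a P) :
    OrthogonalFamily ℝ Harm (blockIsometry ha) := by
  intro ℓ k hne v w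
  simp only [blockIsometry_apply, sum_inner, inner_sum, inner_smul_left, inner_smul_right]
  refine Finset.sum_eq_zero fun m _ ↦ ?_
  rw [Finset.sum_eq_zero, mul_zero]
  intro m' _
  rw [(orthonormal_coeffLp ha).2 (fun h ↦ hne (congrArg Sigma.fst h)), mul_zero]

/-- The isonormal map with `W u = ∑ u_{ℓ,m} a_{ℓ,m}`. -/
def isonormal (ha : IsIIDStandardGaussian a P) : HarmSeq →ₗᵢ[ℝ] Lp ℝ 2 P :=
  (orthogonalFamily_blockIsometry ha).linearIsometry

theorem hasGaussianLaw_sum_smul (ha : IsIIDStandardGaussian a P) (s : Finset HarmonicIndex)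
    (w : HarmonicIndex → ℝ) : HasGaussianLaw (fun ω ↦ ∑ i ∈ s, w i * a i ω) P := by
  have h1 : iIndepFun (fun (i : s) ω ↦ w i * a i ω) P :=
    (ha.indep.precomp (g := ((↑) : s → HarmonicIndex)) Subtype.val_injective).comp
      (fun i x ↦ w i * x) fun i ↦ by fun_prop
  have h2 : ∀ i : s, HasGaussianLaw (fun ω ↦ w i * a i ω) P := fun i ↦
    ((ha.hasLaw i).hasGaussianLaw).fun_smul (w i)
  have h3 := iIndepFun.hasGaussianLaw_fun_sum h2 h1
  refine h3.congr (Eventually.of_forall fun ω ↦ ?_)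
  exact Finset.sum_coe_sort s fun i ↦ w i * a i ω

theorem HasGaussianLaw.hasLaw_of_integral_eq_zero {Z : Lp ℝ 2 P} (h : HasGaussianLaw Z P)
    (h0 : ∫ ω, Z ω ∂P = 0) : HasLaw Z (gaussianReal 0 (‖Z‖₊ ^ 2)) P := by
  have := h.isProbabilityMeasure
  refine ⟨h.aemeasurable, ?_⟩
  rw [h.map_eq_gaussianReal, h0]
  congr 1
  rw [variance_eq_sub (Lp.memLp _), h0, ← NNReal.coe_inj, Real.coe_toNNReal']
  have : ∫ ω, (Z ω) ^ 2 ∂P = ‖Z‖ ^ 2 := by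
    rw [← real_inner_self_eq_norm_sq, L2.inner_def]
    exact integral_congr_ae (Eventually.of_forall fun ω ↦ by simp [sq])
  have h2 : ∫ ω, ((Z : Ω → ℝ) ^ 2) ω ∂P = ‖Z‖ ^ 2 := this
  rw [h2]
  simp

theorem tendsto_sum_blockIsometry (ha : IsIIDStandardGaussian a P) (u : HarmSeq) :
    Tendsto (fun L ↦ ∑ ℓ ∈ Finset.range L, blockIsometry ha ℓ (u ℓ)) atTop
      (𝓝 (isonormal ha u)) :=
  ((orthogonalFamily_blockIsometry ha).hasSum_linearIsometry u).tendsto_sum_nat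

theorem coeFn_sum_blockIsometry (ha : IsIIDStandardGaussian a P) (u : ∀ ℓ, Harm ℓ) (L : ℕ) :
    (∑ ℓ ∈ Finset.range L, blockIsometry ha ℓ (u ℓ) : Lp ℝ 2 P) =ᵐ[P]
      fun ω ↦ ∑ ℓ ∈ Finset.range L, ∑ m, u ℓ m * a ⟨ℓ, m⟩ ω := by
  have h : ∀ᵐ ω ∂P, ∀ i : HarmonicIndex, (u i.1 i.2 • coeffLp ha i : Lp ℝ 2 P) ω
      = u i.1 i.2 * a i ω := by
    refine ae_all_iff.2 fun i ↦ ?_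
    filter_upwards [Lp.coeFn_smul (u i.1 i.2) (coeffLp ha i), (ha.memLp i).coeFn_toLp]
      with ω h1 h2
    rw [h1, Pi.smul_apply, coeffLp, h2, smul_eq_mul]
  have h1 : ∀ᵐ ω ∂P, ∀ ℓ : ℕ, (∑ m, u ℓ m • coeffLp ha ⟨ℓ, m⟩ : Lp ℝ 2 P) ω
      = ∑ m, (u ℓ m • coeffLp ha ⟨ℓ, m⟩ : Lp ℝ 2 P) ω := by
    refine ae_all_iff.2 fun ℓ ↦ ?_
    filter_upwards [Lp.coeFn_finsetSum 
      (Finset.univ : Finset (Finset.Icc (-(ℓ : ℤ)) (ℓ : ℤ))) fun m ↦ u ℓ m • coeffLp ha ⟨ℓ, m⟩] with ω hω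
    rw [hω, Finset.sum_apply]
  filter_upwards [h, h1, Lp.coeFn_finsetSum (Finset.range L) fun ℓ ↦ blockIsometry ha ℓ (u ℓ)]
    with ω h2 h3 h4
  rw [h4, Finset.sum_apply]
  refine Finset.sum_congr rfl fun ℓ _ ↦ ?_
  rw [blockIsometry_apply, h3]
  exact Finset.sum_congr rfl fun m _ ↦ h2 ⟨ℓ, m⟩

/-- Finite combinations are Gaussian by independence and centred, and the general case follows by L²
limits. -/
theorem isIsonormal_isonormal (ha : IsIIDStandardGaussian a P) : IsIsonormal (isonormal ha) := by
  intro u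
  have hP : IsProbabilityMeasure P := (ha.hasLaw ⟨0, ⟨0, by simp⟩⟩).isProbabilityMeasure
  rw [← (isonormal ha).nnnorm_map u]
  refine hasLaw_gaussianReal_of_tendsto (fun L ↦ ?_) (tendsto_sum_blockIsometry ha u)
  have hae := coeFn_sum_blockIsometry ha (fun ℓ ↦ u ℓ) L
  refine HasGaussianLaw.hasLaw_of_integral_eq_zero ?_ ?_
  · have h := hasGaussianLaw_sum_smul ha
      ((Finset.range L).sigma fun ℓ ↦ (Finset.univ : Finset (Finset.Icc (-(ℓ : ℤ)) (ℓ : ℤ))))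
      fun i ↦ u i.1 i.2
    simp only [Finset.sum_sigma] at h
    exact h.congr hae.symm
  · rw [integral_congr_ae hae]
    have hi : ∀ i : HarmonicIndex, Integrable (fun ω ↦ u i.1 i.2 * a i ω) P := fun i ↦
      ((ha.memLp i).integrable (by norm_num)).const_mul _
    rw [integral_finsetSum _ fun ℓ _ ↦ integrable_finsetSum _ fun m _ ↦ hi ⟨ℓ, m⟩]
    refine Finset.sum_eq_zero fun ℓ _ ↦ ?_
    rw [integral_finsetSum _ fun m _ ↦ hi ⟨ℓ, m⟩]
    refine Finset.sum_eq_zero fun m _ ↦ ?_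
    rw [integral_const_mul, ha.integral_eq_zero, mul_zero]

end Coefficients

section ZonalVectors

/-- The vector of spherical harmonics of degree `ℓ` at `x`, of norm one. -/
def harmonicVec (ℓ : ℕ) (x : S2) : Harm ℓ := WithLp.toLp 2 fun m ↦ Y ℓ m x / √(N ℓ)

/-- This is the addition theorem in Hilbert space form; the covariance formulas for the fields rest
on it. -/
theorem inner_harmonicVec (ℓ : ℕ) (x y : S2) :
    inner ℝ (harmonicVec ℓ x) (harmonicVec ℓ y) = (legendre ℓ).eval (inner ℝ (x : E3) (y : E3)) := by
  have h : inner ℝ (harmonicVec ℓ x) (harmonicVec ℓ y) =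
      (∑ m : Finset.Icc (-(ℓ : ℤ)) (ℓ : ℤ), Y ℓ m x * Y ℓ m y) / N ℓ := by
    rw [PiLp.inner_apply, Finset.sum_div]
    refine Finset.sum_congr rfl fun m _ ↦ ?_
    simp only [harmonicVec, RCLike.inner_apply, conj_trivial]
    rw [div_mul_div_comm, Real.mul_self_sqrt (N_pos ℓ).le, mul_comm]
  rw [h, sum_Y_mul_Y, mul_div_cancel_left₀ _ (N_pos ℓ).ne']

theorem norm_harmonicVec (ℓ : ℕ) (x : S2) : ‖harmonicVec ℓ x‖ = 1 := by
  have h := inner_harmonicVec ℓ x x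
  rw [real_inner_self_eq_norm_sq, real_inner_self_eq_norm_sq, norm_eq_of_mem_sphere, one_pow,
    legendre_eval_one] at h
  nlinarith [norm_nonneg (harmonicVec ℓ x)]

variable {b b' : ℕ → ℝ}

theorem memℓp_two_of_summable {v : ∀ ℓ, Harm ℓ} (h : Summable fun ℓ ↦ ‖v ℓ‖ ^ 2) : Memℓp v 2 := by
  rw [memℓp_gen_iff (by norm_num)]
  simpa using h

theorem norm_sq_smul_harmonicVec (b : ℕ → ℝ) (x : S2) (ℓ : ℕ) :
    ‖b ℓ • harmonicVec ℓ x‖ ^ 2 = b ℓ ^ 2 := by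
  rw [norm_smul, norm_harmonicVec, mul_one, Real.norm_eq_abs, sq_abs]

/-- The coefficients of the field `∑ (b_ℓ / √N_ℓ) ∑ a_{ℓ,m} Y_{ℓ,m}` at `x`. -/
def zonalVec (hb : Summable fun ℓ ↦ b ℓ ^ 2) (x : S2) : HarmSeq :=
  ⟨fun ℓ ↦ b ℓ • harmonicVec ℓ x, memℓp_two_of_summable (by simpa only [norm_sq_smul_harmonicVec] using hb)⟩

theorem zonalVec_apply (hb : Summable fun ℓ ↦ b ℓ ^ 2) (x : S2) (ℓ : ℕ) :
    zonalVec hb x ℓ = b ℓ • harmonicVec ℓ x := rfl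

theorem hasSum_inner_zonalVec (hb : Summable fun ℓ ↦ b ℓ ^ 2) (hb' : Summable fun ℓ ↦ b' ℓ ^ 2)
    (x y : S2) : HasSum (fun ℓ ↦ b ℓ * b' ℓ * (legendre ℓ).eval (inner ℝ (x : E3) (y : E3)))
      (inner ℝ (zonalVec hb x) (zonalVec hb' y)) := by
  refine (lp.hasSum_inner (zonalVec hb x) (zonalVec hb' y)).congr_fun fun ℓ ↦ ?_
  rw [zonalVec_apply, zonalVec_apply, inner_smul_left, inner_smul_right, inner_harmonicVec,
    conj_trivial, mul_assoc]

variable {a : HarmonicIndex → Ω → ℝ}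

/-- Both sides are L² limits of the same partial sums over degrees below L. -/
theorem IsFieldSeries.ae_eq (ha : IsIIDStandardGaussian a P) {f : S2 → Ω → ℝ}
    (hb : Summable fun ℓ ↦ b ℓ ^ 2) (hf : IsFieldSeries b a f P) (x : S2) :
    f x =ᵐ[P] isonormal ha (zonalVec hb x) := by
  obtain ⟨hfm, hft⟩ := hf x
  have h1 := tendsto_sum_blockIsometry ha (zonalVec hb x)
  have hae := coeFn_sum_blockIsometry ha (fun ℓ ↦ zonalVec hb x ℓ)
  have h2 : Tendsto (fun L ↦ ∑ ℓ ∈ Finset.range L, blockIsometry ha ℓ (zonalVec hb x ℓ)) atTop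
      (𝓝 (hfm.toLp (f x))) := by
    rw [Lp.tendsto_Lp_iff_tendsto_eLpNorm']
    refine hft.congr fun L ↦ ?_
    rw [← eLpNorm_neg]
    refine eLpNorm_congr_ae ?_
    filter_upwards [hae L, hfm.coeFn_toLp] with ω h3 h4
    rw [Pi.neg_apply, Pi.sub_apply, h3, h4, neg_sub, partialField]
    refine congrArg (· - f x ω) ?_
    refine Finset.sum_congr rfl fun ℓ _ ↦ ?_
    rw [Finset.mul_sum]
    refine Finset.sum_congr rfl fun m _ ↦ ?_
    change _ = b ℓ * (Y ℓ m x / √(N ℓ)) * _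
    ring
  have h5 := tendsto_nhds_unique h1 h2
  rw [h5]
  exact hfm.coeFn_toLp.symm

end ZonalVectors

end Isonormal
end SphericalField

namespace SphericalField
-- Continuous modifications by chaining
noncomputable section ContinuousModification

/-- Indices of the cells of side `2⁻ⁿ` of the cube `[-1, 1]³`. -/
abbrev Cell (n : ℕ) : Type := Fin 3 → Fin (2 ^ (n + 1) + 1)

theorem coord_mem_Icc (x : S2) (i : Fin 3) : (x : E3) i ∈ Set.Icc (-1 : ℝ) 1 := by
  have h := sq_add_sq_add_sq_eq_one x
  rw [Set.mem_Icc, ← abs_le, abs_le_one_iff_mul_self_le_one]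
  fin_cases i <;> simp <;> nlinarith [sq_nonneg ((x : E3) 0), sq_nonneg ((x : E3) 1),
    sq_nonneg ((x : E3) 2)]

theorem floor_coord_lt (n : ℕ) (x : S2) (i : Fin 3) :
    ⌊((x : E3) i + 1) * 2 ^ n⌋₊ < 2 ^ (n + 1) + 1 := by
  have h := coord_mem_Icc x i
  have h2 : (0 : ℝ) < 2 ^ n := by positivity
  rw [Nat.floor_lt (mul_nonneg (by linarith [h.1]) h2.le)]
  push_cast
  rw [pow_succ]
  nlinarith [h.2]

/-- The cell containing `x`. -/
def cellOf (n : ℕ) (x : S2) : Cell n := fun i ↦ ⟨⌊((x : E3) i + 1) * 2 ^ n⌋₊, floor_coord_lt n x i⟩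

theorem dist_lt_of_cellOf_eq {n : ℕ} {x y : S2} (h : cellOf n x = cellOf n y) :
    ‖(x : E3) - y‖ < 2 / 2 ^ n := by
  have h2 : (0 : ℝ) < 2 ^ n := by positivity
  have hc : ∀ i, ((x : E3) i - (y : E3) i) ^ 2 ≤ (1 / 2 ^ n) ^ 2 := by
    intro i
    have h1 : ⌊((x : E3) i + 1) * 2 ^ n⌋₊ = ⌊((y : E3) i + 1) * 2 ^ n⌋₊ := by
      simpa [cellOf] using congrFun h i
    have hx := coord_mem_Icc x i
    have hy := coord_mem_Icc y i
    have hx1 := Nat.floor_le (mul_nonneg (by linarith [hx.1] : 0 ≤ (x : E3) i + 1) h2.le)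
    have hy1 := Nat.floor_le (mul_nonneg (by linarith [hy.1] : 0 ≤ (y : E3) i + 1) h2.le)
    have hx2 := Nat.lt_floor_add_one (((x : E3) i + 1) * 2 ^ n)
    have hy2 := Nat.lt_floor_add_one (((y : E3) i + 1) * 2 ^ n)
    rw [h1] at hx1 hx2
    rw [sq_le_sq, abs_of_pos (by positivity : (0 : ℝ) < 1 / 2 ^ n), abs_le]
    constructor
    · rw [neg_le_iff_add_nonneg, ← sub_nonneg]
      have : -1 / 2 ^ n ≤ (x : E3) i - (y : E3) i := by
        rw [div_le_iff₀ h2]; nlinarith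
      linarith [neg_div ((2 : ℝ) ^ n) 1]
    · rw [le_div_iff₀ h2]; nlinarith
  rw [EuclideanSpace.norm_eq, Real.sqrt_lt' (by positivity), Fin.sum_univ_three]
  simp only [Real.norm_eq_abs, sq_abs, PiLp.sub_apply]
  have h4 : (2 / 2 ^ n : ℝ) ^ 2 = 4 * (1 / 2 ^ n) ^ 2 := by ring
  have h5 : (0 : ℝ) < (1 / 2 ^ n) ^ 2 := by positivity
  linarith [hc 0, hc 1, hc 2]

open Classical in
/-- A point of each cell that meets the sphere. -/
def cellPoint (n : ℕ) (k : Cell n) : S2 :=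
  if h : ∃ x, cellOf n x = k then h.choose else northPole

theorem dist_cellPoint_lt (n : ℕ) (x : S2) :
    ‖(x : E3) - cellPoint n (cellOf n x)‖ < 2 / 2 ^ n := by
  have h : ∃ y, cellOf n y = cellOf n x := ⟨x, rfl⟩
  refine dist_lt_of_cellOf_eq ?_
  rw [cellPoint, dif_pos h]
  exact h.choose_spec.symm

/-- The bump functions at the points of the net. -/
def bump (n : ℕ) (k : Cell n) (x : S2) : ℝ := max 0 (4 / 2 ^ n - ‖(x : E3) - cellPoint n k‖)

theorem bump_nonneg (n : ℕ) (k : Cell n) (x : S2) : 0 ≤ bump n k x := le_max_left _ _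

theorem continuous_bump (n : ℕ) (k : Cell n) : Continuous (bump n k) := by
  unfold bump; fun_prop

theorem sum_bump_pos (n : ℕ) (x : S2) : 0 < ∑ k, bump n k x := by
  refine Finset.sum_pos' (fun k _ ↦ bump_nonneg n k x) ⟨cellOf n x, Finset.mem_univ _, ?_⟩
  refine lt_max_of_lt_right ?_
  have h1 := dist_cellPoint_lt n x
  have h2 : (2 : ℝ) / 2 ^ n ≤ 4 / 2 ^ n := by gcongr; norm_num
  linarith

/-- A continuous partition of unity subordinate to the net. -/
def weight (n : ℕ) (k : Cell n) (x : S2) : ℝ := bump n k x / ∑ j, bump n j x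

theorem continuous_weight (n : ℕ) (k : Cell n) : Continuous (weight n k) :=
  (continuous_bump n k).div (continuous_finsetSum _ fun j _ ↦ continuous_bump n j)
    fun x ↦ (sum_bump_pos n x).ne'

theorem weight_nonneg (n : ℕ) (k : Cell n) (x : S2) : 0 ≤ weight n k x :=
  div_nonneg (bump_nonneg n k x) (sum_bump_pos n x).le

theorem sum_weight (n : ℕ) (x : S2) : ∑ k, weight n k x = 1 := by
  simp only [weight]
  rw [← Finset.sum_div, div_self (sum_bump_pos n x).ne']

theorem dist_lt_of_weight_ne_zero {n : ℕ} {k : Cell n} {x : S2} (h : weight n k x ≠ 0) :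
    ‖(x : E3) - cellPoint n k‖ < 4 / 2 ^ n := by
  by_contra! hle
  refine h ?_
  rw [weight, bump, max_eq_left (by linarith), zero_div]

/-- The interpolation of `X` from the net. -/
def interpolate {E : Type*} [AddCommMonoid E] [Module ℝ E] (X : S2 → E) (n : ℕ) (x : S2) : E :=
  ∑ k, weight n k x • X (cellPoint n k)

theorem norm_interpolate_sub_le {E : Type*} [NormedAddCommGroup E] [NormedSpace ℝ E]
    {X : S2 → E} {n : ℕ} {y : E} {B : ℝ} (x : S2)
    (h : ∀ k, weight n k x ≠ 0 → ‖X (cellPoint n k) - y‖ ≤ B) :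
    ‖interpolate X n x - y‖ ≤ B := by
  have h1 : interpolate X n x - y = ∑ k, weight n k x • (X (cellPoint n k) - y) := by
    simp only [smul_sub, Finset.sum_sub_distrib, ← Finset.sum_smul, sum_weight, one_smul]
    rfl
  rw [h1]
  calc _ ≤ ∑ k, ‖weight n k x • (X (cellPoint n k) - y)‖ := norm_sum_le _ _
    _ ≤ ∑ k, weight n k x * B := by
        refine Finset.sum_le_sum fun k _ ↦ ?_
        rw [norm_smul, Real.norm_of_nonneg (weight_nonneg n k x)]
        by_cases h0 : weight n k x = 0
        · simp [h0]
        · exact mul_le_mul_of_nonneg_left (h k h0) (weight_nonneg n k x)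
    _ = B := by rw [← Finset.sum_mul, sum_weight, one_mul]

open Classical in
/-- The pairs of neighbouring points in two consecutive nets. -/
def closePairs (n : ℕ) : Finset (Cell n × Cell (n + 1)) :=
  {p | ‖(cellPoint n p.1 : E3) - cellPoint (n + 1) p.2‖ < 6 / 2 ^ n}

/-- Only net points near a common x contribute to successive interpolations at x, and 4/2ⁿ + 4/2ⁿ⁺¹
= 6/2ⁿ. -/
theorem mem_closePairs {n : ℕ} {k : Cell n} {j : Cell (n + 1)} {x : S2} (hk : weight n k x ≠ 0)
    (hj : weight (n + 1) j x ≠ 0) : (k, j) ∈ closePairs n := by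
  simp only [closePairs, Finset.mem_filter, Finset.mem_univ, true_and]
  have h1 := dist_lt_of_weight_ne_zero hk
  have h2 := dist_lt_of_weight_ne_zero hj
  have h3 : (4 : ℝ) / 2 ^ (n + 1) = 2 / 2 ^ n := by rw [pow_succ]; field_simp; norm_num
  have h4 : (6 : ℝ) / 2 ^ n = 4 / 2 ^ n + 2 / 2 ^ n := by ring
  calc ‖(cellPoint n k : E3) - cellPoint (n + 1) j‖
      = ‖((x : E3) - cellPoint (n + 1) j) - ((x : E3) - cellPoint n k)‖ := by congr 1; abel
    _ ≤ _ := norm_sub_le _ _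
    _ < _ := by linarith

theorem norm_interpolate_succ_sub_le {X : S2 → ℝ} {n : ℕ} {B : ℝ} (x : S2)
    (h : ∀ p ∈ closePairs n, ‖X (cellPoint (n + 1) p.2) - X (cellPoint n p.1)‖ ≤ B) :
    ‖interpolate X (n + 1) x - interpolate X n x‖ ≤ B := by
  refine norm_interpolate_sub_le x fun j hj ↦ ?_
  rw [norm_sub_rev]
  refine norm_interpolate_sub_le x fun k hk ↦ ?_
  rw [norm_sub_rev]
  exact h (k, j) (mem_closePairs hk hj)

theorem continuous_interpolate {X : S2 → ℝ} (n : ℕ) : Continuous (interpolate X n) := by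
  unfold interpolate
  refine continuous_finsetSum _ fun k _ ↦ ?_
  exact (continuous_weight n k).smul continuous_const

theorem card_closePairs_le (n : ℕ) : ((closePairs n).card : ℝ) ≤ 3375 * (2 ^ n) ^ 6 := by
  have h : (closePairs n).card ≤ (2 ^ (n + 1) + 1) ^ 3 * (2 ^ (n + 2) + 1) ^ 3 := by
    refine (Finset.card_le_univ _).trans (le_of_eq ?_)
    simp [Fintype.card_prod]
  have h1 : (1 : ℝ) ≤ 2 ^ n := one_le_pow₀ (by norm_num)
  have h2 : ((closePairs n).card : ℝ) ≤ (2 ^ (n + 1) + 1) ^ 3 * (2 ^ (n + 2) + 1) ^ 3 := by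
    exact_mod_cast h
  refine h2.trans ?_
  have h3 : (2 : ℝ) ^ (n + 1) + 1 ≤ 3 * 2 ^ n := by rw [pow_succ]; linarith
  have h4 : (2 : ℝ) ^ (n + 2) + 1 ≤ 5 * 2 ^ n := by rw [pow_add]; linarith
  calc _ ≤ (3 * (2 : ℝ) ^ n) ^ 3 * (5 * 2 ^ n) ^ 3 := by gcongr
    _ = _ := by ring

/-- The paths along which the interpolations converge geometrically. -/
def IsChainable (X : S2 → ℝ) : Prop :=
  ∃ B : ℝ, 0 ≤ B ∧ ∀ n, ∀ p ∈ closePairs n,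
    ‖X (cellPoint (n + 1) p.2) - X (cellPoint n p.1)‖ ^ 8 ≤ B * (1 / 2) ^ n

theorem IsChainable.exists_bound {X : S2 → ℝ} (h : IsChainable X) :
    ∃ u : ℕ → ℝ, Summable u ∧ ∀ n x, ‖interpolate X (n + 1) x - interpolate X n x‖ ≤ u n := by
  obtain ⟨B, hB, h⟩ := h
  refine ⟨fun n ↦ B ^ (1 / 8 : ℝ) * ((1 / 2 : ℝ) ^ (1 / 8 : ℝ)) ^ n,
    (summable_geometric_of_lt_one (by positivity)
      (Real.rpow_lt_one (by norm_num) (by norm_num) (by norm_num))).mul_left _,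
    fun n x ↦ norm_interpolate_succ_sub_le x fun p hp ↦ ?_⟩
  have h8 : ∀ t : ℝ, 0 ≤ t → (t ^ (1 / 8 : ℝ)) ^ 8 = t := fun t ht ↦ by
    rw [← Real.rpow_natCast, ← Real.rpow_mul ht]; norm_num
  rw [← pow_le_pow_iff_left₀ (norm_nonneg _) (by positivity) (by norm_num : 8 ≠ 0), mul_pow,
    h8 B hB, ← pow_mul, mul_comm n, pow_mul, h8 _ (by norm_num)]
  exact h n p hp

open Classical in
/-- The limit of the interpolations along chainable paths. -/
def chainLimit (X : S2 → ℝ) (x : S2) : ℝ :=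
  if IsChainable X then
    interpolate X 0 x + ∑' n, (interpolate X (n + 1) x - interpolate X n x) else 0

theorem continuous_chainLimit (X : S2 → ℝ) : Continuous (chainLimit X) := by
  unfold chainLimit
  split_ifs with h
  · obtain ⟨u, hu, hb⟩ := h.exists_bound
    exact (continuous_interpolate 0).add (continuous_tsum
      (fun n ↦ (continuous_interpolate (n + 1)).sub (continuous_interpolate n)) hu hb)
  · exact continuous_const

theorem IsChainable.tendsto_interpolate {X : S2 → ℝ} (h : IsChainable X) (x : S2) :
    Tendsto (fun n ↦ interpolate X n x) atTop (𝓝 (chainLimit X x)) := by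
  obtain ⟨u, hu, hb⟩ := h.exists_bound
  have h1 := (Summable.of_norm_bounded hu fun n ↦ hb n x).hasSum.tendsto_sum_nat
  simp only [Finset.sum_range_sub (fun n ↦ interpolate X n x)] at h1
  have h2 := h1.const_add (interpolate X 0 x)
  rw [chainLimit, if_pos h]
  simpa using h2

variable {Ω : Type*} [MeasurableSpace Ω] {P : Measure Ω}
  {H : Type*} [NormedAddCommGroup H] [InnerProductSpace ℝ H] {W : H →ₗᵢ[ℝ] Lp ℝ 2 P}

theorem IsIsonormal.lintegral_pow_eight (hW : IsIsonormal W) (u v : H) :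
    ∫⁻ ω, ‖W u ω - W v ω‖ₑ ^ 8 ∂P = ENNReal.ofReal ((‖u - v‖ * gaussianNorm.toReal) ^ 8) := by
  have h1 : eLpNorm (W (u - v)) 8 P ^ 8 = ∫⁻ ω, ‖W u ω - W v ω‖ₑ ^ 8 ∂P := by
    have := eLpNorm_nnreal_pow_eq_lintegral (μ := P) (f := W (u - v)) (p := 8) (by norm_num)
    simp only [NNReal.coe_ofNat, ENNReal.rpow_ofNat, ENNReal.coe_ofNat] at this
    rw [this]
    refine lintegral_congr_ae ?_
    rw [map_sub]
    filter_upwards [Lp.coeFn_sub (W u) (W v)] with ω hω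
    rw [hω, Pi.sub_apply]
  rw [← h1, hW.eLpNorm_eight, ENNReal.ofReal_pow (by positivity),
    ENNReal.ofReal_mul (norm_nonneg _), ENNReal.ofReal_toReal gaussianNorm_ne_top]

/-- The nets come from cells of the ambient cube, so the number of pairs is of order 2⁶ⁿ, while the
eighth moment of an increment is of order 2⁻⁸ⁿ. This leaves 2⁻²ⁿ, and after the extra weight 2ⁿ the
expectations are still summable. The eighth moment compensates for this crude count. -/
theorem IsIsonormal.ae_isChainable (hW : IsIsonormal W) {v : S2 → H} {D : ℝ} (hD : 0 ≤ D)
    (hv : ∀ x y : S2, ‖v x - v y‖ ≤ D * ‖(x : E3) - y‖) :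
    ∀ᵐ ω ∂P, IsChainable fun x ↦ W (v x) ω := by
  set F : ℕ → Ω → ℝ≥0∞ := fun n ω ↦ ∑ p ∈ closePairs n,
    2 ^ n * ‖W (v (cellPoint (n + 1) p.2)) ω - W (v (cellPoint n p.1)) ω‖ₑ ^ 8 with hF
  set K : ℝ := 3375 * (6 * D * gaussianNorm.toReal) ^ 8
  have hK : 0 ≤ K := by positivity
  have hm : ∀ (n : ℕ) (p : Cell n × Cell (n + 1)), AEMeasurable (fun ω ↦ 2 ^ n *
      ‖W (v (cellPoint (n + 1) p.2)) ω - W (v (cellPoint n p.1)) ω‖ₑ ^ 8) P := by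
    intro n p
    have h1 := (Lp.aestronglyMeasurable (W (v (cellPoint (n + 1) p.2)))).aemeasurable
    have h2 := (Lp.aestronglyMeasurable (W (v (cellPoint n p.1)))).aemeasurable
    fun_prop
  have hFm : ∀ n, AEMeasurable (F n) P := fun n ↦ Finset.aemeasurable_fun_sum _ fun p _ ↦ hm n p
  have hint : ∀ n, ∫⁻ ω, F n ω ∂P ≤ ENNReal.ofReal (K * (1 / 2) ^ n) := by
    intro n
    have hn : (0 : ℝ) < 2 ^ n := by positivity
    rw [lintegral_finsetSum' _ fun p _ ↦ hm n p]
    have hp : ∀ p ∈ closePairs n, ∫⁻ ω, 2 ^ n *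
        ‖W (v (cellPoint (n + 1) p.2)) ω - W (v (cellPoint n p.1)) ω‖ₑ ^ 8 ∂P ≤
        ENNReal.ofReal (2 ^ n * (D * (6 / 2 ^ n) * gaussianNorm.toReal) ^ 8) := by
      intro p hp
      rw [lintegral_const_mul' _ _ (by simp), hW.lintegral_pow_eight,
        ENNReal.ofReal_mul hn.le, ENNReal.ofReal_pow (p := (2 : ℝ)) (by norm_num),
        ENNReal.ofReal_ofNat]
      gcongr
      refine (hv _ _).trans ?_
      rw [norm_sub_rev]
      gcongr
      simp only [closePairs, Finset.mem_filter] at hp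
      exact hp.2.le
    refine (Finset.sum_le_sum hp).trans ?_
    rw [Finset.sum_const, nsmul_eq_mul, ← ENNReal.ofReal_natCast,
      ← ENNReal.ofReal_mul (Nat.cast_nonneg _)]
    refine ENNReal.ofReal_le_ofReal ?_
    calc _ ≤ 3375 * (2 ^ n) ^ 6 * (2 ^ n * (D * (6 / 2 ^ n) * gaussianNorm.toReal) ^ 8) := by
          gcongr
          exact card_closePairs_le n
      _ = K * (1 / 2) ^ n := by
          simp only [K, one_div, inv_pow]
          field_simp
  have hsum : ∫⁻ ω, ∑' n, F n ω ∂P ≠ ∞ := by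
    rw [lintegral_tsum hFm]
    have hs : Summable fun n : ℕ ↦ K * (1 / 2 : ℝ) ^ n :=
      (summable_geometric_of_lt_one (by norm_num) (by norm_num)).mul_left _
    refine ne_top_of_le_ne_top ?_ (ENNReal.tsum_le_tsum hint)
    exact hs.tsum_ofReal_ne_top
  filter_upwards [ae_lt_top' (AEMeasurable.tsum hFm) hsum] with ω hω
  refine ⟨(∑' n, F n ω).toReal, ENNReal.toReal_nonneg, fun n p hp ↦ ?_⟩
  have h1 : 2 ^ n * ‖W (v (cellPoint (n + 1) p.2)) ω - W (v (cellPoint n p.1)) ω‖ₑ ^ 8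
      ≤ ∑' n, F n ω :=
    (Finset.single_le_sum (f := fun p : Cell n × Cell (n + 1) ↦ (2 : ℝ≥0∞) ^ n *
      ‖W (v (cellPoint (n + 1) p.2)) ω - W (v (cellPoint n p.1)) ω‖ₑ ^ 8)
      (fun _ _ ↦ zero_le) hp).trans (ENNReal.le_tsum n)
  have h2 := ENNReal.toReal_mono hω.ne h1
  rw [ENNReal.toReal_mul, ENNReal.toReal_pow, ENNReal.toReal_pow, toReal_enorm,
    ENNReal.toReal_ofNat] at h2
  rw [one_div, inv_pow, ← div_eq_mul_inv, le_div_iff₀ (by positivity), mul_comm]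
  exact h2

/-- A Gaussian field with Lipschitz mean-square increments has a continuous modification. -/
theorem IsIsonormal.exists_continuous_modification [IsProbabilityMeasure P] (hW : IsIsonormal W)
    {v : S2 → H} {D : ℝ} (hD : 0 ≤ D) (hv : ∀ x y : S2, ‖v x - v y‖ ≤ D * ‖(x : E3) - y‖) :
    ∃ g : S2 → Ω → ℝ, (∀ ω, Continuous fun x ↦ g x ω) ∧ ∀ x, g x =ᵐ[P] W (v x) := by
  refine ⟨fun x ω ↦ chainLimit (fun y ↦ W (v y) ω) x, fun ω ↦ continuous_chainLimit _,
    fun x ↦ ?_⟩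
  -- Interpolation commutes with `W` almost surely. In `H` the interpolations tend to v(x), so their
  -- images tend to W(v x) along a subsequence almost everywhere; pathwise they tend to the chain
  -- limit.
  have h1 : Tendsto (fun n ↦ interpolate v n x) atTop (𝓝 (v x)) := by
    rw [tendsto_iff_norm_sub_tendsto_zero]
    have h2 : Tendsto (fun n : ℕ ↦ D * 4 * (1 / 2 : ℝ) ^ n) atTop (𝓝 0) := by
      simpa using (tendsto_pow_atTop_nhds_zero_of_lt_one (r := (1 / 2 : ℝ)) (by norm_num)
        (by norm_num)).const_mul (D * 4)
    refine squeeze_zero (fun _ ↦ norm_nonneg _) (fun n ↦ ?_) h2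
    refine norm_interpolate_sub_le x fun k hk ↦ (hv _ _).trans ?_
    rw [norm_sub_rev, mul_assoc]
    refine mul_le_mul_of_nonneg_left ((dist_lt_of_weight_ne_zero hk).le.trans (le_of_eq ?_)) hD
    rw [one_div, inv_pow, div_eq_mul_inv]
  have h3 : Tendsto (fun n ↦ W (interpolate v n x)) atTop (𝓝 (W (v x))) :=
    (W.continuous.tendsto _).comp h1
  obtain ⟨ns, hns, hae⟩ := (tendstoInMeasure_of_tendsto_Lp h3).exists_seq_tendsto_ae
  have h4 : ∀ᵐ ω ∂P, ∀ n, interpolate (fun y ↦ W (v y) ω) n x = W (interpolate v n x) ω :=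
    ae_all_iff.2 fun n ↦ coeFn_map_sum_smul W (fun k ↦ v (cellPoint n k))
      (X := fun k ω ↦ W (v (cellPoint n k)) ω) (fun _ ↦ EventuallyEq.rfl) fun k ↦ weight n k x
  filter_upwards [hae, h4, hW.ae_isChainable hD hv] with ω h5 h6 h7
  have h8 := (h7.tendsto_interpolate x).comp hns.tendsto_atTop
  simp only [Function.comp_def, h6] at h8
  exact tendsto_nhds_unique h8 h5

/-- The squared distance is ∑ b_ℓ² · 2(1 - P_ℓ(x·y)), and 1 - P_ℓ(t) ≤ ℓ(ℓ+1)(1-t)/2 with 2(1 - x·y)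
= ‖x-y‖². -/
theorem norm_zonalVec_sub_le {b : ℕ → ℝ} (hb : Summable fun ℓ ↦ b ℓ ^ 2)
    (hb' : Summable fun ℓ : ℕ ↦ b ℓ ^ 2 * (ℓ * (ℓ + 1) : ℝ)) (x y : S2) :
    ‖zonalVec hb x - zonalVec hb y‖ ≤
      √(∑' ℓ : ℕ, b ℓ ^ 2 * (ℓ * (ℓ + 1) : ℝ)) * ‖(x : E3) - y‖ := by
  have hK : 0 ≤ ∑' ℓ : ℕ, b ℓ ^ 2 * (ℓ * (ℓ + 1) : ℝ) := tsum_nonneg fun ℓ ↦ by positivity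
  have hin : ∀ x y : S2, HasSum (fun ℓ ↦ b ℓ ^ 2 * (legendre ℓ).eval (inner ℝ (x : E3) (y : E3)))
      (inner ℝ (zonalVec hb x) (zonalVec hb y)) := fun x y ↦ by
    simpa only [sq] using hasSum_inner_zonalVec hb hb x y
  have hself : ∀ x : S2, inner ℝ (x : E3) (x : E3) = (1 : ℝ) := fun x ↦ by
    rw [real_inner_self_eq_norm_sq, norm_eq_of_mem_sphere, one_pow]
  have hxy : ‖(x : E3) - y‖ ^ 2 = 2 * (1 - inner ℝ (x : E3) (y : E3)) := by
    rw [norm_sub_sq_real, norm_eq_of_mem_sphere, norm_eq_of_mem_sphere]; ring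
  have h1 : HasSum (fun ℓ ↦ b ℓ ^ 2 * (2 * (1 - (legendre ℓ).eval (inner ℝ (x : E3) (y : E3)))))
      (‖zonalVec hb x - zonalVec hb y‖ ^ 2) := by
    rw [norm_sub_sq_real, ← real_inner_self_eq_norm_sq, ← real_inner_self_eq_norm_sq]
    refine (((hin x x).sub ((hin x y).mul_left 2)).add (hin y y)).congr_fun fun ℓ ↦ ?_
    rw [hself, hself, legendre_eval_one]
    ring
  have h2 : ‖zonalVec hb x - zonalVec hb y‖ ^ 2 ≤
      (∑' ℓ : ℕ, b ℓ ^ 2 * (ℓ * (ℓ + 1) : ℝ)) * ‖(x : E3) - y‖ ^ 2 := by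
    have h3 := (hb'.hasSum.mul_right (‖(x : E3) - y‖ ^ 2))
    refine hasSum_le (fun ℓ ↦ ?_) h1 h3
    rw [mul_assoc]
    refine mul_le_mul_of_nonneg_left ?_ (sq_nonneg _)
    have h4 := one_sub_legendre_le ℓ (inner_mem_Icc x y)
    have h5 : (0 : ℝ) ≤ ℓ * (ℓ + 1) := by positivity
    have h6 := (inner_mem_Icc x y).2
    rw [hxy]
    nlinarith
  rw [← Real.sqrt_sq (norm_nonneg (zonalVec hb x - zonalVec hb y)),
    ← Real.sqrt_sq (norm_nonneg ((x : E3) - y)), ← Real.sqrt_mul hK]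
  exact Real.sqrt_le_sqrt h2

end ContinuousModification
end SphericalField

namespace SphericalField
-- The mean-square spherical gradient
noncomputable section MeanSquareGradient

/-- The polynomial on `ℝ³` that defines the spherical harmonic `Y ℓ m`. -/
def ambientY (ℓ : ℕ) (m : ℤ) (v : E3) : ℝ :=
  let k : ℕ := m.natAbs
  let A : ℝ := √(N ℓ * ((ℓ - k).factorial / (ℓ + k).factorial))
  let p : ℝ := (Polynomial.derivative^[k] (legendre ℓ)).eval (v 2)
  let w : ℂ := ((v 0 : ℂ) + (v 1 : ℂ) * Complex.I) ^ k
  if m = 0 then A * p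
  else if 0 < m then √2 * A * w.re * p
  else √2 * A * w.im * p

theorem ambientY_coe (ℓ : ℕ) (m : ℤ) (x : S2) : ambientY ℓ m x = Y ℓ m x := rfl

theorem differentiable_ambientY (ℓ : ℕ) (m : ℤ) : Differentiable ℝ (ambientY ℓ m) := by
  have hc : ∀ i : Fin 3, Differentiable ℝ fun v : E3 ↦ v i := fun i ↦
    (EuclideanSpace.proj i : E3 →L[ℝ] ℝ).differentiable
  have hp : Differentiable ℝ fun v : E3 ↦
      (Polynomial.derivative^[m.natAbs] (legendre ℓ)).eval (v 2) :=
    (Polynomial.derivative^[m.natAbs] (legendre ℓ)).differentiable.comp (hc 2)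
  have hw : Differentiable ℝ fun v : E3 ↦
      ((v 0 : ℂ) + (v 1 : ℂ) * Complex.I) ^ m.natAbs :=
    ((Complex.ofRealCLM.differentiable.comp (hc 0)).add
      ((Complex.ofRealCLM.differentiable.comp (hc 1)).mul_const _)).pow _
  have hre := Complex.reCLM.differentiable.comp hw
  have him := Complex.imCLM.differentiable.comp hw
  unfold ambientY
  simp only
  split_ifs
  · exact hp.const_mul _
  · exact (hre.const_mul _).mul hp
  · exact (him.const_mul _).mul hp

/-- The vector of spherical harmonics, extended to `ℝ³ ∖ {0}` to be constant along rays. -/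
def radialVec (ℓ : ℕ) (v : E3) : Harm ℓ :=
  WithLp.toLp 2 fun m ↦ ambientY ℓ m (‖v‖⁻¹ • v) / √(N ℓ)

theorem radialVec_coe (ℓ : ℕ) (x : S2) : radialVec ℓ x = harmonicVec ℓ x := by
  ext m
  simp [radialVec, harmonicVec, norm_eq_of_mem_sphere, ambientY_coe]

theorem radialVec_eq (ℓ : ℕ) {v : E3} (hv : v ≠ 0) :
    radialVec ℓ v = harmonicVec ℓ ⟨‖v‖⁻¹ • v, by simp [norm_smul, hv]⟩ := by
  ext m
  simp [radialVec, harmonicVec, ← ambientY_coe]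

theorem radialVec_smul (ℓ : ℕ) {s : ℝ} (hs : 0 < s) (v : E3) :
    radialVec ℓ (s • v) = radialVec ℓ v := by
  simp only [radialVec, norm_smul, Real.norm_of_nonneg hs.le, mul_inv, smul_smul]
  congr! 5
  field_simp

theorem differentiableAt_radialVec (ℓ : ℕ) {v : E3} (hv : v ≠ 0) :
    DifferentiableAt ℝ (radialVec ℓ) v := by
  rw [differentiableAt_euclidean]
  intro m
  have h1 : DifferentiableAt ℝ (fun v : E3 ↦ ‖v‖⁻¹ • v) v :=
    ((differentiableAt_id.norm ℝ hv).inv (norm_ne_zero_iff.2 hv)).smul differentiableAt_id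
  have h2 : DifferentiableAt ℝ (fun v : E3 ↦ ambientY ℓ m (‖v‖⁻¹ • v)) v :=
    ((differentiable_ambientY ℓ m) _).comp v h1
  have h3 := h2.mul_const (√(N ℓ))⁻¹
  simp only [← div_eq_mul_inv] at h3
  exact h3

theorem norm_harmonicVec_sub_le (ℓ : ℕ) (x y : S2) :
    ‖harmonicVec ℓ x - harmonicVec ℓ y‖ ≤ √(ℓ * (ℓ + 1)) * ‖(x : E3) - y‖ := by
  have hxy : ‖(x : E3) - y‖ ^ 2 = 2 * (1 - inner ℝ (x : E3) (y : E3)) := by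
    rw [norm_sub_sq_real, norm_eq_of_mem_sphere, norm_eq_of_mem_sphere]; ring
  have h4 := one_sub_legendre_le ℓ (inner_mem_Icc x y)
  have h5 : (0 : ℝ) ≤ ℓ * (ℓ + 1) := by positivity
  have h6 := (inner_mem_Icc x y).2
  rw [← Real.sqrt_sq (norm_nonneg (harmonicVec ℓ x - _)),
    ← Real.sqrt_sq (norm_nonneg ((x : E3) - y)), ← Real.sqrt_mul h5]
  refine Real.sqrt_le_sqrt ?_
  rw [norm_sub_sq_real, norm_harmonicVec, norm_harmonicVec, inner_harmonicVec, hxy]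
  nlinarith

theorem norm_normalize_sub_le (x : S2) {v : E3} (hv : v ≠ 0) :
    ‖‖v‖⁻¹ • v - (x : E3)‖ ≤ 2 * ‖v - x‖ := by
  have h1 : ‖‖v‖⁻¹ • v - v‖ = |1 - ‖v‖| := by
    have : ‖v‖⁻¹ • v - v = (‖v‖⁻¹ - 1) • v := by rw [sub_smul, one_smul]
    have h0 : 0 < ‖v‖ := norm_pos_iff.2 hv
    rw [this, norm_smul, Real.norm_eq_abs, ← abs_of_pos h0, ← abs_mul, abs_of_pos h0, sub_mul,
      inv_mul_cancel₀ h0.ne', one_mul]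
  have h2 : |1 - ‖v‖| ≤ ‖v - x‖ := by
    have := abs_norm_sub_norm_le (x : E3) v
    rwa [norm_eq_of_mem_sphere, norm_sub_rev] at this
  calc _ ≤ ‖‖v‖⁻¹ • v - v‖ + ‖v - x‖ := norm_sub_le_norm_sub_add_norm_sub _ _ _
    _ ≤ _ := by rw [h1]; linarith

theorem coe_ne_zero (x : S2) : (x : E3) ≠ 0 := by
  rw [← norm_ne_zero_iff, norm_eq_of_mem_sphere]; norm_num

/-- The derivative of the vector of spherical harmonics of degree `ℓ`. -/
def harmonicDeriv (ℓ : ℕ) (x : S2) : E3 →L[ℝ] Harm ℓ := fderiv ℝ (radialVec ℓ) x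

theorem hasFDerivAt_radialVec (ℓ : ℕ) (x : S2) :
    HasFDerivAt (radialVec ℓ) (harmonicDeriv ℓ x) x :=
  (differentiableAt_radialVec ℓ (coe_ne_zero x)).hasFDerivAt

/-- The radial extension is constant along rays, so its derivative kills the radial direction. This
makes the random gradient tangent. -/
theorem harmonicDeriv_self (ℓ : ℕ) (x : S2) : harmonicDeriv ℓ x x = 0 := by
  have h1 : HasDerivAt (fun s : ℝ ↦ s • (x : E3)) (x : E3) 1 := by
    simpa using (hasDerivAt_id (1 : ℝ)).smul_const (x : E3)
  have h2 : HasDerivAt (fun s : ℝ ↦ radialVec ℓ (s • (x : E3))) (harmonicDeriv ℓ x x) 1 := by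
    have h3 := hasFDerivAt_radialVec ℓ x
    rw [← one_smul ℝ (x : E3)] at h3
    have h4 := h3.comp_hasDerivAt (1 : ℝ) h1
    exact h4
  have h3 : (fun s : ℝ ↦ radialVec ℓ (s • (x : E3))) =ᶠ[𝓝 1] fun _ ↦ radialVec ℓ x := by
    filter_upwards [lt_mem_nhds (zero_lt_one : (0 : ℝ) < 1)] with s hs
    exact radialVec_smul ℓ hs _
  exact h2.unique ((hasDerivAt_const (1 : ℝ) (radialVec ℓ x)).congr_of_eventuallyEq h3)

/-- The Lipschitz bound on the sphere, with a factor 2 from the normalisation v ↦ v/‖v‖ near the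
sphere. -/
theorem norm_harmonicDeriv_le (ℓ : ℕ) (x : S2) : ‖harmonicDeriv ℓ x‖ ≤ 2 * √(ℓ * (ℓ + 1)) := by
  refine (hasFDerivAt_radialVec ℓ x).le_of_lip' (by positivity) ?_
  filter_upwards [isOpen_ne.mem_nhds (coe_ne_zero x)] with v hv
  rw [radialVec_coe, radialVec_eq ℓ hv]
  refine (norm_harmonicVec_sub_le ℓ _ x).trans ?_
  have := norm_normalize_sub_le x hv
  calc _ ≤ √(ℓ * (ℓ + 1)) * (2 * ‖v - x‖) := by gcongr
    _ = _ := by ring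

theorem tendsto_harmonicVec (ℓ : ℕ) (x : S2) :
    Tendsto (fun y : S2 ↦ ‖harmonicVec ℓ y - harmonicVec ℓ x - harmonicDeriv ℓ x ((y : E3) - x)‖ /
      ‖(y : E3) - x‖) (𝓝[≠] x) (𝓝 0) := by
  have h1 := hasFDerivAt_iff_tendsto.1 (hasFDerivAt_radialVec ℓ x)
  have h2 : Tendsto (fun y : S2 ↦ (y : E3)) (𝓝[≠] x) (𝓝 (x : E3)) :=
    (continuous_subtype_val.tendsto x).mono_left nhdsWithin_le_nhds
  refine (h1.comp h2).congr fun y ↦ ?_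
  simp only [Function.comp, radialVec_coe]
  rw [div_eq_inv_mul]

variable {d : ℕ → ℝ}

theorem norm_sq_smul_harmonicDeriv_le (d : ℕ → ℝ) (x : S2) (e : E3) (ℓ : ℕ) :
    ‖d ℓ • harmonicDeriv ℓ x e‖ ^ 2 ≤ 4 * ‖e‖ ^ 2 * (d ℓ ^ 2 * (ℓ * (ℓ + 1))) := by
  have h : ‖harmonicDeriv ℓ x e‖ ^ 2 ≤ (2 * √(ℓ * (ℓ + 1)) * ‖e‖) ^ 2 := by
    gcongr
    exact (harmonicDeriv ℓ x).le_of_opNorm_le (norm_harmonicDeriv_le ℓ x) e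
  rw [norm_smul, mul_pow, Real.norm_eq_abs, sq_abs]
  rw [mul_pow, mul_pow, Real.sq_sqrt (by positivity)] at h
  nlinarith [mul_le_mul_of_nonneg_left h (sq_nonneg (d ℓ))]

/-- The derivative of `zonalVec` in the direction `e`. -/
def zonalDeriv (hd : Summable fun ℓ : ℕ ↦ d ℓ ^ 2 * (ℓ * (ℓ + 1) : ℝ)) (x : S2) (e : E3) :
    HarmSeq :=
  ⟨fun ℓ ↦ d ℓ • harmonicDeriv ℓ x e, memℓp_two_of_summable (Summable.of_nonneg_of_le
    (fun _ ↦ sq_nonneg _) (norm_sq_smul_harmonicDeriv_le d x e) (hd.mul_left _))⟩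

theorem hasSum_norm_sq (u : HarmSeq) : HasSum (fun ℓ ↦ ‖u ℓ‖ ^ 2) (‖u‖ ^ 2) := by
  rw [← real_inner_self_eq_norm_sq]
  refine (lp.hasSum_inner u u).congr_fun fun ℓ ↦ ?_
  rw [real_inner_self_eq_norm_sq]

theorem norm_sq_zonalDeriv_le (hd : Summable fun ℓ : ℕ ↦ d ℓ ^ 2 * (ℓ * (ℓ + 1) : ℝ)) (x : S2)
    (e : E3) : ‖zonalDeriv hd x e‖ ^ 2 ≤ 4 * ‖e‖ ^ 2 * ∑' ℓ : ℕ, d ℓ ^ 2 * (ℓ * (ℓ + 1) : ℝ) := by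
  have h1 : HasSum (fun ℓ ↦ ‖d ℓ • harmonicDeriv ℓ x e‖ ^ 2) (‖zonalDeriv hd x e‖ ^ 2) :=
    hasSum_norm_sq (zonalDeriv hd x e)
  have h2 := hd.hasSum.mul_left (4 * ‖e‖ ^ 2)
  exact hasSum_le (norm_sq_smul_harmonicDeriv_le d x e) h1 h2

theorem sum_smul_zonalDeriv (hd : Summable fun ℓ : ℕ ↦ d ℓ ^ 2 * (ℓ * (ℓ + 1) : ℝ)) (x : S2)
    (e : E3) : ∑ i, e i • zonalDeriv hd x (EuclideanSpace.single i 1) = zonalDeriv hd x e := by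
  have he : e = ∑ i, e i • EuclideanSpace.single i (1 : ℝ) := by
    ext j
    simp [Finset.sum_apply, Pi.single_apply]
  refine lp.ext (funext fun ℓ ↦ ?_)
  rw [lp.coeFn_sum, Finset.sum_apply]
  change ∑ i, e i • (d ℓ • harmonicDeriv ℓ x (EuclideanSpace.single i 1)) =
    d ℓ • harmonicDeriv ℓ x e
  conv_rhs => rw [he, map_sum, Finset.smul_sum]
  refine Finset.sum_congr rfl fun i _ ↦ ?_
  rw [map_smul, smul_comm]

theorem zonalDeriv_self (hd : Summable fun ℓ : ℕ ↦ d ℓ ^ 2 * (ℓ * (ℓ + 1) : ℝ)) (x : S2) :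
    zonalDeriv hd x x = 0 := by
  refine lp.ext (funext fun ℓ ↦ ?_)
  change d ℓ • harmonicDeriv ℓ x x = 0
  rw [harmonicDeriv_self, smul_zero]

/-- The expansion holds in each degree. Summation over degrees is by dominated convergence, the
dominating series being 9 d_ℓ² ℓ(ℓ+1): the remainder quotient is at most 1 (increment) plus 2
(derivative) times √(ℓ(ℓ+1)). -/
theorem tendsto_zonalVec (hd : Summable fun ℓ ↦ d ℓ ^ 2)
    (hd' : Summable fun ℓ : ℕ ↦ d ℓ ^ 2 * (ℓ * (ℓ + 1) : ℝ)) (x : S2) :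
    Tendsto (fun y : S2 ↦ ‖zonalVec hd y - zonalVec hd x - zonalDeriv hd' x ((y : E3) - x)‖ /
      ‖(y : E3) - x‖) (𝓝[≠] x) (𝓝 0) := by
  set R : ℕ → S2 → ℝ := fun ℓ y ↦
    ‖harmonicVec ℓ y - harmonicVec ℓ x - harmonicDeriv ℓ x ((y : E3) - x)‖ / ‖(y : E3) - x‖ with hR
  have hR0 : ∀ ℓ y, 0 ≤ R ℓ y := fun ℓ y ↦ by positivity
  have hsum : ∀ y : S2, HasSum (fun ℓ ↦ d ℓ ^ 2 * R ℓ y ^ 2)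
      ((‖zonalVec hd y - zonalVec hd x - zonalDeriv hd' x ((y : E3) - x)‖ /
        ‖(y : E3) - x‖) ^ 2) := by
    intro y
    rw [div_pow]
    refine ((hasSum_norm_sq _).div_const _).congr_fun fun ℓ ↦ ?_
    have : (zonalVec hd y - zonalVec hd x - zonalDeriv hd' x ((y : E3) - x)) ℓ = d ℓ •
        (harmonicVec ℓ y - harmonicVec ℓ x - harmonicDeriv ℓ x ((y : E3) - x)) := by
      rw [smul_sub, smul_sub]; rfl
    rw [this, norm_smul, mul_pow, Real.norm_eq_abs, sq_abs, div_pow, mul_div_assoc]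
  have hbound : ∀ ℓ (y : S2), ‖d ℓ ^ 2 * R ℓ y ^ 2‖ ≤ 9 * (d ℓ ^ 2 * (ℓ * (ℓ + 1))) := by
    intro ℓ y
    have h1 : R ℓ y ≤ 3 * √(ℓ * (ℓ + 1)) := by
      refine div_le_of_le_mul₀ (norm_nonneg _) (by positivity) ?_
      refine (norm_sub_le _ _).trans ?_
      have h2 := norm_harmonicVec_sub_le ℓ y x
      have h3 := (harmonicDeriv ℓ x).le_of_opNorm_le (norm_harmonicDeriv_le ℓ x) ((y : E3) - x)
      linarith
    have h2 : R ℓ y ^ 2 ≤ 9 * (ℓ * (ℓ + 1)) := by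
      calc R ℓ y ^ 2 ≤ (3 * √(ℓ * (ℓ + 1))) ^ 2 := by gcongr
        _ = _ := by rw [mul_pow, Real.sq_sqrt (by positivity)]; ring
    rw [Real.norm_of_nonneg (by positivity)]
    nlinarith [mul_le_mul_of_nonneg_left h2 (sq_nonneg (d ℓ))]
  have hlim := tendsto_tsum_of_dominated_convergence (𝓕 := 𝓝[≠] x)
    (f := fun (y : S2) ℓ ↦ d ℓ ^ 2 * R ℓ y ^ 2) (g := fun _ ↦ 0) (hd'.mul_left 9)
    (fun ℓ ↦ by
      have := ((tendsto_harmonicVec ℓ x).pow 2).const_mul (d ℓ ^ 2)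
      rw [zero_pow two_ne_zero, mul_zero] at this
      exact this)
    (Eventually.of_forall fun y ℓ ↦ hbound ℓ y)
  simp only [(hsum _).tsum_eq, tsum_zero] at hlim
  have h2 := (Real.continuous_sqrt.tendsto 0).comp hlim
  rw [Real.sqrt_zero] at h2
  refine h2.congr fun y ↦ ?_
  exact Real.sqrt_sq (by positivity)

variable {Ω : Type*} [MeasurableSpace Ω] {P : Measure Ω} {W : HarmSeq →ₗᵢ[ℝ] Lp ℝ 2 P}

theorem eLpNorm_map_eq (u : HarmSeq) : eLpNorm (W u) 2 P = ENNReal.ofReal ‖u‖ := by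
  rw [← W.norm_map u, Lp.norm_def, ENNReal.ofReal_toReal (Lp.eLpNorm_ne_top _)]

/-- The mean-square gradient of a field with coefficients `d` satisfying `∑ d_ℓ² ℓ(ℓ+1) < ∞`. -/
theorem exists_isMeanSquareGradient (W : HarmSeq →ₗᵢ[ℝ] Lp ℝ 2 P)
    (hd : Summable fun ℓ ↦ d ℓ ^ 2) (hd' : Summable fun ℓ : ℕ ↦ d ℓ ^ 2 * (ℓ * (ℓ + 1) : ℝ))
    {h : S2 → Ω → ℝ} (hh : ∀ y, h y =ᵐ[P] W (zonalVec hd y)) (x : S2) :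
    ∃ G : Ω → E3, IsMeanSquareGradient h P x G ∧ ∫⁻ ω, ENNReal.ofReal (‖G ω‖ ^ 2) ∂P ≤
      ENNReal.ofReal (12 * ∑' ℓ : ℕ, d ℓ ^ 2 * (ℓ * (ℓ + 1) : ℝ)) := by
  -- The gradient is assembled from its three Cartesian components, each of squared norm at most 4 ∑
  -- d_ℓ² ℓ(ℓ+1); hence the constant 12.
  set Γ : Fin 3 → HarmSeq := fun i ↦ zonalDeriv hd' x (EuclideanSpace.single i 1) with hΓ
  set G : Ω → E3 := fun ω ↦ WithLp.toLp 2 fun i ↦ W (Γ i) ω with hG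
  have hinner : ∀ e : E3, (fun ω ↦ inner ℝ (G ω) e) =ᵐ[P] W (zonalDeriv hd' x e) := by
    intro e
    rw [← sum_smul_zonalDeriv]
    refine EventuallyEq.trans (Eventually.of_forall fun ω ↦ ?_)
      (coeFn_map_sum_smul W Γ (fun i ↦ EventuallyEq.rfl) fun i ↦ e i)
    simp [PiLp.inner_apply, hG]
  refine ⟨G, ⟨?_, ?_, ?_⟩, ?_⟩
  · have : G = fun ω ↦ ∑ i, W (Γ i) ω • (EuclideanSpace.single i (1 : ℝ) : E3) := by
      funext ω
      ext j
      simp [hG, Finset.sum_apply, Pi.single_apply]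
    rw [this]
    exact memLp_finsetSum _ fun i _ ↦ (ContinuousLinearMap.toSpanSingleton ℝ
      (EuclideanSpace.single i (1 : ℝ) : E3)).comp_memLp' (Lp.memLp (W (Γ i)))
  · filter_upwards [hinner x, Lp.coeFn_zero ℝ 2 P] with ω h1 h2
    rw [h1, zonalDeriv_self, map_zero, h2, Pi.zero_apply]
  · have h1 : ∀ y : S2, eLpNorm (fun ω ↦ h y ω - h x ω - inner ℝ (G ω) ((y : E3) - (x : E3))) 2 P
        = ENNReal.ofReal ‖zonalVec hd y - zonalVec hd x - zonalDeriv hd' x ((y : E3) - x)‖ := by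
      intro y
      rw [← eLpNorm_map_eq (W := W)]
      refine eLpNorm_congr_ae ?_
      rw [map_sub, map_sub]
      filter_upwards [hh y, hh x, hinner ((y : E3) - x),
        Lp.coeFn_sub (W (zonalVec hd y) - W (zonalVec hd x)) (W (zonalDeriv hd' x ((y : E3) - x))),
        Lp.coeFn_sub (W (zonalVec hd y)) (W (zonalVec hd x))] with ω h1 h2 h3 h4 h5
      rw [h4, Pi.sub_apply, h5, Pi.sub_apply, h1, h2, h3]
    have h2 := ENNReal.tendsto_ofReal (tendsto_zonalVec hd hd' x)
    rw [ENNReal.ofReal_zero] at h2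
    refine h2.congr' ?_
    filter_upwards [self_mem_nhdsWithin] with y hy
    have hpos : 0 < ‖(y : E3) - x‖ := norm_pos_iff.2 (sub_ne_zero.2 fun h ↦ hy (Subtype.ext h))
    rw [h1, ENNReal.ofReal_div_of_pos hpos, ofReal_norm ((y : E3) - x)]
  · have h1 : ∀ ω, ENNReal.ofReal (‖G ω‖ ^ 2) = ∑ i, ‖W (Γ i) ω‖ₑ ^ 2 := by
      intro ω
      rw [EuclideanSpace.norm_sq_eq, ENNReal.ofReal_sum_of_nonneg fun _ _ ↦ sq_nonneg _]
      refine Finset.sum_congr rfl fun i _ ↦ ?_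
      rw [ENNReal.ofReal_pow (norm_nonneg _), ofReal_norm]
    have h2 : ∀ i, ∫⁻ ω, ‖W (Γ i) ω‖ₑ ^ 2 ∂P = ENNReal.ofReal (‖Γ i‖ ^ 2) := by
      intro i
      have := eLpNorm_nnreal_pow_eq_lintegral (μ := P) (f := W (Γ i)) (p := 2) (by norm_num)
      simp only [NNReal.coe_ofNat, ENNReal.rpow_ofNat, ENNReal.coe_ofNat] at this
      rw [← this, eLpNorm_map_eq, ENNReal.ofReal_pow (norm_nonneg _)]
    have hm : ∀ i ∈ (Finset.univ : Finset (Fin 3)),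
        AEMeasurable (fun ω ↦ ‖W (Γ i) ω‖ₑ ^ 2) P := fun i _ ↦ by
      have := (Lp.aestronglyMeasurable (W (Γ i))).aemeasurable
      fun_prop
    simp only [h1]
    rw [lintegral_finsetSum' _ hm, Fin.sum_univ_three, h2, h2, h2,
      ← ENNReal.ofReal_add (by positivity) (by positivity),
      ← ENNReal.ofReal_add (by positivity) (by positivity)]
    refine ENNReal.ofReal_le_ofReal ?_
    have h3 : ∀ i, ‖Γ i‖ ^ 2 ≤ 4 * ∑' ℓ : ℕ, d ℓ ^ 2 * (ℓ * (ℓ + 1) : ℝ) := fun i ↦ by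
      simpa using norm_sq_zonalDeriv_le hd' x (EuclideanSpace.single i 1)
    linarith [h3 0, h3 1, h3 2]

end MeanSquareGradient
end SphericalField

namespace SphericalField
-- Cutoffs of uniformly bounded Dirichlet energy
noncomputable section Cutoffs

/-- A cutoff function of the height, equal to `1` outside the cap of radius `r / 2` and vanishing
inside the cap of radius `r / 4`, together with its derivative. -/
structure IsCutoff (r : ℝ) (Ψ Ψ' : ℝ → ℝ) : Prop where
  hasDerivAt : ∀ t, HasDerivAt Ψ (Ψ' t) t
  continuous_deriv : Continuous Ψ'
  nonneg : ∀ t, 0 ≤ Ψ t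
  le_one : ∀ t, Ψ t ≤ 1
  eq_zero : ∀ t, t < 1 → Real.cos (r / 4) ≤ t → Ψ t = 0
  eq_one : ∀ t, t < 1 → t ≤ Real.cos (r / 2) → Ψ t = 1
  deriv_support : ∀ t, Ψ' t ≠ 0 → t ∈ Set.Ioo (Real.cos (r / 2)) (Real.cos (r / 4))

theorem exists_abs_deriv_smoothTransition_le :
    ∃ M : ℝ, 0 ≤ M ∧ ∀ s, |deriv Real.smoothTransition s| ≤ M := by
  have hc : Continuous (deriv Real.smoothTransition) :=
    (Real.smoothTransition.contDiff (n := 1)).continuous_deriv (by norm_num)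
  obtain ⟨M, hM⟩ := (isCompact_Icc (a := (-1 : ℝ)) (b := 2)).exists_bound_of_continuousOn
    hc.continuousOn
  refine ⟨M, (norm_nonneg _).trans (hM 0 (by norm_num)), fun s ↦ ?_⟩
  by_cases hs : s ∈ Set.Icc (-1 : ℝ) 2
  · exact hM s hs
  have hM0 : 0 ≤ M := (norm_nonneg _).trans (hM 0 (by norm_num))
  suffices h : deriv Real.smoothTransition s = 0 by rw [h, abs_zero]; exact hM0
  rw [Set.mem_Icc, not_and_or, not_le, not_le] at hs
  rcases hs with hs | hs
  · have : Real.smoothTransition =ᶠ[𝓝 s] fun _ ↦ 0 := by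
      filter_upwards [gt_mem_nhds hs] with u hu
      exact Real.smoothTransition.zero_of_nonpos (by linarith)
    rw [this.deriv_eq, deriv_const]
  · have : Real.smoothTransition =ᶠ[𝓝 s] fun _ ↦ 1 := by
      filter_upwards [lt_mem_nhds hs] with u hu
      exact Real.smoothTransition.one_of_one_le (by linarith)
    rw [this.deriv_eq, deriv_const]

/-- Off (0,1) the function attains its global minimum or maximum. Including the endpoints gives the
strict inequalities needed for the open annulus. -/
theorem deriv_smoothTransition_eq_zero {s : ℝ} (hs : s ∉ Set.Ioo (0 : ℝ) 1) :
    deriv Real.smoothTransition s = 0 := by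
  rw [Set.mem_Ioo, not_and_or, not_lt, not_lt] at hs
  rcases hs with hs | hs
  · have h : IsLocalMin Real.smoothTransition s := Eventually.of_forall fun u ↦ by
      rw [Real.smoothTransition.zero_of_nonpos hs]; exact Real.smoothTransition.nonneg u
    exact h.deriv_eq_zero
  · have h : IsLocalMax Real.smoothTransition s := Eventually.of_forall fun u ↦ by
      rw [Real.smoothTransition.one_of_one_le hs]; exact Real.smoothTransition.le_one u
    exact h.deriv_eq_zero

/-- The squared slope is at most B²/(b-a)² on an interval of length b - a, where ρ² ≤ 1 - a². -/
theorem lintegral_energy_le {a b B : ℝ} (ha : 0 ≤ a) (hab : a < b) {Ψ' : ℝ → ℝ}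
    (hs : ∀ t, Ψ' t ≠ 0 → t ∈ Set.Ioo a b) (hB : ∀ t, |Ψ' t| ≤ B / (b - a)) :
    ∫⁻ t, ENNReal.ofReal (rho t ^ 2 * Ψ' t ^ 2) ∂heightMeasure ≤
      ENNReal.ofReal (2 * Real.pi * B ^ 2 * ((1 - a ^ 2) / (b - a))) := by
  by_cases ha1 : 1 ≤ a
  · have h0 : ∫⁻ t, ENNReal.ofReal (rho t ^ 2 * Ψ' t ^ 2) ∂heightMeasure = 0 := by
      rw [← lintegral_zero (μ := heightMeasure)]
      refine lintegral_congr_ae ?_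
      filter_upwards [ae_heightMeasure_mem_Icc] with t ht
      by_cases h : Ψ' t = 0
      · simp [h]
      · linarith [(hs t h).1, ht.2]
    rw [h0]; exact zero_le
  push Not at ha1
  have hd : 0 < b - a := sub_pos.2 hab
  set κ : ℝ := (1 - a ^ 2) * (B / (b - a)) ^ 2
  have hκ : 0 ≤ κ := mul_nonneg (by nlinarith) (sq_nonneg _)
  calc _ ≤ ∫⁻ t, (Set.Icc a b).indicator (fun _ ↦ ENNReal.ofReal κ) t ∂heightMeasure := by
        refine lintegral_mono_ae ?_
        filter_upwards [ae_heightMeasure_mem_Icc] with t ht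
        by_cases h : Ψ' t = 0
        · simp [h]
        have ht' := hs t h
        rw [Set.indicator_of_mem (Set.Ioo_subset_Icc_self ht')]
        refine ENNReal.ofReal_le_ofReal ?_
        rw [rho_sq ht]
        have h1 : Ψ' t ^ 2 ≤ (B / (b - a)) ^ 2 := sq_le_sq' (abs_le.1 (hB t)).1 (abs_le.1 (hB t)).2
        refine mul_le_mul ?_ h1 (sq_nonneg _) (by nlinarith)
        nlinarith [ht'.1]
    _ = ENNReal.ofReal κ * heightMeasure (Set.Icc a b) :=
        lintegral_indicator_const measurableSet_Icc _
    _ ≤ ENNReal.ofReal κ * (ENNReal.ofReal (2 * Real.pi) * ENNReal.ofReal (b - a)) := by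
        gcongr
        rw [heightMeasure, Measure.smul_apply, smul_eq_mul]
        gcongr
        exact (Measure.restrict_apply_le _ _).trans Real.volume_Icc.le
    _ = _ := by
        rw [← ENNReal.ofReal_mul (by positivity), ← ENNReal.ofReal_mul hκ]
        congr 1
        simp only [κ]
        field_simp

theorem exists_isCutoff : ∃ M : ℝ, 0 ≤ M ∧ ∀ r ∈ Set.Icc (0 : ℝ) (Real.pi / 2), ∃ Ψ Ψ' : ℝ → ℝ,
    IsCutoff r Ψ Ψ' ∧
    ∫⁻ t, ENNReal.ofReal (rho t ^ 2 * Ψ' t ^ 2) ∂heightMeasure ≤ ENNReal.ofReal M := by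
  obtain ⟨B, hB0, hB⟩ := exists_abs_deriv_smoothTransition_le
  refine ⟨2 * Real.pi * B ^ 2 * 8, by positivity, fun r hr ↦ ?_⟩
  -- For r = 0 the cutoff is the constant 1: the approximating kernel is zero. The restriction t < 1
  -- in `IsCutoff` makes the vanishing condition empty in this case.
  rcases hr.1.eq_or_lt with h0 | h0
  · subst h0
    refine ⟨fun _ ↦ 1, fun _ ↦ 0, ⟨fun t ↦ hasDerivAt_const _ _, continuous_const,
      fun _ ↦ zero_le_one, fun _ ↦ le_rfl, fun t h1 h2 ↦ ?_, fun _ _ _ ↦ rfl,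
      fun t h ↦ (h rfl).elim⟩, ?_⟩
    · rw [zero_div, Real.cos_zero] at h2
      linarith
    · simp
  have hpi := Real.pi_pos
  set a := Real.cos (r / 2) with ha_def
  set b := Real.cos (r / 4) with hb_def
  have hb0 : 0 ≤ b := Real.cos_nonneg_of_neg_pi_div_two_le_of_le (by linarith) (by linarith [hr.2])
  have ha0 : 0 ≤ a := Real.cos_nonneg_of_neg_pi_div_two_le_of_le (by linarith) (by linarith [hr.2])
  have hab : a < b := Real.cos_lt_cos_of_nonneg_of_le_pi (by linarith) (by linarith [hr.2])
    (by linarith)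
  have hd : 0 < b - a := sub_pos.2 hab
  -- With this, (1-a²)/(b-a) = 4b²(1+b)/(1+2b) ≤ 8. The ratio stays bounded as r → 0, which is the
  -- scale invariance of the energy.
  have haeq : a = 2 * b ^ 2 - 1 := by
    rw [ha_def, hb_def, ← Real.cos_two_mul]; congr 1; ring
  have hb1 : b ≤ 1 := Real.cos_le_one _
  have hder : ∀ t, HasDerivAt (fun t ↦ 1 - Real.smoothTransition ((t - a) / (b - a)))
      (-(deriv Real.smoothTransition ((t - a) / (b - a)) * (1 / (b - a)))) t := by
    intro t
    have h1 : HasDerivAt Real.smoothTransition (deriv Real.smoothTransition ((t - a) / (b - a)))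
        ((t - a) / (b - a)) :=
      ((Real.smoothTransition.contDiff (n := 1)).differentiable (by norm_num) _).hasDerivAt
    have h2 : HasDerivAt (fun t ↦ (t - a) / (b - a)) (1 / (b - a)) t :=
      ((hasDerivAt_id t).sub_const a).div_const _
    exact (h1.comp t h2).const_sub 1
  have hsupp : ∀ t, -(deriv Real.smoothTransition ((t - a) / (b - a)) * (1 / (b - a))) ≠ 0 →
      t ∈ Set.Ioo a b := by
    intro t ht
    by_contra hn
    refine ht ?_
    rw [deriv_smoothTransition_eq_zero, zero_mul, neg_zero]
    intro h
    refine hn ⟨?_, ?_⟩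
    · have := (div_pos_iff_of_pos_right hd).1 h.1; linarith
    · have := (div_lt_one hd).1 h.2; linarith
  refine ⟨_, _, ⟨hder, ?_, fun t ↦ sub_nonneg.2 (Real.smoothTransition.le_one _),
    fun t ↦ sub_le_self _ (Real.smoothTransition.nonneg _), fun t _ h ↦ ?_, fun t _ h ↦ ?_,
    hsupp⟩, ?_⟩
  · have hc : Continuous (deriv Real.smoothTransition) :=
      (Real.smoothTransition.contDiff (n := 1)).continuous_deriv (by norm_num)
    fun_prop
  · rw [Real.smoothTransition.one_of_one_le ((one_le_div hd).2 (by linarith)), sub_self]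
  · rw [Real.smoothTransition.zero_of_nonpos (div_nonpos_of_nonpos_of_nonneg (by linarith) hd.le),
      sub_zero]
  · refine (lintegral_energy_le (B := B) ha0 hab hsupp fun t ↦ ?_).trans
      (ENNReal.ofReal_le_ofReal ?_)
    · rw [abs_neg, abs_mul, abs_of_pos (by positivity : 0 < 1 / (b - a)), mul_one_div]
      gcongr
      exact hB _
    · refine mul_le_mul_of_nonneg_left ?_ (by positivity)
      rw [div_le_iff₀ hd, haeq]
      nlinarith [mul_nonneg hb0 hb0, mul_nonneg (sub_nonneg.2 hb1) hb0,
        mul_nonneg (mul_nonneg (sub_nonneg.2 hb1) hb0) hb0,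
        mul_nonneg (mul_nonneg (sub_nonneg.2 hb1) hb0) (mul_nonneg hb0 hb0)]

theorem IsCutoff.continuous {r : ℝ} {Ψ Ψ' : ℝ → ℝ} (h : IsCutoff r Ψ Ψ') : Continuous Ψ :=
  continuous_iff_continuousAt.2 fun t ↦ (h.hasDerivAt t).continuousAt

end Cutoffs

/-! ### Bounds by the quantities q₁, q₂ and q₃ -/

noncomputable section Estimates

theorem lintegral_comp_inner (x : S2) {F : ℝ → ℝ≥0∞} (hF : AEMeasurable F heightMeasure) :
    ∫⁻ z : S2, F (inner ℝ (x : E3) (z : E3)) ∂area = ∫⁻ t, F t ∂heightMeasure := by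
  rw [← (measurePreserving_inner x).map_eq] at hF ⊢
  rw [lintegral_map' hF (measurePreserving_inner x).aemeasurable]

theorem ae_comp_inner (x : S2) {p : ℝ → Prop} (h : ∀ᵐ t ∂heightMeasure, p t) :
    ∀ᵐ z : S2 ∂area, p (inner ℝ (x : E3) (z : E3)) :=
  (measurePreserving_inner x).quasiMeasurePreserving.ae h

theorem mem_cap_iff {s : ℝ} (hs : s ∈ Set.Icc 0 Real.pi) (x : S2) :
    x ∈ cap s ↔ Real.cos s ≤ (x : E3) 2 := by
  rw [cap, Set.mem_ofPred_eq, ← inner_northPole, ← cos_sphDist]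
  exact (Real.strictAntiOn_cos.le_iff_ge hs
    ⟨InnerProductGeometry.angle_nonneg _ _, InnerProductGeometry.angle_le_pi _ _⟩).symm

theorem measurableSet_cap (s : ℝ) : MeasurableSet (cap s) := by
  have h : cap s = {x : S2 | Real.arccos (inner ℝ (northPole : E3) (x : E3)) ≤ s} := by
    ext x
    simp [cap, sphDist, InnerProductGeometry.angle, norm_eq_of_mem_sphere]
  rw [h]
  exact measurableSet_le (by fun_prop : Continuous _).measurable measurable_const

variable {c : ℕ → ℝ}

/-- The vector η - x₂x is the tangential projection of the pole, of squared length 1 - x₂². The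
spherical gradient of q therefore has length ρ|Q'|. -/
theorem hasGradientAt_radial {Q : ℝ → ℝ} {Q' : ℝ} (x : S2) (hQ : HasDerivAt Q Q' ((x : E3) 2)) :
    HasGradientAt (fun y : E3 ↦ Q (‖y‖⁻¹ * y 2))
      (Q' • ((northPole : E3) - (x : E3) 2 • (x : E3))) (x : E3) := by
  have hx : ‖(x : E3)‖ = 1 := norm_eq_of_mem_sphere x
  have h1 : HasFDerivAt (fun y : E3 ↦ √(‖y‖ ^ 2)) (innerSL ℝ (x : E3)) (x : E3) := by
    have := ((hasStrictFDerivAt_norm_sq (x : E3)).hasFDerivAt).sqrt (by simp [hx])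
    refine this.congr_fderiv ?_
    ext e
    simp [hx]
  have h1' : HasFDerivAt (fun y : E3 ↦ ‖y‖) (innerSL ℝ (x : E3)) (x : E3) := by
    refine h1.congr_of_eventuallyEq (Eventually.of_forall fun y ↦ ?_)
    exact (Real.sqrt_sq (norm_nonneg y)).symm
  have h2 : HasFDerivAt (fun y : E3 ↦ ‖y‖⁻¹) (-innerSL ℝ (x : E3)) (x : E3) := by
    have h3 := (hasDerivAt_inv (norm_ne_zero_iff.2 (coe_ne_zero x))).comp_hasFDerivAt (x : E3) h1'
    refine h3.congr_fderiv ?_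
    ext e
    simp [hx]
  have h3 : HasFDerivAt (fun y : E3 ↦ y 2) (EuclideanSpace.proj 2 : E3 →L[ℝ] ℝ) (x : E3) :=
    (EuclideanSpace.proj 2 : E3 →L[ℝ] ℝ).hasFDerivAt
  have h4 := h2.mul h3
  have h5 : HasDerivAt Q Q' (‖(x : E3)‖⁻¹ * (x : E3) 2) := by simpa [hx] using hQ
  rw [hasGradientAt_iff_hasFDerivAt]
  refine (h5.comp_hasFDerivAt (x : E3) h4).congr_fderiv ?_
  ext e
  simp [hx, inner_northPole]
  ring

theorem norm_sphericalGradient {Q' : ℝ} (x : S2)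
    (hQ : HasDerivAt (zonalSeries c) Q' ((x : E3) 2)) :
    ‖sphericalGradient (q c) x‖ ^ 2 = Q' ^ 2 * (1 - (x : E3) 2 ^ 2) := by
  have h1 : HasGradientAt (fun y : E3 ↦ if h : y = 0 then 0 else
      q c ⟨‖y‖⁻¹ • y, by simp [norm_smul, h]⟩)
      (Q' • ((northPole : E3) - (x : E3) 2 • (x : E3))) (x : E3) := by
    refine (hasGradientAt_radial x hQ).congr_of_eventuallyEq ?_
    filter_upwards [isOpen_ne.mem_nhds (coe_ne_zero x)] with y hy
    rw [dif_neg hy, q_eq]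
    simp
  rw [sphericalGradient, h1.gradient, norm_smul, mul_pow, Real.norm_eq_abs, sq_abs,
    norm_sub_sq_real, inner_smul_right, inner_northPole, norm_smul, mul_pow,
    norm_eq_of_mem_sphere, norm_eq_of_mem_sphere, Real.norm_eq_abs, sq_abs]
  ring

theorem ae_norm_sphericalGradient (hc : Summable fun ℓ : ℕ ↦ c ℓ ^ 2 * ((ℓ : ℝ) + 1) ^ 2) :
    ∀ᵐ x : S2 ∂area, ‖sphericalGradient (q c) x‖ ^ 2 = zonalGrad c ((x : E3) 2) ^ 2 := by
  have h1 := ae_comp_inner northPole (ae_hasDerivAt_zonalSeries hc)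
  have h2 := ae_comp_inner northPole ae_heightMeasure_mem_Ioo
  filter_upwards [h1, h2] with x hx hx2
  rw [inner_northPole] at hx hx2
  rw [norm_sphericalGradient x hx, ← rho_sq ⟨hx2.1.le, hx2.2.le⟩, ← mul_pow, mul_right_comm,
    inv_mul_cancel₀ (rho_pos hx2).ne', one_mul]

variable {r : ℝ} {Ψ Ψ' : ℝ → ℝ}

theorem IsCutoff.sq_le_one (h : IsCutoff r Ψ Ψ') (t : ℝ) : Ψ t ^ 2 ≤ 1 :=
  pow_le_one₀ (h.nonneg t) (h.le_one t)

/-- A weight that is supported outside the cap of radius `r / 4` localises integrals. -/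
theorem lintegral_cutoff_le (h : IsCutoff r Ψ Ψ') (hr : r ∈ Set.Icc 0 (Real.pi / 2)) {A : ℝ → ℝ}
    {F : S2 → ℝ} (hA : AEMeasurable A heightMeasure)
    (hAF : ∀ᵐ x : S2 ∂area, A ((x : E3) 2) ^ 2 = F x) :
    ∫⁻ t, ENNReal.ofReal ((Ψ t * A t) ^ 2) ∂heightMeasure ≤
      ∫⁻ x in (cap (r / 4))ᶜ, ENNReal.ofReal (F x) ∂area := by
  have hm : AEMeasurable (fun t ↦ ENNReal.ofReal ((Ψ t * A t) ^ 2)) heightMeasure :=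
    ((h.continuous.aemeasurable.mul hA).pow_const 2).ennreal_ofReal
  rw [← lintegral_comp_inner northPole hm,
    ← lintegral_indicator (measurableSet_cap _).compl]
  refine lintegral_mono_ae ?_
  filter_upwards [hAF, ae_comp_inner northPole ae_heightMeasure_mem_Ioo] with x h1 h2
  rw [inner_northPole] at h2 ⊢
  by_cases hx : x ∈ cap (r / 4)
  · rw [mem_cap_iff ⟨by linarith [hr.1], by linarith [hr.2, Real.pi_pos]⟩] at hx
    rw [h.eq_zero _ h2.2 hx]
    simp
  · rw [Set.indicator_of_mem (Set.mem_compl hx)]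
    refine ENNReal.ofReal_le_ofReal ?_
    rw [mul_pow, ← h1]
    exact mul_le_of_le_one_left (sq_nonneg _) (h.sq_le_one _)

theorem lintegral_cutoff_le_q₁ (hc : Summable fun ℓ : ℕ ↦ c ℓ ^ 2 * ((ℓ : ℝ) + 1) ^ 2)
    (h : IsCutoff r Ψ Ψ') (hr : r ∈ Set.Icc 0 (Real.pi / 2)) :
    ∫⁻ t, ENNReal.ofReal ((Ψ t * zonalSeries c t) ^ 2) ∂heightMeasure ≤ q₁ c r :=
  lintegral_cutoff_le h hr (memLp_zonalSeries hc).aestronglyMeasurable.aemeasurable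
    (Eventually.of_forall fun x ↦ by rw [q_eq])

theorem ofReal_add_sq_le (u v : ℝ) : ENNReal.ofReal ((u + v) ^ 2) ≤
    2 * ENNReal.ofReal (u ^ 2) + 2 * ENNReal.ofReal (v ^ 2) := by
  rw [← ENNReal.ofReal_ofNat 2, ← ENNReal.ofReal_mul (by norm_num),
    ← ENNReal.ofReal_mul (by norm_num), ← ENNReal.ofReal_add (by positivity) (by positivity)]
  refine ENNReal.ofReal_le_ofReal ?_
  nlinarith [sq_nonneg (u - v)]

/-- Apply (u+v)² ≤ 2u² + 2v² to the product rule. The factor Ψ lives outside D_{r/4}; the factor Ψ'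
lives on the annulus, where q² is bounded by its supremum and ρ²Ψ'² integrates to at most M. -/
theorem lintegral_cutGrad_le_q₃ (hc : Summable fun ℓ : ℕ ↦ c ℓ ^ 2 * ((ℓ : ℝ) + 1) ^ 2)
    (h : IsCutoff r Ψ Ψ') (hr : r ∈ Set.Icc 0 (Real.pi / 2)) {M : ℝ}
    (hM : ∫⁻ t, ENNReal.ofReal (rho t ^ 2 * Ψ' t ^ 2) ∂heightMeasure ≤ ENNReal.ofReal M) :
    ∫⁻ t, ENNReal.ofReal (cutGrad c Ψ Ψ' t ^ 2) ∂heightMeasure ≤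
      (2 + 2 * ENNReal.ofReal M) * q₃ c r := by
  set I := ∫⁻ x in (cap (r / 4))ᶜ, ENNReal.ofReal (‖sphericalGradient (q c) x‖ ^ 2) ∂area
  set S : ℝ≥0∞ := ⨆ x ∈ cap (r / 2) \ cap (r / 4), ENNReal.ofReal (q c x ^ 2) with hS
  have hzm : AEMeasurable (zonalGrad c) heightMeasure :=
    (Lp.aestronglyMeasurable (zonalGrad c)).aemeasurable
  have h1 : ∫⁻ t, ENNReal.ofReal ((Ψ t * zonalGrad c t) ^ 2) ∂heightMeasure ≤ I :=
    lintegral_cutoff_le h hr hzm (by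
      filter_upwards [ae_norm_sphericalGradient hc] with x hx
      rw [hx])
  have h2 : ∫⁻ t, ENNReal.ofReal ((rho t * Ψ' t * zonalSeries c t) ^ 2) ∂heightMeasure ≤
      ENNReal.ofReal M * S := by
    have hm : Measurable fun t ↦ ENNReal.ofReal (rho t ^ 2 * Ψ' t ^ 2) := by
      have h3 := continuous_rho
      have h4 := h.continuous_deriv
      exact (by fun_prop : Continuous fun t ↦ rho t ^ 2 * Ψ' t ^ 2).measurable.ennreal_ofReal
    refine le_trans ?_ (mul_le_mul_left hM S)
    rw [← lintegral_mul_const _ hm]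
    refine lintegral_mono_ae ?_
    filter_upwards [ae_heightMeasure_mem_Icc] with t ht
    by_cases h0 : Ψ' t = 0
    · simp [h0]
    rw [mul_pow, mul_pow, ENNReal.ofReal_mul (by positivity)]
    gcongr
    -- Every height is attained on the sphere, so the supremum over points of the annulus bounds Q²
    -- at each height in it.
    obtain ⟨x, hx⟩ := exists_S2_height ht
    have ht' := h.deriv_support t h0
    have hpi := Real.pi_pos
    have hxm : x ∈ cap (r / 2) \ cap (r / 4) := by
      refine ⟨?_, ?_⟩
      · rw [mem_cap_iff ⟨by linarith [hr.1], by linarith [hr.2]⟩, hx]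
        exact ht'.1.le
      · rw [mem_cap_iff ⟨by linarith [hr.1], by linarith [hr.2]⟩, hx]
        exact not_le.2 ht'.2
    rw [hS, ← hx, ← q_eq]
    exact le_iSup₂ (f := fun (x : S2) (_ : x ∈ cap (r / 2) \ cap (r / 4)) ↦
      ENNReal.ofReal (q c x ^ 2)) x hxm
  have h3 : ∀ t, ENNReal.ofReal (cutGrad c Ψ Ψ' t ^ 2) ≤
      2 * ENNReal.ofReal ((Ψ t * zonalGrad c t) ^ 2) +
      2 * ENNReal.ofReal ((rho t * Ψ' t * zonalSeries c t) ^ 2) := fun t ↦ ofReal_add_sq_le _ _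
  have hm1 : AEMeasurable (fun t ↦ 2 * ENNReal.ofReal ((Ψ t * zonalGrad c t) ^ 2))
      heightMeasure :=
    (((h.continuous.aemeasurable.mul hzm).pow_const 2).ennreal_ofReal).const_mul 2
  calc _ ≤ ∫⁻ t, (2 * ENNReal.ofReal ((Ψ t * zonalGrad c t) ^ 2) +
        2 * ENNReal.ofReal ((rho t * Ψ' t * zonalSeries c t) ^ 2)) ∂heightMeasure :=
        lintegral_mono h3
    _ ≤ 2 * I + 2 * (ENNReal.ofReal M * S) := by
        rw [lintegral_add_left' hm1, lintegral_const_mul' _ _ (by simp),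
          lintegral_const_mul' _ _ (by simp)]
        gcongr
    _ ≤ (2 + 2 * ENNReal.ofReal M) * (I + S) := by
        rw [add_mul, mul_add, mul_add]
        refine add_le_add le_self_add ?_
        rw [mul_assoc, mul_assoc]
        exact le_add_self

theorem cutoff_compl_eq_zero (h : IsCutoff r Ψ Ψ') (hr : r ∈ Set.Icc 0 (Real.pi / 2)) {y z : S2}
    (h1 : inner ℝ (y : E3) (z : E3) < (1 : ℝ)) (h2 : r / 2 ≤ sphDist y z) :
    1 - Ψ (inner ℝ (y : E3) (z : E3)) = 0 := by
  rw [h.eq_one _ h1, sub_self]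
  rw [← cos_sphDist]
  exact Real.cos_le_cos_of_nonneg_of_le_pi (by linarith [hr.1])
    (InnerProductGeometry.angle_le_pi _ _) h2

/-- The kernels with axes at distance at least `r`, cut off to caps, have disjoint supports. -/
theorem integral_cutoff_mul_cutoff_eq_zero (h : IsCutoff r Ψ Ψ')
    (hr : r ∈ Set.Icc 0 (Real.pi / 2)) {x y : S2} (hxy : r ≤ sphDist x y) (A : ℝ → ℝ) :
    ∫ z : S2, ((1 - Ψ (inner ℝ (x : E3) (z : E3))) * A (inner ℝ (x : E3) (z : E3))) *
      ((1 - Ψ (inner ℝ (y : E3) (z : E3))) * A (inner ℝ (y : E3) (z : E3))) ∂area = 0 := by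
  refine integral_eq_zero_of_ae ?_
  filter_upwards [ae_comp_inner x ae_heightMeasure_mem_Ioo,
    ae_comp_inner y ae_heightMeasure_mem_Ioo] with z hx hy
  have htri : sphDist x y ≤ sphDist x z + sphDist y z := by
    have := InnerProductGeometry.angle_le_angle_add_angle (x : E3) (z : E3) (y : E3)
    rwa [InnerProductGeometry.angle_comm (z : E3)] at this
  rcases le_or_gt (r / 2) (sphDist x z) with h1 | h1
  · rw [cutoff_compl_eq_zero h hr hx.2 h1]; simp
  · rw [cutoff_compl_eq_zero h hr hy.2 (by linarith)]; simp

/-- The cut kernel confines z to distance less than r/2 from y, so d(x,z) differs from d(x,y) by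
less than r/2. Almost every z is neither x nor its antipode, so the supremum may omit the poles. -/
theorem ofReal_abs_integral_cross_le (hc : Summable fun ℓ : ℕ ↦ c ℓ ^ 2 * ((ℓ : ℝ) + 1) ^ 2)
    (h : IsCutoff r Ψ Ψ') (hr : r ∈ Set.Icc 0 (Real.pi / 2)) (x y : S2) :
    ENNReal.ofReal |∫ z : S2, zonalSeries c (inner ℝ (x : E3) (z : E3)) *
      ((1 - Ψ (inner ℝ (y : E3) (z : E3))) * zonalSeries c (inner ℝ (y : E3) (z : E3))) ∂area| ≤
    (∫⁻ x in cap (r / 2), ENNReal.ofReal |q c x| ∂area) *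
      ⨆ θ' ∈ Set.Icc (sphDist x y - r / 2) (sphDist x y + r / 2) ∩ Set.Ioo 0 Real.pi,
        ENNReal.ofReal |qAngle c θ'| := by
  set S : ℝ≥0∞ := ⨆ θ' ∈ Set.Icc (sphDist x y - r / 2) (sphDist x y + r / 2) ∩
    Set.Ioo 0 Real.pi, ENNReal.ofReal |qAngle c θ'| with hS
  have hpi := Real.pi_pos
  set F : ℝ → ℝ≥0∞ := (Set.Ici (Real.cos (r / 2))).indicator
    fun t ↦ ENNReal.ofReal |zonalSeries c t| with hF
  have hFm : AEMeasurable F heightMeasure := by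
    have hq := (memLp_zonalSeries hc).aestronglyMeasurable.aemeasurable
    have h1 : AEMeasurable (fun t ↦ ENNReal.ofReal |zonalSeries c t|) heightMeasure :=
      (measurable_norm.comp_aemeasurable hq).ennreal_ofReal
    exact h1.indicator measurableSet_Ici
  -- The integral over the cap depends only on the heights, so its centre may be moved from the pole
  -- to y.
  have hcap : ∫⁻ x in cap (r / 2), ENNReal.ofReal |q c x| ∂area =
      ∫⁻ z : S2, F (inner ℝ (y : E3) (z : E3)) ∂area := by
    rw [lintegral_comp_inner y hFm, ← lintegral_comp_inner northPole hFm,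
      ← lintegral_indicator (measurableSet_cap _)]
    refine lintegral_congr fun z ↦ ?_
    rw [inner_northPole]
    have hz := mem_cap_iff (s := r / 2) ⟨by linarith [hr.1], by linarith [hr.2]⟩ z
    by_cases hm : z ∈ cap (r / 2)
    · rw [Set.indicator_of_mem hm, hF, Set.indicator_of_mem (Set.mem_Ici.2 (hz.1 hm)), q_eq]
    · rw [Set.indicator_of_notMem hm, hF,
        Set.indicator_of_notMem (fun h ↦ hm (hz.2 (Set.mem_Ici.1 h)))]
  have hFm' : AEMeasurable (fun z : S2 ↦ F (inner ℝ (y : E3) (z : E3))) area := by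
    rw [← (measurePreserving_inner y).map_eq] at hFm
    exact hFm.comp_measurable (measurePreserving_inner y).measurable
  rw [hcap, ← lintegral_mul_const'' _ hFm', ← Real.norm_eq_abs, ofReal_norm]
  refine (enorm_integral_le_lintegral_enorm _).trans (lintegral_mono_ae ?_)
  filter_upwards [ae_comp_inner x ae_heightMeasure_mem_Ioo,
    ae_comp_inner y ae_heightMeasure_mem_Ioo] with z hx hy
  rcases le_or_gt (r / 2) (sphDist y z) with h1 | h1
  · rw [cutoff_compl_eq_zero h hr hy.2 h1]; simp
  have h2 : Real.cos (r / 2) ≤ inner ℝ (y : E3) (z : E3) := by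
    rw [← cos_sphDist]
    exact Real.cos_le_cos_of_nonneg_of_le_pi (InnerProductGeometry.angle_nonneg _ _)
      (by linarith [hr.2]) h1.le
  have h3 : ‖zonalSeries c (inner ℝ (x : E3) (z : E3))‖ₑ ≤ S := by
    rw [← ofReal_norm, Real.norm_eq_abs, ← cos_sphDist, ← qAngle_eq, hS]
    refine le_iSup₂ (f := fun (θ' : ℝ) (_ : θ' ∈ Set.Icc (sphDist x y - r / 2)
      (sphDist x y + r / 2) ∩ Set.Ioo 0 Real.pi) ↦ ENNReal.ofReal |qAngle c θ'|) (sphDist x z) ?_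
    have t1 := InnerProductGeometry.angle_le_angle_add_angle (x : E3) (z : E3) (y : E3)
    have t2 := InnerProductGeometry.angle_le_angle_add_angle (x : E3) (y : E3) (z : E3)
    rw [InnerProductGeometry.angle_comm (z : E3)] at t1
    simp only [sphDist] at h1 ⊢
    refine ⟨⟨by linarith, by linarith⟩, ?_, ?_⟩
    · refine (InnerProductGeometry.angle_nonneg _ _).lt_of_ne fun h0 ↦ ?_
      have := cos_sphDist x z
      rw [sphDist, ← h0, Real.cos_zero] at this
      linarith [hx.2]
    · refine (InnerProductGeometry.angle_le_pi _ _).lt_of_ne fun h0 ↦ ?_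
      have := cos_sphDist x z
      rw [sphDist, h0, Real.cos_pi] at this
      linarith [hx.1]
  rw [hF, Set.indicator_of_mem (Set.mem_Ici.2 h2), enorm_mul, enorm_mul, mul_comm]
  refine mul_le_mul' ?_ h3
  rw [← Real.norm_eq_abs, ofReal_norm]
  refine mul_le_of_le_one_left zero_le ?_
  rw [← ofReal_norm, ENNReal.ofReal_le_one, Real.norm_of_nonneg (sub_nonneg.2 (h.le_one _))]
  linarith [h.nonneg (inner ℝ (y : E3) (z : E3))]

end Estimates
end SphericalField

namespace SphericalField
-- Construction of the finite-range field
noncomputable section FiniteRange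

variable {c : ℕ → ℝ} {r : ℝ} {Ψ Ψ' : ℝ → ℝ}

theorem legendreCoeff_sub {A B : ℝ → ℝ} (hA : MemLp A 2 heightMeasure)
    (hB : MemLp B 2 heightMeasure) (ℓ : ℕ) :
    legendreCoeff (fun t ↦ A t - B t) ℓ = legendreCoeff A ℓ - legendreCoeff B ℓ := by
  have hn : MemLp (normLegendre ℓ) 2 heightMeasure :=
    (continuous_normLegendre ℓ).memLp_heightMeasure 2
  refine Eq.trans ?_ (integral_sub (hn.integrable_mul hA) (hn.integrable_mul hB))
  exact integral_congr_ae (Eventually.of_forall fun t ↦ mul_sub _ _ _)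

theorem ofReal_integral_sq {A : ℝ → ℝ} (hA : MemLp A 2 heightMeasure) :
    ENNReal.ofReal (∫ t, A t ^ 2 ∂heightMeasure) =
      ∫⁻ t, ENNReal.ofReal (A t ^ 2) ∂heightMeasure :=
  ofReal_integral_eq_lintegral_ofReal hA.integrable_sq (Eventually.of_forall fun _ ↦ sq_nonneg _)

theorem zonalVec_sub {b d : ℕ → ℝ} (hc : Summable fun ℓ ↦ c ℓ ^ 2) (hb : Summable fun ℓ ↦ b ℓ ^ 2)
    (hd : Summable fun ℓ ↦ d ℓ ^ 2) (h : ∀ ℓ, c ℓ - b ℓ = d ℓ) (x : S2) :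
    zonalVec hc x - zonalVec hb x = zonalVec hd x := by
  refine lp.ext (funext fun ℓ ↦ ?_)
  change c ℓ • harmonicVec ℓ x - b ℓ • harmonicVec ℓ x = d ℓ • harmonicVec ℓ x
  rw [← sub_smul, h]

theorem norm_sq_zonalVec {d : ℕ → ℝ} (hd : Summable fun ℓ ↦ d ℓ ^ 2) (x : S2) :
    ‖zonalVec hd x‖ ^ 2 = ∑' ℓ, d ℓ ^ 2 := by
  rw [← (hasSum_norm_sq (zonalVec hd x)).tsum_eq]
  exact tsum_congr fun ℓ ↦ norm_sq_smul_harmonicVec d x ℓ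

theorem inner_zonalVec_swap {a b : ℕ → ℝ} (ha : Summable fun ℓ ↦ a ℓ ^ 2)
    (hb : Summable fun ℓ ↦ b ℓ ^ 2) (x y : S2) :
    (inner ℝ (zonalVec ha y) (zonalVec hb x) : ℝ) = inner ℝ (zonalVec ha x) (zonalVec hb y) := by
  refine (hasSum_inner_zonalVec ha hb y x).unique ?_
  rw [real_inner_comm]
  exact hasSum_inner_zonalVec ha hb x y

theorem K_sphDist_eq (hc : Summable fun ℓ ↦ c ℓ ^ 2) (x y : S2) :
    K c (sphDist x y) = inner ℝ (zonalVec hc x) (zonalVec hc y) := by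
  rw [← (hasSum_inner_zonalVec hc hc x y).tsum_eq, K, cos_sphDist]
  simp only [sq]

theorem inner_zonalVec_eq_integral {A B : ℝ → ℝ} (hA : MemLp A 2 heightMeasure)
    (hB : MemLp B 2 heightMeasure) {a b : ℕ → ℝ} (ha : Summable fun ℓ ↦ a ℓ ^ 2)
    (hb : Summable fun ℓ ↦ b ℓ ^ 2) (hAa : ∀ ℓ, legendreCoeff A ℓ = a ℓ)
    (hBb : ∀ ℓ, legendreCoeff B ℓ = b ℓ) (x y : S2) :
    inner ℝ (zonalVec ha x) (zonalVec hb y) =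
      ∫ z : S2, A (inner ℝ (x : E3) (z : E3)) * B (inner ℝ (y : E3) (z : E3)) ∂area := by
  refine (hasSum_inner_zonalVec ha hb x y).unique ?_
  simpa only [hAa, hBb] using hasSum_legendreCoeff_mul hA hB x y

variable {Ω : Type*} [MeasurableSpace Ω] {P : Measure Ω} [IsProbabilityMeasure P]
  {W : HarmSeq →ₗᵢ[ℝ] Lp ℝ 2 P}

theorem IsIsonormal.isIsotropic (hW : IsIsonormal W) {b : ℕ → ℝ} (hb : Summable fun ℓ ↦ b ℓ ^ 2)
    {g : S2 → Ω → ℝ} (hg : ∀ x, g x =ᵐ[P] W (zonalVec hb x)) : IsIsotropic g P := by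
  intro R _ n x y hxy
  refine hW.identDistrib (fun i ↦ hg (y i)) (fun i ↦ hg (x i)) fun i j ↦ ?_
  refine (hasSum_inner_zonalVec hb hb (y i) (y j)).unique ?_
  rw [hxy, hxy, R.inner_map_map]
  exact hasSum_inner_zonalVec hb hb (x i) (x j)

/-- The coefficients c = b + d follow the splitting Q = (1-Ψ)Q + ΨQ. All fields come from the same
`W`, so the coupling is automatic and the claims become inner products of kernels. -/
theorem IsIsonormal.exists_finiteRange (hW : IsIsonormal W)
    (hc : Summable fun ℓ : ℕ ↦ c ℓ ^ 2 * ((ℓ : ℝ) + 1) ^ 2) {f : S2 → Ω → ℝ}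
    (hf : ∀ x, f x =ᵐ[P] W (zonalVec (summable_sq_of_succ hc) x))
    (hr : r ∈ Set.Icc 0 (Real.pi / 2)) (hΨ : IsCutoff r Ψ Ψ') {M : ℝ}
    (hM : ∫⁻ t, ENNReal.ofReal (rho t ^ 2 * Ψ' t ^ 2) ∂heightMeasure ≤ ENNReal.ofReal M) :
    ∃ g : S2 → Ω → ℝ,
      (∀ ω, Continuous (fun x ↦ g x ω)) ∧
      IsGaussianProcess g P ∧
      (∀ x, ∫ ω, g x ω ∂P = 0) ∧
      IsIsotropic g P ∧
      IsRangeDependent r g P ∧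
      (∀ x y : S2,
        ENNReal.ofReal |covariance (fun ω ↦ f x ω - g x ω) (fun ω ↦ f y ω - g y ω) P| ≤ q₁ c r ∧
        (r ≤ sphDist x y →
          ENNReal.ofReal |covariance (fun ω ↦ f x ω - g x ω) (fun ω ↦ f y ω - g y ω) P|
            ≤ 2 * q₂ c r (sphDist x y))) ∧
      (∀ x : S2, ∃ G : Ω → E3,
        IsMeanSquareGradient (fun y ω ↦ f y ω - g y ω) P x G ∧
        ∫⁻ ω, ENNReal.ofReal (‖G ω‖ ^ 2) ∂P ≤ 12 * (2 + 2 * ENNReal.ofReal M) * q₃ c r) := by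
  set A : ℝ → ℝ := fun t ↦ Ψ t * zonalSeries c t with hA_def
  set B : ℝ → ℝ := fun t ↦ (1 - Ψ t) * zonalSeries c t with hB_def
  have hQ := memLp_zonalSeries hc
  have hA : MemLp A 2 heightMeasure := memLp_cut hc hΨ.continuous
  have hB : MemLp B 2 heightMeasure := memLp_cut hc (continuous_const.sub hΨ.continuous)
  set d : ℕ → ℝ := legendreCoeff A with hd_def
  set b : ℕ → ℝ := fun ℓ ↦ c ℓ - d ℓ with hb_def
  have hcQ := legendreCoeff_zonalSeries hc
  have hBb : ∀ ℓ, legendreCoeff B ℓ = b ℓ := by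
    intro ℓ
    have h1 := legendreCoeff_sub hQ hA ℓ
    rw [hcQ] at h1
    rw [hb_def, hd_def]
    simp only
    rw [← h1]
    congr 1
    funext t
    simp only [hA_def, hB_def]
    ring
  have hc0 := summable_sq_of_succ hc
  obtain ⟨hd0, hdle⟩ := sum_sq_legendreCoeff_le hA
  -- Finite energy of d comes from the cutoff and that of c from the hypothesis, so b = c - d has
  -- finite energy too.
  obtain ⟨hd1, hdle1⟩ := energy_cut_le hc hΨ.hasDerivAt hΨ.continuous_deriv
  have hbc : ∀ (w : ℕ → ℝ), (∀ ℓ, 0 ≤ w ℓ) → (Summable fun ℓ ↦ c ℓ ^ 2 * w ℓ) →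
      (Summable fun ℓ ↦ d ℓ ^ 2 * w ℓ) → Summable fun ℓ ↦ b ℓ ^ 2 * w ℓ := by
    intro w hw h1 h2
    refine Summable.of_nonneg_of_le (fun ℓ ↦ mul_nonneg (sq_nonneg _) (hw ℓ)) (fun ℓ ↦ ?_)
      ((h1.add h2).mul_left 2)
    have : b ℓ ^ 2 ≤ 2 * (c ℓ ^ 2 + d ℓ ^ 2) := by
      simp only [hb_def]; nlinarith [sq_nonneg (c ℓ + d ℓ)]
    nlinarith [mul_le_mul_of_nonneg_right this (hw ℓ)]
  have hb0 : Summable fun ℓ ↦ b ℓ ^ 2 := by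
    simpa using hbc (fun _ ↦ 1) (fun _ ↦ zero_le_one) (by simpa using hc0) (by simpa using hd0)
  have hb1 : Summable fun ℓ : ℕ ↦ b ℓ ^ 2 * (ℓ * (ℓ + 1) : ℝ) :=
    hbc (fun ℓ ↦ ℓ * (ℓ + 1)) (fun ℓ ↦ by positivity) (summable_energy_of_succ hc) hd1
  obtain ⟨g, hgc, hg⟩ := hW.exists_continuous_modification (Real.sqrt_nonneg _)
    (norm_zonalVec_sub_le hb0 hb1)
  have hfg : ∀ x, (fun ω ↦ f x ω - g x ω) =ᵐ[P] W (zonalVec hd0 x) := by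
    intro x
    rw [← zonalVec_sub hc0 hb0 hd0 (fun ℓ ↦ sub_sub_cancel _ _) x, map_sub]
    filter_upwards [hf x, hg x, Lp.coeFn_sub (W (zonalVec hc0 x)) (W (zonalVec hb0 x))]
      with ω h1 h2 h3
    rw [h1, h2, h3, Pi.sub_apply]
  have hzero : ∀ x y : S2, r ≤ sphDist x y →
      inner ℝ (zonalVec hb0 x) (zonalVec hb0 y) = (0 : ℝ) := by
    intro x y hxy
    rw [inner_zonalVec_eq_integral hB hB hb0 hb0 hBb hBb]
    exact integral_cutoff_mul_cutoff_eq_zero hΨ hr hxy _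
  have hd0' : ENNReal.ofReal (∑' ℓ, d ℓ ^ 2) ≤ q₁ c r := by
    refine (ENNReal.ofReal_le_ofReal hdle).trans ?_
    rw [ofReal_integral_sq hA]
    exact lintegral_cutoff_le_q₁ hc hΨ hr
  refine ⟨g, hgc, hW.isGaussianProcess hg, fun x ↦ ?_, hW.isIsotropic hb0 hg,
    fun x y hxy ↦ ?_, fun x y ↦ ?_, fun x ↦ ?_⟩
  · rw [integral_congr_ae (hg x), hW.integral_eq_zero]
  · rw [hW.covariance_eq (hg x) (hg y), hzero x y hxy]
  · rw [hW.covariance_eq (hfg x) (hfg y)]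
    refine ⟨?_, fun hxy ↦ ?_⟩
    · refine le_trans (ENNReal.ofReal_le_ofReal ?_) hd0'
      have h1 := abs_real_inner_le_norm (zonalVec hd0 x) (zonalVec hd0 y)
      have h2 := norm_sq_zonalVec hd0 x
      have h3 := norm_sq_zonalVec hd0 y
      nlinarith [sq_nonneg (‖zonalVec hd0 x‖ - ‖zonalVec hd0 y‖)]
    -- Expanding d = c - b in both arguments gives K - J(x,y) - J(y,x) + 0: the (b,b) term vanishes
    -- by finite range, and the cross terms agree since they depend only on x·y.
    · set J : S2 → S2 → ℝ := fun x y ↦ ∫ z : S2, zonalSeries c (inner ℝ (x : E3) (z : E3)) *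
        ((1 - Ψ (inner ℝ (y : E3) (z : E3))) * zonalSeries c (inner ℝ (y : E3) (z : E3))) ∂area
      have hJ : ∀ x y, inner ℝ (zonalVec hc0 x) (zonalVec hb0 y) = J x y := fun x y ↦
        inner_zonalVec_eq_integral hQ hB hc0 hb0 hcQ hBb x y
      have hJle : ∀ x y, ENNReal.ofReal |J x y| ≤ _ := fun x y ↦
        ofReal_abs_integral_cross_le hc hΨ hr x y
      have hsym : J y x = J x y := by
        rw [← hJ, ← hJ, inner_zonalVec_swap]
      have hin : inner ℝ (zonalVec hd0 x) (zonalVec hd0 y) = K c (sphDist x y) - 2 * J x y := by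
        rw [← zonalVec_sub hc0 hb0 hd0 (fun ℓ ↦ sub_sub_cancel _ _) x,
          ← zonalVec_sub hc0 hb0 hd0 (fun ℓ ↦ sub_sub_cancel _ _) y, inner_sub_left, inner_sub_right,
          inner_sub_right, hzero x y hxy, ← K_sphDist_eq, hJ,
          real_inner_comm, hJ, hsym]
        ring
      have h3 : |K c (sphDist x y) - 2 * J x y| ≤ |K c (sphDist x y)| + 2 * |J x y| := by
        refine (abs_sub _ _).trans ?_
        rw [abs_mul, abs_two]
      rw [hin, q₂, mul_add]
      refine (ENNReal.ofReal_le_ofReal h3).trans ?_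
      rw [ENNReal.ofReal_add (abs_nonneg _) (by positivity), ENNReal.ofReal_mul zero_le_two,
        ENNReal.ofReal_ofNat]
      refine add_le_add ?_ ?_
      · rw [two_mul]; exact le_self_add
      · gcongr
        exact hJle x y
  · obtain ⟨G, hG, hGle⟩ := exists_isMeanSquareGradient W hd0 hd1 hfg x
    refine ⟨G, hG, hGle.trans ?_⟩
    rw [ENNReal.ofReal_mul (by norm_num), ENNReal.ofReal_ofNat, mul_assoc]
    gcongr
    refine (ENNReal.ofReal_le_ofReal hdle1).trans ?_
    rw [ofReal_integral_sq (memLp_cutGrad hc hΨ.continuous hΨ.continuous_deriv)]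
    exact lintegral_cutGrad_le_q₃ hc hΨ hr hM

end FiniteRange
end SphericalField

/-! ### Assembly with an absolute constant -/

theorem proposition3p6 :
    ∃ C : ℝ≥0, 0 < C ∧
      ∀ (c : ℕ → ℝ), Summable (fun ℓ : ℕ ↦ c ℓ ^ 2 * (ℓ : ℝ) ^ 2) →
      ∀ (Ω : Type*) [MeasurableSpace Ω] (P : Measure Ω) [IsProbabilityMeasure P]
        (a : SphericalField.HarmonicIndex → Ω → ℝ) (f : SphericalField.S2 → Ω → ℝ),
        SphericalField.IsIIDStandardGaussian a P →
        SphericalField.IsFieldSeries c a f P →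
      ∀ r ∈ Set.Icc (0 : ℝ) (Real.pi / 2),
      ∃ g : SphericalField.S2 → Ω → ℝ,
        (∀ ω, Continuous (fun x ↦ g x ω)) ∧
        IsGaussianProcess g P ∧
        (∀ x, ∫ ω, g x ω ∂P = 0) ∧
        SphericalField.IsIsotropic g P ∧
        SphericalField.IsRangeDependent r g P ∧
        (∀ x y : SphericalField.S2,
          (SphericalField.sphDist x y ≤ r →
            ENNReal.ofReal |covariance (fun ω ↦ f x ω - g x ω) (fun ω ↦ f y ω - g y ω) P|
              ≤ C * SphericalField.q₁ c r) ∧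
          (r ≤ SphericalField.sphDist x y →
            ENNReal.ofReal |covariance (fun ω ↦ f x ω - g x ω) (fun ω ↦ f y ω - g y ω) P|
              ≤ C * SphericalField.q₂ c r (SphericalField.sphDist x y))) ∧
        (∀ x : SphericalField.S2, ∃ G : Ω → SphericalField.E3,
          SphericalField.IsMeanSquareGradient (fun y ω ↦ f y ω - g y ω) P x G ∧
          ∫⁻ ω, ENNReal.ofReal (‖G ω‖ ^ 2) ∂P ≤ C * SphericalField.q₃ c r) := by
  obtain ⟨M, hM0, hM⟩ := SphericalField.exists_isCutoff
  -- The gradient bound dictates this constant; it exceeds the 1 and 2 needed for the two covariance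
  -- bounds, and M does not depend on r or c.
  have hC : ((12 * (2 + 2 * M.toNNReal) : ℝ≥0) : ℝ≥0∞) = 12 * (2 + 2 * ENNReal.ofReal M) := by
    push_cast
    rfl
  have h2 : (2 : ℝ≥0∞) ≤ 12 * (2 + 2 * ENNReal.ofReal M) := by
    calc (2 : ℝ≥0∞) ≤ 12 * 2 := by norm_num
      _ ≤ _ := by gcongr; exact le_self_add
  refine ⟨12 * (2 + 2 * M.toNNReal), by positivity, fun c hc Ω _ P _ a f ha hf r hr ↦ ?_⟩
  obtain ⟨Ψ, Ψ', hΨ, hE⟩ := hM r hr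
  have hc' := SphericalField.summable_sq_mul_succ_sq hc
  obtain ⟨g, h_cont, h_gauss, h_mean, h_iso, h_range, h_cov, h_grad⟩ :=
    (SphericalField.isIsonormal_isonormal ha).exists_finiteRange hc'
      (fun x ↦ hf.ae_eq ha (SphericalField.summable_sq_of_succ hc') x) hr hΨ hE
  refine ⟨g, h_cont, h_gauss, h_mean, h_iso, h_range, fun x y ↦ ⟨fun _ ↦ ?_, fun h ↦ ?_⟩,
    fun x ↦ ?_⟩
  · rw [hC]
    exact (h_cov x y).1.trans (le_mul_of_one_le_left zero_le (one_le_two.trans h2))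
  · rw [hC]
    refine ((h_cov x y).2 h).trans ?_
    gcongr
  · rw [hC]
    exact h_grad x
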